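/- Let $g\ge 1$, let $H=\mathbb Z^{2g}$ with its standard unimodular symplectic pairing $\theta$, and let $H_{\mathbb R}=\mathbb R^{2g}$. Let $c_1,\dots,c_{2g+1}\in H$ satisfy $\theta(c_i,c_{i+1})=\pm1$ and $\theta(c_i,c_j)=0$ for $|i-j|\ge 2$ (the homology classes, in a symplectic basis of $H_1(C_g,\mathbb Z)$, of the standard chain of $2g+1$ simple closed curves on a closed oriented surface $C_g$ of genus $g$). For $a\in H_{\mathbb R}$, $s\in\mathbb R$ put $T_a(s)x=x+s\,\theta(a,x)\,a$. Let $B_{2g+2}$ be the braid group with standard generators $t_1,\dots,t_{2g+1}$, and let $\sigma_g:B_{2g+2}\to Sp(H,\theta)$ be the homomorphism $t_i\mapsto T_{c_i}(1)$ (the action of the right-handed Dehn twists). Put $$h=t_1t_2\cdots t_{2g+1},\qquad \bar h=t_{2g+1}\cdots t_2t_1 .$$ Let $\widetilde{Sp}(H_{\mathbb R},\theta)$ be the universal covering group of $Sp(H_{\mathbb R},\theta)$, with covering map $\pi$ (elements are homotopy classes of paths starting at $1$), let $\widetilde{Sp}(H,\theta)=\pi^{-1}(Sp(H,\theta))$,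 and let $\mathrm{Exp}(x)$, for $x\in\mathfrak{sp}(H_{\mathbb R},\theta)$, be the class of the path $t\mapsto\exp(tx)$. Let $\Lambda$ be the Grassmannian of Lagrangian subspaces of $H_{\mathbb R}$, with any base point $\lambda_0$, and let $\widetilde\Lambda$ be its universal cover, on which $\widetilde{Sp}(H_{\mathbb R},\theta)$ acts. Let $\tilde\sigma_g:B_{2g+2}\to\widetilde{Sp}(H,\theta)$ be the homomorphism sending $t_i$ to the class of the path $s\mapsto T_{c_i}(s)$, $0\le s\le 1$. A $\theta$-tamed complex structure is an endomorphism $I$ of $H_{\mathbb R}$ with $I^2=-1$ such that $\gamma(u,v)=\theta(u,Iv)$ is symmetric and positive definite; $U(I)\subset Sp(H_{\mathbb R},\theta)$ is the subgroup of elements commuting with $I$, i.e. the unitary group of $\eta=\gamma+\sqrt{-1}\,\theta$. Let $d_I:\Lambda\to S^1$ be given by $d_I(u\lambda_0)=\det_{\mathbb C}(u)^2$ for $u\in U(I)$, and let $\tilde d_I:\widetilde\Lambda\to\mathbb R$ be a lift of $d_I$ through $y\mapsto e^{iy}$. Let $\widetilde{Sp}(-)$ be the set of $s\in\widetilde{Sp}(H_{\mathbb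 R},\theta)$ with $\tilde d_I(s\tilde\lambda)\le\tilde d_I(\tilde\lambda)$ for all $I$ and all $\tilde\lambda\in\widetilde\Lambda$. For $x\in\mathfrak{sp}(H_{\mathbb R},\theta)$ let $\gamma_x(u,v)=\theta(u,xv)$. We say that $s\in\widetilde{Sp}(H_{\mathbb R},\theta)$ has displacement angle $\phi$ if $s\in\widetilde{Sp}(-)$, if there are a $\theta$-tamed $I$ and an $x$ in the Lie algebra of $U(I)$ such that $\mathrm{Exp}(x)=s$ and the spectrum of $\gamma_x$ relative to the inner product $\gamma$ is contained in $(-2\pi,0]$, and if for all such $I$ and $x$ the trace of $\gamma_x$ relative to $\gamma$ satisfies $\mathrm{tr}(\gamma_x)/(2g)=\phi$. The displacement angle of a braid $b$ is that of $\tilde\sigma_g(b)$. Then $\tilde\sigma_g$ is a lift of $\sigma_g$, i.e. $\pi\circ\tilde\sigma_g=\sigma_g$, each $\tilde\sigma_g(t_i)$ acts with fixed points on $\widetilde\Lambda$, and: (i) $\sigma_g(h)$ and $\sigma_g(\bar h)$ have order $2g+2$ in $Sp(H,\theta)$, and there is a $\theta$-tamed $I$ such that $U(I)$ is a maximal compact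 subgroup of $Sp(H_{\mathbb R},\theta)$ containing both of them. (ii) $\tilde\sigma_g(h)$ and $\tilde\sigma_g(\bar h)$ are conjugate in $\widetilde{Sp}(H,\theta)$. (iii) $h$ and $\bar h$ both have displacement angle $-\pi/2$. -/

import Mathlib

namespace HyperellipticBraid

noncomputable section

/-! ### Universal covers as spaces of homotopy classes of paths -/

section UniversalCover

open ContinuousMap

theorem homotopicRel_map₂ {X Y Z T : Type*} [TopologicalSpace X] [TopologicalSpace Y]
    [TopologicalSpace Z] [TopologicalSpace T] {S : Set T} {m : Y × Z → X} (hm : Continuous m)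
    {f f' : C(T, Y)} {k k' : C(T, Z)} (hf : f.HomotopicRel f' S) (hk : k.HomotopicRel k' S) :
    (ContinuousMap.comp ⟨m, hm⟩ (f.prodMk k)).HomotopicRel
      (ContinuousMap.comp ⟨m, hm⟩ (f'.prodMk k')) S := by
  obtain ⟨F⟩ := hf
  obtain ⟨K⟩ := hk
  exact ⟨{ toFun := fun p => m (F p, K p)
           continuous_toFun := by fun_prop
           map_zero_left := fun x => by simp
           map_one_left := fun x => by simp
           prop' := fun t x hx => by
            have h1 := F.eq_fst t hx
            have h2 := K.eq_fst t hx
            simp [h1, h2] }⟩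

variable (G : Type*) [Group G] [TopologicalSpace G] [IsTopologicalGroup G]

/-- The group, under pointwise multiplication, of continuous paths `[0,1] → G` starting at `1`. -/
def pathGroup : Subgroup C(unitInterval, G) where
  carrier := {γ | γ 0 = 1}
  mul_mem' {a b} ha hb := by
    have ha' : a 0 = 1 := ha
    have hb' : b 0 = 1 := hb
    change (a * b) 0 = 1
    simp [ha', hb']
  one_mem' := rfl
  inv_mem' {a} ha := by
    have ha' : a 0 = 1 := ha
    change (a⁻¹) 0 = 1
    simp [ha']

/-- The loops at `1` that are homotopic, relative to the end points, to the constant loop. -/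
def nullLoops : Subgroup (pathGroup G) where
  carrier := {γ | (γ : C(unitInterval, G)).HomotopicRel 1 {0, 1}}
  mul_mem' {a b} ha hb := by
    have := homotopicRel_map₂ (m := fun p : G × G => p.1 * p.2) continuous_mul ha hb
    change ((a * b : pathGroup G) : C(unitInterval, G)).HomotopicRel 1 {0, 1}
    convert this using 1 <;>
    · ext x
      simp
  one_mem' := ContinuousMap.HomotopicRel.refl _
  inv_mem' {a} ha := by
    have := homotopicRel_map₂ (m := fun p : G × G => p.1⁻¹) (by fun_prop) ha ha
    change ((a⁻¹ : pathGroup G) : C(unitInterval, G)).HomotopicRel 1 {0, 1}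
    convert this using 1 <;>
    · ext x
      simp

instance nullLoops_normal : (nullLoops G).Normal where
  conj_mem a ha b := by
    have hb : (b : C(unitInterval, G)).HomotopicRel b {0, 1} :=
      ContinuousMap.HomotopicRel.refl _
    have := homotopicRel_map₂ (m := fun p : G × G => p.2 * p.1 * p.2⁻¹) (by fun_prop) ha hb
    change ((b * a * b⁻¹ : pathGroup G) : C(unitInterval, G)).HomotopicRel 1 {0, 1}
    convert this using 1 <;>
    · ext x
      simp

/-- The universal covering group of a (connected, locally contractible) topological group `G`:
homotopy classes, relative to the end points, of paths in `G` starting at `1`, with the group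
structure induced by pointwise multiplication of paths.  (Two paths `γ`, `δ` from `1` are
homotopic relative to the end points if and only if `γ⁻¹ δ` is a null-homotopic loop.) -/
abbrev UniversalCover : Type _ := pathGroup G ⧸ nullLoops G

variable {G}

theorem homotopicRel_iff_inv_mul_mem (γ δ : pathGroup G) :
    γ⁻¹ * δ ∈ nullLoops G ↔
      (γ : C(unitInterval, G)).HomotopicRel (δ : C(unitInterval, G)) {0, 1} := by
  have hγ : (γ : C(unitInterval, G)).HomotopicRel γ {0, 1} := ContinuousMap.HomotopicRel.refl _
  constructor
  · intro h
    have := homotopicRel_map₂ (m := fun p : G × G => p.1 * p.2) continuous_mul hγ h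
    refine ContinuousMap.HomotopicRel.symm ?_
    convert this using 1 <;>
    · ext x
      simp
  · intro h
    change ((γ⁻¹ * δ : pathGroup G) : C(unitInterval, G)).HomotopicRel 1 {0, 1}
    have h2 := homotopicRel_map₂ (m := fun p : G × G => p.1⁻¹ * p.2) (by fun_prop) hγ h.symm
    convert h2 using 1 <;>
    · ext x
      simp

/-- The class in the universal covering group of a path starting at `1`. -/
def UniversalCover.mk (γ : C(unitInterval, G)) (h : γ 0 = 1) : UniversalCover G :=
  QuotientGroup.mk (⟨γ, h⟩ : pathGroup G)

/-- The covering homomorphism: the end point of a class of paths. -/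
def UniversalCover.proj : UniversalCover G →* G :=
  QuotientGroup.lift (nullLoops G)
    { toFun := fun γ => (γ : C(unitInterval, G)) 1
      map_one' := rfl
      map_mul' := fun _ _ => rfl }
    (fun _ h => h.fst_eq_snd (x := (1 : unitInterval)) (by simp))

variable (X : Type*) [TopologicalSpace X]

/-- Paths in `X` starting at `x₀`. -/
abbrev BasedPath (x₀ : X) : Type _ := {ℓ : C(unitInterval, X) // ℓ 0 = x₀}

/-- Homotopy relative to the end points, for paths starting at `x₀`. -/
instance basedPathSetoid (x₀ : X) : Setoid (BasedPath X x₀) where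
  r ℓ m := (ℓ : C(unitInterval, X)).HomotopicRel m {0, 1}
  iseqv := ⟨fun _ => ContinuousMap.HomotopicRel.refl _, fun h => h.symm, fun h k => h.trans k⟩

/-- The universal cover of a (connected, locally contractible) space `X` with base point `x₀`:
homotopy classes, relative to the end points, of paths in `X` starting at `x₀`. -/
def UniversalCoverAt (x₀ : X) : Type _ := Quotient (basedPathSetoid X x₀)

variable {X} [MulAction G X] [ContinuousSMul G X]

/-- The lift to the universal covers of a continuous action of `G` on `X`: the path `γ` acts on
the path `ℓ` by `t ↦ γ t • ℓ t`. -/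
instance universalCoverAction (x₀ : X) :
    MulAction (UniversalCover G) (UniversalCoverAt X x₀) where
  smul := Quotient.map₂
    (fun (γ : pathGroup G) (ℓ : BasedPath X x₀) =>
      (⟨⟨fun t => (γ : C(unitInterval, G)) t • (ℓ : C(unitInterval, X)) t, by fun_prop⟩, by
        have h : (γ : C(unitInterval, G)) 0 = 1 := γ.2
        simp [h, ℓ.2]⟩ : BasedPath X x₀))
    (by
      intro γ γ' hγ ℓ ℓ' hℓ
      have h1 := (homotopicRel_iff_inv_mul_mem γ γ').1 (QuotientGroup.leftRel_apply.1 hγ)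
      exact homotopicRel_map₂ (m := fun p : G × X => p.1 • p.2) continuous_smul h1 hℓ)
  one_smul := by
    rintro ⟨ℓ⟩
    refine congrArg (Quotient.mk _) (Subtype.ext (ContinuousMap.ext fun t => ?_))
    exact one_smul G _
  mul_smul := by
    rintro ⟨γ⟩ ⟨δ⟩ ⟨ℓ⟩
    refine congrArg (Quotient.mk _) (Subtype.ext (ContinuousMap.ext fun t => ?_))
    exact mul_smul _ _ _

end UniversalCover

/-! ### The symplectic lattice and the symplectic groups -/

section Symplectic

open Matrix

variable {g : ℕ} {R : Type*} [CommRing R]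

/-- The standard unimodular symplectic pairing on `R^{2g}`: the coordinates indexed by `Sum.inl i`
and `Sum.inr i` are those with respect to a symplectic basis `a_i`, `b_i`, `θ(a_i, b_i) = 1`. -/
def theta (u v : Fin g ⊕ Fin g → R) : R :=
  ∑ i, (u (Sum.inl i) * v (Sum.inr i) - u (Sum.inr i) * v (Sum.inl i))

theorem theta_eq (u v : Fin g ⊕ Fin g → R) : theta u v = -(u ⬝ᵥ (J (Fin g) R *ᵥ v)) := by
  simp [theta, J, dotProduct, Fintype.sum_sum_type, fromBlocks_mulVec, Matrix.neg_mulVec,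
    Finset.sum_sub_distrib, Function.comp_def]
  ring

theorem theta_add_right (u v w : Fin g ⊕ Fin g → R) :
    theta u (v + w) = theta u v + theta u w := by
  simp [theta_eq, mulVec_add, add_comm]

theorem theta_smul_right (s : R) (u v : Fin g ⊕ Fin g → R) :
    theta u (s • v) = s * theta u v := by
  simp [theta_eq, mulVec_smul]

theorem theta_skew (u v : Fin g ⊕ Fin g → R) : theta u v = -theta v u := by
  simp only [theta, ← Finset.sum_neg_distrib]
  exact Finset.sum_congr rfl fun i _ => by ring

theorem theta_self (u : Fin g ⊕ Fin g → R) : theta u u = 0 := by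
  simp only [theta]
  exact Finset.sum_eq_zero fun i _ => by ring

theorem theta_add_left (u v w : Fin g ⊕ Fin g → R) :
    theta (u + v) w = theta u w + theta v w := by
  rw [theta_skew, theta_add_right, theta_skew w u, theta_skew w v]; ring

theorem theta_smul_left (s : R) (u v : Fin g ⊕ Fin g → R) :
    theta (s • u) v = s * theta u v := by
  rw [theta_skew, theta_smul_right, theta_skew v u]; ring

/-- `Matrix.symplecticGroup` is the group of matrices preserving `theta`. -/
theorem mem_symplecticGroup_iff (A : Matrix (Fin g ⊕ Fin g) (Fin g ⊕ Fin g) R) :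
    A ∈ symplecticGroup (Fin g) R ↔ ∀ u v, theta (A *ᵥ u) (A *ᵥ v) = theta u v := by
  have key : ∀ u v, theta (A *ᵥ u) (A *ᵥ v) = -(u ⬝ᵥ ((Aᵀ * J (Fin g) R * A) *ᵥ v)) := by
    intro u v
    rw [theta_eq, ← Matrix.mulVec_mulVec, ← Matrix.mulVec_mulVec, Matrix.dotProduct_mulVec u,
      Matrix.vecMul_transpose]
  rw [SymplecticGroup.mem_iff']
  constructor
  · intro h u v
    rw [key, h, theta_eq]
  · intro h
    ext i j
    have := h (Pi.single i 1) (Pi.single j 1)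
    rw [key, theta_eq, neg_inj] at this
    simpa using this

/-- The matrix of the transvection `T_a(s) : x ↦ x + s θ(a, x) a`. -/
def transvectionMatrix (a : Fin g ⊕ Fin g → R) (s : R) :
    Matrix (Fin g ⊕ Fin g) (Fin g ⊕ Fin g) R :=
  1 + s • vecMulVec a (fun j => theta a (Pi.single j 1))

theorem transvectionMatrix_mulVec (a : Fin g ⊕ Fin g → R) (s : R) (x : Fin g ⊕ Fin g → R) :
    transvectionMatrix a s *ᵥ x = x + (s * theta a x) • a := by
  have h : (fun j => theta a (Pi.single j 1)) ⬝ᵥ x = theta a x := by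
    have : (fun j => theta a (Pi.single j 1)) = -(a ᵥ* J (Fin g) R) := by
      ext j
      simp only [theta_eq, Matrix.dotProduct_mulVec, dotProduct_single, mul_one, Pi.neg_apply]
    rw [this, theta_eq, Matrix.dotProduct_mulVec, neg_dotProduct]
  rw [transvectionMatrix, add_mulVec, one_mulVec, smul_mulVec, vecMulVec_mulVec, h]
  ext i
  simp [mul_comm, mul_left_comm]

theorem transvectionMatrix_mem (a : Fin g ⊕ Fin g → R) (s : R) :
    transvectionMatrix a s ∈ symplecticGroup (Fin g) R := by
  rw [mem_symplecticGroup_iff]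
  intro u v
  simp only [transvectionMatrix_mulVec, theta_add_left, theta_add_right, theta_smul_left,
    theta_smul_right, theta_self, theta_skew u a]
  ring

/-- The symplectic transvection `T_a(s) : x ↦ x + s θ(a, x) a`. -/
def transvection (a : Fin g ⊕ Fin g → R) (s : R) : symplecticGroup (Fin g) R :=
  ⟨transvectionMatrix a s, transvectionMatrix_mem a s⟩

theorem symplectic_ext {A B : symplecticGroup (Fin g) R}
    (h : ∀ x, (A : Matrix (Fin g ⊕ Fin g) (Fin g ⊕ Fin g) R) *ᵥ x =
      (B : Matrix (Fin g ⊕ Fin g) (Fin g ⊕ Fin g) R) *ᵥ x) : A = B :=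
  Subtype.ext (Matrix.mulVec_injective (funext h))

theorem conj_transvection (A : symplecticGroup (Fin g) R) (a : Fin g ⊕ Fin g → R) (s : R) :
    A * transvection a s * A⁻¹ =
      transvection ((A : Matrix (Fin g ⊕ Fin g) (Fin g ⊕ Fin g) R) *ᵥ a) s := by
  rw [mul_inv_eq_iff_eq_mul]
  refine symplectic_ext fun x => ?_
  have hA := (mem_symplecticGroup_iff _).1 A.2
  simp only [transvection, Submonoid.coe_mul, ← Matrix.mulVec_mulVec, transvectionMatrix_mulVec,
    Matrix.mulVec_add, Matrix.mulVec_smul, hA]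

theorem transvection_neg (a : Fin g ⊕ Fin g → R) (s : R) :
    transvection (-a) s = transvection a s := by
  refine symplectic_ext fun x => ?_
  have : -a = (-1 : R) • a := by simp
  simp only [transvection, transvectionMatrix_mulVec, this, theta_smul_left, smul_smul]
  congr 2
  ring

theorem transvection_zero (a : Fin g ⊕ Fin g → R) : transvection a (0 : R) = 1 := by
  refine symplectic_ext fun x => ?_
  simp [transvection, transvectionMatrix_mulVec]

/-- The vectors `c_1, …, c_{2g+1}` of the lattice `ℤ^{2g}` have the intersection numbers of the
homology classes of the standard chain of simple closed curves on a closed oriented surface of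
genus `g`: consecutive curves meet exactly once, all others are disjoint. -/
def IsChain (c : Fin (2 * g + 1) → Fin g ⊕ Fin g → ℤ) : Prop :=
  (∀ i j : Fin (2 * g + 1), (i : ℕ) + 1 = j →
    theta (c i) (c j) = 1 ∨ theta (c i) (c j) = -1) ∧
  (∀ i j : Fin (2 * g + 1), (i : ℕ) + 1 < j → theta (c i) (c j) = 0)

/-- Extension of scalars from `ℤ^{2g}` to `ℝ^{2g}`. -/
def toReal (v : Fin g ⊕ Fin g → ℤ) : Fin g ⊕ Fin g → ℝ := fun k => (v k : ℝ)

theorem theta_toReal (u v : Fin g ⊕ Fin g → ℤ) :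
    theta (toReal u) (toReal v) = ((theta u v : ℤ) : ℝ) := by
  simp [theta, toReal]

/-- The inclusion `Sp(2g, ℤ) → Sp(2g, ℝ)`. -/
def spIntToReal (g : ℕ) : symplecticGroup (Fin g) ℤ →* symplecticGroup (Fin g) ℝ where
  toFun A := ⟨(A : Matrix (Fin g ⊕ Fin g) (Fin g ⊕ Fin g) ℤ).map (Int.castRingHom ℝ),
    SymplecticGroup.map_mem A.2 (Int.castRingHom ℝ)⟩
  map_one' := Subtype.ext (by simp)
  map_mul' A B := Subtype.ext (Matrix.map_mul (f := Int.castRingHom ℝ))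

end Symplectic

/-! ### Braid groups -/

section Braid

/-- The relations of the Artin braid group of the Dynkin graph `A_n`, with generators indexed by
`Fin n`. -/
def braidRelations (n : ℕ) : Set (FreeGroup (Fin n)) :=
  {r | ∃ i j : Fin n, (i : ℕ) + 1 < j ∧
    r = FreeGroup.of i * FreeGroup.of j * (FreeGroup.of j * FreeGroup.of i)⁻¹} ∪
  {r | ∃ i j : Fin n, (i : ℕ) + 1 = j ∧
    r = FreeGroup.of i * FreeGroup.of j * FreeGroup.of i *
      (FreeGroup.of j * FreeGroup.of i * FreeGroup.of j)⁻¹}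

/-- The braid group on `n + 1` strands, with standard generators `t_1, …, t_n`. -/
abbrev BraidGroup (n : ℕ) : Type := PresentedGroup (braidRelations n)

/-- The standard generator `t_{i+1}` of the braid group (`i = 0, …, n - 1`). -/
def braidGen {n : ℕ} (i : Fin n) : BraidGroup n := PresentedGroup.of i

/-- The braid `h = t_1 t_2 ⋯ t_n`. -/
def braidH (n : ℕ) : BraidGroup n := (List.ofFn fun i : Fin n => braidGen i).prod

/-- The braid `h̄ = t_n ⋯ t_2 t_1`. -/
def braidHBar (n : ℕ) : BraidGroup n := (List.ofFn fun i : Fin n => braidGen i.rev).prod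

/-- A homomorphism out of the braid group, from elements satisfying the braid relations. -/
def braidLift {n : ℕ} {G : Type*} [Group G] (f : Fin n → G)
    (h₁ : ∀ i j : Fin n, (i : ℕ) + 1 < j → f i * f j = f j * f i)
    (h₂ : ∀ i j : Fin n, (i : ℕ) + 1 = j → f i * f j * f i = f j * f i * f j) :
    BraidGroup n →* G :=
  PresentedGroup.toGroup (f := f) (rels := braidRelations n) (by
    rintro r (⟨i, j, hij, rfl⟩ | ⟨i, j, hij, rfl⟩)
    · simp only [map_mul, map_inv, FreeGroup.lift_apply_of]
      rw [h₁ i j hij]; group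
    · simp only [map_mul, map_inv, FreeGroup.lift_apply_of]
      rw [h₂ i j hij]; group)

@[simp] theorem braidLift_gen {n : ℕ} {G : Type*} [Group G] (f : Fin n → G)
    (h₁ : ∀ i j : Fin n, (i : ℕ) + 1 < j → f i * f j = f j * f i)
    (h₂ : ∀ i j : Fin n, (i : ℕ) + 1 = j → f i * f j * f i = f j * f i * f j) (i : Fin n) :
    braidLift f h₁ h₂ (braidGen i) = f i :=
  PresentedGroup.toGroup.of _

end Braid

/-! ### The symplectic representation of the braid group and its lift -/

section Representation

open Matrix

variable {g : ℕ}

/-- A family `F` of homomorphic images of transvections, indexed by vectors, that is compatible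
with conjugation satisfies the braid relations along a chain. -/
theorem braid_commute {R : Type*} [CommRing R] {G : Type*} [Group G]
    (F : (Fin g ⊕ Fin g → R) → G)
    (hconj : ∀ a b, F a * F b * (F a)⁻¹ = F (b + theta a b • a)) (a b : Fin g ⊕ Fin g → R)
    (h : theta a b = 0) : F a * F b = F b * F a := by
  have := hconj a b
  rw [h, zero_smul, add_zero] at this
  exact mul_inv_eq_iff_eq_mul.1 this

theorem braid_braid {R : Type*} [CommRing R] {G : Type*} [Group G]
    (F : (Fin g ⊕ Fin g → R) → G)
    (hconj : ∀ a b, F a * F b * (F a)⁻¹ = F (b + theta a b • a))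
    (hneg : ∀ a, F (-a) = F a) (a b : Fin g ⊕ Fin g → R)
    (h : theta a b = 1 ∨ theta a b = -1) : F a * F b * F a = F b * F a * F b := by
  have h1 := hconj b a
  have h2 := hconj a (a + theta b a • b)
  rw [← h1] at h2
  have hv : (a + theta b a • b) + theta a (a + theta b a • b) • a = theta b a • b := by
    rw [theta_add_right, theta_smul_right, theta_self, theta_skew b a]
    rcases h with h | h <;> simp [h]
  have hb : F (theta b a • b) = F b := by
    rw [theta_skew b a]
    rcases h with h | h <;> simp [h, hneg]
  rw [hv, hb] at h2
  have h3 := congrArg (fun x => x * (F a * F b)) h2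
  simpa [mul_assoc] using h3

/-- The symplectic representation `σ_g : B_{2g+2} → Sp(2g, ℤ)`, sending `t_i` to the action
`T_{c_i}(1) : x ↦ x + θ(c_i, x) c_i` on homology of the right-handed Dehn twist along the `i`-th
curve of the chain. -/
def sigma (c : Fin (2 * g + 1) → Fin g ⊕ Fin g → ℤ) (hc : IsChain c) :
    BraidGroup (2 * g + 1) →* symplecticGroup (Fin g) ℤ :=
  have hconj : ∀ a b : Fin g ⊕ Fin g → ℤ, transvection a (1 : ℤ) * transvection b (1 : ℤ) *
      (transvection a (1 : ℤ))⁻¹ = transvection (b + theta a b • a) (1 : ℤ) := fun a b => by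
    rw [conj_transvection]
    congr 1
    simp [transvection, transvectionMatrix_mulVec]
  braidLift (fun i => transvection (c i) (1 : ℤ))
    (fun i j hij => braid_commute (fun a => transvection a (1 : ℤ)) hconj _ _ (hc.2 i j hij))
    (fun i j hij => braid_braid (fun a => transvection a (1 : ℤ)) hconj
      (fun a => transvection_neg a 1) _ _ (hc.1 i j hij))

instance symplectic_isTopologicalGroup (g : ℕ) :
    IsTopologicalGroup (symplecticGroup (Fin g) ℝ) where
  continuous_inv := by
    refine continuous_induced_rng.2 ?_
    change Continuous fun A : symplecticGroup (Fin g) ℝ =>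
      (-J (Fin g) ℝ) * (A : Matrix (Fin g ⊕ Fin g) (Fin g ⊕ Fin g) ℝ)ᵀ * J (Fin g) ℝ
    fun_prop

/-- The universal covering group of `Sp(2g, ℝ)`. -/
abbrev SpTilde (g : ℕ) : Type := UniversalCover (symplecticGroup (Fin g) ℝ)

theorem continuous_transvection :
    Continuous fun p : (Fin g ⊕ Fin g → ℝ) × ℝ => transvection p.1 p.2 := by
  refine continuous_induced_rng.2 ?_
  change Continuous fun p : (Fin g ⊕ Fin g → ℝ) × ℝ => transvectionMatrix p.1 p.2
  refine continuous_matrix fun i j => ?_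
  simp only [transvectionMatrix, theta, Matrix.add_apply, Matrix.smul_apply, vecMulVec_apply]
  fun_prop

/-- The path `s ↦ T_a(s)`, `0 ≤ s ≤ 1`, in `Sp(2g, ℝ)`. -/
def transvectionPath (a : Fin g ⊕ Fin g → ℝ) :
    C(unitInterval, symplecticGroup (Fin g) ℝ) :=
  ⟨fun s => transvection a (s : ℝ),
    continuous_transvection.comp (continuous_const.prodMk continuous_subtype_val)⟩

/-- The canonical lift of the transvection `T_a(1)` to the universal covering group: the class of
the path `s ↦ T_a(s)`. It acts with fixed points on the universal cover of the Lagrangian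
Grassmannian. -/
def transvectionLift (a : Fin g ⊕ Fin g → ℝ) : SpTilde g :=
  UniversalCover.mk (transvectionPath a) (by simp [transvectionPath, transvection_zero])

theorem transvectionLift_neg (a : Fin g ⊕ Fin g → ℝ) :
    transvectionLift (-a) = transvectionLift a := by
  simp only [transvectionLift, transvectionPath, transvection_neg]

theorem conj_transvectionLift (a b : Fin g ⊕ Fin g → ℝ) :
    transvectionLift a * transvectionLift b * (transvectionLift a)⁻¹ =
      transvectionLift (b + theta a b • a) := by
  refine (QuotientGroup.eq.2 ((homotopicRel_iff_inv_mul_mem _ _).2 ?_))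
  refine ⟨{ toFun := fun p => transvection (b + ((max p.1 p.2 : unitInterval) * theta a b) • a)
              ((p.2 : unitInterval) : ℝ)
            continuous_toFun := by
              have hc : Continuous fun p : unitInterval × unitInterval =>
                  ((b + (((max p.1 p.2 : unitInterval) : ℝ) * theta a b) • a,
                    ((p.2 : unitInterval) : ℝ)) : (Fin g ⊕ Fin g → ℝ) × ℝ) := by
                fun_prop
              exact continuous_transvection.comp hc
            map_zero_left := fun t => ?_
            map_one_left := fun t => ?_
            prop' := fun r t ht => ?_ }⟩
  · have h0 : max (0 : unitInterval) t = t := max_eq_right t.2.1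
    change transvection _ _ = transvection a (t : ℝ) * transvection b (t : ℝ) *
      (transvection a (t : ℝ))⁻¹
    rw [conj_transvection]
    simp only [transvection, transvectionMatrix_mulVec, h0]
  · have h1 : max (1 : unitInterval) t = 1 := max_eq_left t.2.2
    change transvection _ _ = transvection _ (t : ℝ)
    simp only [h1, Set.Icc.coe_one, one_mul]
  · change transvection (b + _ • a) (t : ℝ) = transvection a (t : ℝ) * transvection b (t : ℝ) *
      (transvection a (t : ℝ))⁻¹
    rw [conj_transvection]
    rcases ht with rfl | ht
    · simp [transvection_zero]
    · obtain rfl : t = 1 := ht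
      have h1 : max r (1 : unitInterval) = 1 := max_eq_right r.2.2
      simp only [transvection, transvectionMatrix_mulVec, h1]

/-- The lift `σ̃_g : B_{2g+2} → S̃p(2g, ℝ)` of `σ_g`, sending `t_i` to the canonical lift of the
transvection `σ_g(t_i)`. -/
def sigmaTilde (c : Fin (2 * g + 1) → Fin g ⊕ Fin g → ℤ) (hc : IsChain c) :
    BraidGroup (2 * g + 1) →* SpTilde g :=
  braidLift (fun i => transvectionLift (toReal (c i)))
    (fun i j hij => braid_commute transvectionLift conj_transvectionLift _ _ (by
      rw [theta_toReal, hc.2 i j hij, Int.cast_zero]))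
    (fun i j hij => braid_braid transvectionLift conj_transvectionLift
      transvectionLift_neg _ _ (by
        rw [theta_toReal]
        rcases hc.1 i j hij with h | h <;> simp [h]))

/-- The group `S̃p(H, θ)`: the preimage in the universal covering group
of the integral symplectic group. -/
def spTildeInt (g : ℕ) : Subgroup (SpTilde g) :=
  (spIntToReal g).range.comap UniversalCover.proj

end Representation

/-! ### The Lagrangian Grassmannian -/

section Lagrangian

open Matrix

variable {g : ℕ}

theorem theta_sum_right {ι : Type*} (s : Finset ι) (u : Fin g ⊕ Fin g → ℝ)
    (f : ι → Fin g ⊕ Fin g → ℝ) (b : ι → ℝ) :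
    theta u (∑ j ∈ s, b j • f j) = ∑ j ∈ s, b j * theta u (f j) := by
  classical
  induction s using Finset.induction_on with
  | empty => simp [theta]
  | insert j s hj ih => rw [Finset.sum_insert hj, Finset.sum_insert hj, theta_add_right,
      theta_smul_right, ih]

theorem theta_sum_left {ι : Type*} (s : Finset ι) (u : Fin g ⊕ Fin g → ℝ)
    (f : ι → Fin g ⊕ Fin g → ℝ) (b : ι → ℝ) :
    theta (∑ j ∈ s, b j • f j) u = ∑ j ∈ s, b j * theta (f j) u := by
  rw [theta_skew, theta_sum_right, ← Finset.sum_neg_distrib]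
  exact Finset.sum_congr rfl fun j _ => by rw [theta_skew u]; ring

variable (g) in
/-- Lagrangian frames: bases of Lagrangian subspaces of `(ℝ^{2g}, θ)`. -/
abbrev LagrangianFrame : Type :=
  {f : Fin g → Fin g ⊕ Fin g → ℝ // LinearIndependent ℝ f ∧ ∀ i j, theta (f i) (f j) = 0}

variable (g) in
/-- The Lagrangian Grassmannian of `(ℝ^{2g}, θ)`: the set of `g`-dimensional subspaces on which
`θ` vanishes. -/
def Lagrangian : Type :=
  {W : Submodule ℝ (Fin g ⊕ Fin g → ℝ) // Module.finrank ℝ W = g ∧ ∀ u ∈ W, ∀ v ∈ W, theta u v = 0}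

/-- The Lagrangian subspace spanned by a Lagrangian frame. -/
def LagrangianFrame.span (f : LagrangianFrame g) : Lagrangian g :=
  ⟨Submodule.span ℝ (Set.range f.1), by
    rw [finrank_span_eq_card f.2.1, Fintype.card_fin], by
    intro u hu v hv
    obtain ⟨a, rfl⟩ := (Submodule.mem_span_range_iff_exists_fun ℝ).1 hu
    obtain ⟨b, rfl⟩ := (Submodule.mem_span_range_iff_exists_fun ℝ).1 hv
    simp [theta_sum_right, theta_sum_left, f.2.2]⟩

/-- The topology of the Lagrangian Grassmannian, as a quotient of the space of Lagrangian
frames. -/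
instance : TopologicalSpace (Lagrangian g) :=
  TopologicalSpace.coinduced LagrangianFrame.span inferInstance

theorem LagrangianFrame.span_surjective :
    Function.Surjective (LagrangianFrame.span : LagrangianFrame g → Lagrangian g) := by
  rintro ⟨W, hW, hθ⟩
  let b := Module.finBasisOfFinrankEq ℝ W hW
  refine ⟨⟨fun i => (b i : Fin g ⊕ Fin g → ℝ), ?_, fun i j => hθ _ (b i).2 _ (b j).2⟩, ?_⟩
  · exact b.linearIndependent.map' W.subtype W.ker_subtype
  · refine Subtype.ext ?_
    change Submodule.span ℝ (Set.range (W.subtype ∘ b)) = W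
    rw [Set.range_comp, Submodule.span_image, b.span_eq, Submodule.map_top, Submodule.range_subtype]

/-- A chosen frame of a Lagrangian subspace. -/
def Lagrangian.frame (lam : Lagrangian g) : LagrangianFrame g :=
  (LagrangianFrame.span_surjective lam).choose

theorem Lagrangian.span_frame (lam : Lagrangian g) : lam.frame.span = lam :=
  (LagrangianFrame.span_surjective lam).choose_spec

/-- Two frames of the same Lagrangian subspace differ by a matrix. -/
theorem LagrangianFrame.exists_matrix {f f' : LagrangianFrame g} (h : f.span = f'.span) :
    ∃ B : Matrix (Fin g) (Fin g) ℝ, ∀ i, f'.1 i = ∑ j, B j i • f.1 j := by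
  have hs : Submodule.span ℝ (Set.range f.1) = Submodule.span ℝ (Set.range f'.1) :=
    congrArg Subtype.val h
  have : ∀ i, ∃ b : Fin g → ℝ, ∑ j, b j • f.1 j = f'.1 i := fun i =>
    (Submodule.mem_span_range_iff_exists_fun ℝ).1
      (hs ▸ Submodule.subset_span (Set.mem_range_self i))
  choose b hb using this
  exact ⟨fun j i => b i j, fun i => (hb i).symm⟩

theorem LagrangianFrame.isOpenQuotientMap_span :
    IsOpenQuotientMap (LagrangianFrame.span : LagrangianFrame g → Lagrangian g) := by
  refine ⟨LagrangianFrame.span_surjective, continuous_coinduced_rng, ?_⟩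
  intro U hU
  obtain ⟨O, hO, rfl⟩ := isOpen_induced_iff.1 hU
  refine isOpen_coinduced.2 (isOpen_iff_mem_nhds.2 ?_)
  rintro f ⟨f', hf', hff'⟩
  obtain ⟨B, hB⟩ := LagrangianFrame.exists_matrix hff'.symm
  let m : (Fin g → Fin g ⊕ Fin g → ℝ) → (Fin g → Fin g ⊕ Fin g → ℝ) :=
    fun k i => ∑ j, B j i • k j
  have hm : Continuous m := by fun_prop
  have hmf : m f.1 = f'.1 := funext fun i => (hB i).symm
  have hopen : IsOpen (m ⁻¹' (O ∩ {k | LinearIndependent ℝ k})) :=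
    (hO.inter isOpen_setOfPred_linearIndependent).preimage hm
  have hmem : Subtype.val ⁻¹' (m ⁻¹' (O ∩ {k | LinearIndependent ℝ k})) ∈ nhds f :=
    (hopen.preimage continuous_subtype_val).mem_nhds (by
      change m f.1 ∈ O ∩ {k | LinearIndependent ℝ k}
      rw [hmf]
      exact ⟨hf', f'.2.1⟩)
  refine Filter.mem_of_superset hmem ?_
  rintro k ⟨hk1, hk2⟩
  refine ⟨⟨m k.1, hk2, fun i j => ?_⟩, hk1, ?_⟩
  · simp [m, theta_sum_right, theta_sum_left, k.2.2]
  · refine Subtype.ext ?_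
    change Submodule.span ℝ (Set.range (m k.1)) = Submodule.span ℝ (Set.range k.1)
    refine Submodule.eq_of_le_of_finrank_eq (Submodule.span_le.2 ?_) ?_
    · rintro _ ⟨i, rfl⟩
      exact Submodule.sum_mem _ fun j _ =>
        Submodule.smul_mem _ _ (Submodule.subset_span (Set.mem_range_self j))
    · rw [finrank_span_eq_card hk2, finrank_span_eq_card k.2.1]

/-- The natural action of `Sp(2g, ℝ)` on the Lagrangian Grassmannian. -/
instance : MulAction (symplecticGroup (Fin g) ℝ) (Lagrangian g) where
  smul A W := ⟨W.1.map (mulVecLin A.1), by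
    have hinj : Function.Injective (mulVecLin A.1) :=
      Matrix.mulVec_injective_of_isUnit
        ((Matrix.isUnit_iff_isUnit_det _).2 (SymplecticGroup.symplectic_det A.2))
    exact (Submodule.equivMapOfInjective _ hinj W.1).finrank_eq.symm.trans W.2.1, by
    rintro _ ⟨u, hu, rfl⟩ _ ⟨v, hv, rfl⟩
    rw [mulVecLin_apply, mulVecLin_apply, (mem_symplecticGroup_iff _).1 A.2]
    exact W.2.2 u hu v hv⟩
  one_smul W := Subtype.ext (by
    change W.1.map (mulVecLin 1) = W.1
    rw [mulVecLin_one, Submodule.map_id])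
  mul_smul A B W := Subtype.ext (by
    change W.1.map (mulVecLin (A.1 * B.1)) = (W.1.map (mulVecLin B.1)).map (mulVecLin A.1)
    rw [mulVecLin_mul, Submodule.map_comp])

instance : ContinuousSMul (symplecticGroup (Fin g) ℝ) (Lagrangian g) where
  continuous_smul := by
    rw [← (IsOpenQuotientMap.id.prodMap
      (LagrangianFrame.isOpenQuotientMap_span (g := g))).continuous_comp_iff]
    have hinj : ∀ A : symplecticGroup (Fin g) ℝ, LinearMap.ker (mulVecLin A.1) = ⊥ := fun A =>
      LinearMap.ker_eq_bot.2 (Matrix.mulVec_injective_of_isUnit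
        ((Matrix.isUnit_iff_isUnit_det _).2 (SymplecticGroup.symplectic_det A.2)))
    let a : symplecticGroup (Fin g) ℝ × LagrangianFrame g → LagrangianFrame g := fun p =>
      ⟨fun i => p.1.1 *ᵥ p.2.1 i, p.2.2.1.map' (mulVecLin p.1.1) (hinj p.1), fun i j => by
        rw [(mem_symplecticGroup_iff _).1 p.1.2, p.2.2.2]⟩
    have ha : Continuous a := by
      refine continuous_induced_rng.2 (continuous_pi fun i => ?_)
      change Continuous fun p : symplecticGroup (Fin g) ℝ × LagrangianFrame g => p.1.1 *ᵥ p.2.1 i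
      exact Continuous.matrix_mulVec (by fun_prop)
        ((continuous_apply i).comp (continuous_subtype_val.comp continuous_snd))
    have : (fun p : symplecticGroup (Fin g) ℝ × Lagrangian g => p.1 • p.2) ∘
        Prod.map id LagrangianFrame.span = LagrangianFrame.span ∘ a := by
      funext p
      refine Subtype.ext ?_
      change (Submodule.span ℝ (Set.range p.2.1)).map (mulVecLin p.1.1) =
        Submodule.span ℝ (Set.range (mulVecLin p.1.1 ∘ p.2.1))
      rw [Set.range_comp, Submodule.span_image]
    rw [this]
    exact continuous_coinduced_rng.comp ha

end Lagrangian

/-! ### Complex structures, maximal compact subgroups and the determinant map -/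

section Determinant

open Matrix

variable {g : ℕ}

variable (g) in
/-- A `θ`-tamed complex structure on `ℝ^{2g}`: an endomorphism `I` with `I² = -1` for which
`γ(u, v) = θ(u, I v)` is a positive definite symmetric form. -/
structure TameStructure where
  toMatrix : Matrix (Fin g ⊕ Fin g) (Fin g ⊕ Fin g) ℝ
  sq : toMatrix * toMatrix = -1
  symm : ∀ u v, theta u (toMatrix *ᵥ v) = theta v (toMatrix *ᵥ u)
  pos : ∀ u, u ≠ 0 → 0 < theta u (toMatrix *ᵥ u)

namespace TameStructure

variable (I : TameStructure g)

/-- The positive definite Hermitian form `η = γ + √-1 θ` on the complex vector space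
`(ℝ^{2g}, I)`; it is complex linear in the second variable. -/
def eta (u v : Fin g ⊕ Fin g → ℝ) : ℂ :=
  ((theta u (I.toMatrix *ᵥ v) : ℝ) : ℂ) + ((theta u v : ℝ) : ℂ) * Complex.I

/-- The unitary group `U(ℝ^{2g}, I, η)`, as a subgroup of `Sp(2g, ℝ)`: the symplectic maps that
are complex linear. -/
def unitary : Subgroup (symplecticGroup (Fin g) ℝ) where
  carrier := {A | Commute A.1 I.toMatrix}
  mul_mem' ha hb := Commute.mul_left ha hb
  one_mem' := Commute.one_left _
  inv_mem' {A} hA := by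
    have h1 : A.1 * (A⁻¹).1 = 1 := congrArg Subtype.val (mul_inv_cancel A)
    have h2 : (A⁻¹).1 * A.1 = 1 := congrArg Subtype.val (inv_mul_cancel A)
    have hA' : A.1 * I.toMatrix = I.toMatrix * A.1 := hA
    change (A⁻¹).1 * I.toMatrix = I.toMatrix * (A⁻¹).1
    calc (A⁻¹).1 * I.toMatrix = (A⁻¹).1 * (I.toMatrix * A.1) * (A⁻¹).1 := by
          rw [Matrix.mul_assoc, Matrix.mul_assoc, h1, Matrix.mul_one]
      _ = I.toMatrix * (A⁻¹).1 := by
          rw [← hA', ← Matrix.mul_assoc, h2, Matrix.one_mul]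

theorem apply_apply (v : Fin g ⊕ Fin g → ℝ) : I.toMatrix *ᵥ (I.toMatrix *ᵥ v) = -v := by
  rw [Matrix.mulVec_mulVec, I.sq, Matrix.neg_mulVec, Matrix.one_mulVec]

/-- A Lagrangian frame is a basis of the complex vector space `(ℝ^{2g}, I)`. -/
theorem frame_injective (f : LagrangianFrame g) (p q : Fin g → ℝ)
    (h : (∑ j, p j • f.1 j) + I.toMatrix *ᵥ (∑ j, q j • f.1 j) = 0) : p = 0 ∧ q = 0 := by
  have hq : ∑ j, q j • f.1 j = 0 := by
    by_contra hne
    have h1 := I.pos _ hne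
    have h2 : theta (∑ j, q j • f.1 j)
        ((∑ j, p j • f.1 j) + I.toMatrix *ᵥ (∑ j, q j • f.1 j)) = 0 := by
      rw [h]
      simp [theta]
    rw [theta_add_right] at h2
    have h3 : theta (∑ j, q j • f.1 j) (∑ j, p j • f.1 j) = 0 := by
      simp [theta_sum_right, theta_sum_left, f.2.2]
    linarith
  have hp : ∑ j, p j • f.1 j = 0 := by
    rw [hq, Matrix.mulVec_zero, add_zero] at h
    exact h
  have hli := Fintype.linearIndependent_iff.1 f.2.1
  exact ⟨funext (hli p hp), funext (hli q hq)⟩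

theorem frame_surjective (f : LagrangianFrame g) (v : Fin g ⊕ Fin g → ℝ) :
    ∃ p q : Fin g → ℝ, (∑ j, p j • f.1 j) + I.toMatrix *ᵥ (∑ j, q j • f.1 j) = v := by
  let L : ((Fin g → ℝ) × (Fin g → ℝ)) →ₗ[ℝ] (Fin g ⊕ Fin g → ℝ) :=
    (Fintype.linearCombination ℝ f.1).coprod
      ((Matrix.mulVecLin I.toMatrix).comp (Fintype.linearCombination ℝ f.1))
  have hL : ∀ p q, L (p, q) =
      (∑ j, p j • f.1 j) + I.toMatrix *ᵥ (∑ j, q j • f.1 j) := fun p q => by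
    simp only [L, LinearMap.coprod_apply, LinearMap.comp_apply, Fintype.linearCombination_apply,
      Matrix.mulVecLin_apply]
  have hinj : Function.Injective L := by
    rw [← LinearMap.ker_eq_bot, LinearMap.ker_eq_bot']
    rintro ⟨p, q⟩ h
    rw [hL] at h
    obtain ⟨rfl, rfl⟩ := I.frame_injective f p q h
    rfl
  have hsurj := (LinearMap.injective_iff_surjective_of_finrank_eq_finrank (by simp)).1 hinj
  obtain ⟨⟨p, q⟩, h⟩ := hsurj v
  exact ⟨p, q, (hL p q).symm.trans h⟩

/-- The matrix of the frame `f` with respect to the frame `f₀`, computed by `η`. -/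
def frameMatrix (f₀ f : LagrangianFrame g) : Matrix (Fin g) (Fin g) ℂ :=
  Matrix.of fun i j => I.eta (f₀.1 i) (f.1 j)

theorem det_frameMatrix_ne_zero (f₀ f : LagrangianFrame g) : (I.frameMatrix f₀ f).det ≠ 0 := by
  intro hdet
  obtain ⟨w, hw, hw0⟩ := Matrix.exists_mulVec_eq_zero_iff.2 hdet
  let p : Fin g → ℝ := fun j => (w j).re
  let q : Fin g → ℝ := fun j => (w j).im
  set v := (∑ j, p j • f.1 j) + I.toMatrix *ᵥ (∑ j, q j • f.1 j) with hv
  have hIv : I.toMatrix *ᵥ v =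
      I.toMatrix *ᵥ (∑ j, p j • f.1 j) + (-1 : ℝ) • (∑ j, q j • f.1 j) := by
    rw [hv, Matrix.mulVec_add, I.apply_apply]
    simp
  have hI : ∀ (u : Fin g ⊕ Fin g → ℝ) (r : Fin g → ℝ),
      theta u (I.toMatrix *ᵥ ∑ j, r j • f.1 j) = ∑ j, r j * theta u (I.toMatrix *ᵥ f.1 j) := by
    intro u r
    rw [← theta_sum_right, Matrix.mulVec_sum]
    simp [Matrix.mulVec_smul]
  have h1 : ∀ i, theta (f₀.1 i) (I.toMatrix *ᵥ v) = 0 ∧ theta (f₀.1 i) v = 0 := by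
    intro i
    have hi : ∑ j, I.eta (f₀.1 i) (f.1 j) * w j = 0 := congrFun hw0 i
    constructor
    · rw [hIv, theta_add_right, theta_smul_right, hI, theta_sum_right]
      have := congrArg Complex.re hi
      simp only [eta, Complex.re_sum, Complex.mul_re, Complex.add_re, Complex.add_im,
        Complex.ofReal_re, Complex.ofReal_im, Complex.mul_im, Complex.I_re, Complex.I_im,
        Complex.zero_re] at this
      rw [Finset.mul_sum, ← Finset.sum_add_distrib]
      refine Eq.trans ?_ this
      exact Finset.sum_congr rfl fun j _ => by simp only [p, q]; ring
    · rw [hv, theta_add_right, hI, theta_sum_right]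
      have := congrArg Complex.im hi
      simp only [eta, Complex.im_sum, Complex.mul_re, Complex.add_re, Complex.add_im,
        Complex.ofReal_re, Complex.ofReal_im, Complex.mul_im, Complex.I_re, Complex.I_im,
        Complex.zero_im] at this
      rw [← Finset.sum_add_distrib]
      refine Eq.trans ?_ this
      exact Finset.sum_congr rfl fun j _ => by simp only [p, q]; ring
  obtain ⟨a, b, hab⟩ := I.frame_surjective f₀ v
  have h2 : theta v (I.toMatrix *ᵥ v) = 0 := by
    nth_rewrite 1 [← hab]
    rw [theta_add_left, theta_sum_left, I.symm, I.apply_apply, ← neg_one_smul ℝ,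
      theta_smul_right, theta_skew v, theta_sum_left]
    simp [h1]
  have hv0 : v = 0 := by
    by_contra hne
    exact (I.pos v hne).ne' h2
  obtain ⟨hp, hq⟩ := I.frame_injective f p q hv0
  exact hw (funext fun j => Complex.ext (congrFun hp j) (congrFun hq j))

end TameStructure

/-- The square `(z / |z|)²` of the phase of a nonzero complex number. -/
def phaseSq (z : ℂ) (hz : z ≠ 0) : Circle :=
  ⟨(z / (‖z‖ : ℂ)) ^ 2, mem_sphere_zero_iff_norm.2 (by
    rw [norm_pow, norm_div, Complex.norm_real, norm_norm, div_self (norm_ne_zero_iff.2 hz),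
      one_pow])⟩

namespace TameStructure

variable (I : TameStructure g)

theorem phaseSq_frameMatrix_congr (f₀ : LagrangianFrame g) {f f' : LagrangianFrame g}
    (h : f.span = f'.span) :
    phaseSq (I.frameMatrix f₀ f).det (I.det_frameMatrix_ne_zero f₀ f) =
      phaseSq (I.frameMatrix f₀ f').det (I.det_frameMatrix_ne_zero f₀ f') := by
  obtain ⟨B, hB⟩ := LagrangianFrame.exists_matrix h
  have hM : I.frameMatrix f₀ f' = I.frameMatrix f₀ f * B.map Complex.ofRealHom := by
    ext i k
    have hI : I.toMatrix *ᵥ (∑ j, B j k • f.1 j) = ∑ j, B j k • (I.toMatrix *ᵥ f.1 j) := by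
      rw [Matrix.mulVec_sum]
      simp [Matrix.mulVec_smul]
    simp only [frameMatrix, Matrix.of_apply, Matrix.mul_apply, Matrix.map_apply, eta, hB k, hI,
      theta_sum_right, Complex.ofRealHom_eq_coe, Complex.ofReal_sum, Complex.ofReal_mul,
      Finset.sum_mul]
    rw [← Finset.sum_add_distrib]
    exact Finset.sum_congr rfl fun j _ => by ring
  have hdet : (I.frameMatrix f₀ f').det = (I.frameMatrix f₀ f).det * ((B.det : ℝ) : ℂ) := by
    rw [hM, Matrix.det_mul]
    congr 1
    exact (RingHom.map_det Complex.ofRealHom B).symm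
  have hB0 : B.det ≠ 0 := fun h0 => I.det_frameMatrix_ne_zero f₀ f' (by simp [hdet, h0])
  have hsq : ((B.det : ℝ) : ℂ) ^ 2 / ((|B.det| : ℝ) : ℂ) ^ 2 = 1 := by
    rw [← Complex.ofReal_pow, ← Complex.ofReal_pow, sq_abs, div_self]
    exact_mod_cast pow_ne_zero 2 hB0
  refine Subtype.ext ?_
  simp only [phaseSq, hdet, norm_mul, Complex.norm_real, Real.norm_eq_abs, Complex.ofReal_mul,
    mul_div_mul_comm, mul_pow]
  rw [div_pow ((B.det : ℝ) : ℂ), hsq, mul_one]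

/-- The map `d_K : Λ → S¹/{±1} ≅ S¹` attached to the maximal compact subgroup `K = U(I)` and the
base point `lam₀`.  If `f₀` and `f = u(f₀)`, `u ∈ K`, are `γ`-orthonormal bases of `lam₀` and
`lam`, then the matrix `η(f₀ i, f j)` is the unitary matrix of `u` in the basis `f₀`, and the value
is `det(u)²`; the normalisation by the absolute value makes it independent of the bases. -/
def detMap (lam₀ lam : Lagrangian g) : Circle :=
  phaseSq (I.frameMatrix lam₀.frame lam.frame).det
    (I.det_frameMatrix_ne_zero lam₀.frame lam.frame)

theorem continuous_detMap (lam₀ : Lagrangian g) : Continuous (I.detMap lam₀) := by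
  refine continuous_coinduced_dom.2 ?_
  have h : I.detMap lam₀ ∘ LagrangianFrame.span = fun f =>
      phaseSq (I.frameMatrix lam₀.frame f).det (I.det_frameMatrix_ne_zero lam₀.frame f) :=
    funext fun f => I.phaseSq_frameMatrix_congr lam₀.frame f.span.span_frame
  rw [h]
  refine continuous_induced_rng.2 ?_
  have hM : Continuous fun f : LagrangianFrame g => (I.frameMatrix lam₀.frame f).det := by
    refine Continuous.matrix_det (continuous_matrix fun i j => ?_)
    have hj : Continuous fun f : LagrangianFrame g => f.1 j :=
      (continuous_apply j).comp continuous_subtype_val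
    have hθ : ∀ u : Fin g ⊕ Fin g → ℝ, Continuous fun v : Fin g ⊕ Fin g → ℝ => theta u v :=
      fun u => by
        simp only [theta]
        fun_prop
    have h1 : Continuous fun f : LagrangianFrame g =>
        theta (lam₀.frame.1 i) (I.toMatrix *ᵥ f.1 j) :=
      (hθ _).comp (Continuous.matrix_mulVec continuous_const hj)
    exact (Complex.continuous_ofReal.comp h1).add
      ((Complex.continuous_ofReal.comp ((hθ _).comp hj)).mul continuous_const)
  change Continuous fun f : LagrangianFrame g => ((I.frameMatrix lam₀.frame f).det /
    (‖(I.frameMatrix lam₀.frame f).det‖ : ℂ)) ^ 2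
  refine (hM.div (Complex.continuous_ofReal.comp hM.norm) fun f => ?_).pow 2
  exact Complex.ofReal_ne_zero.2 (norm_ne_zero_iff.2 (I.det_frameMatrix_ne_zero lam₀.frame f))

/-- A lift `d̃_K : Λ̃ → ℝ` of `d_K` to the universal cover of the Lagrangian Grassmannian: along a
path from the base point, lift `d_K` through `x ↦ e^{ix}` and take the value at the end. -/
def detLift (lam₀ : Lagrangian g) : UniversalCoverAt (Lagrangian g) lam₀ → ℝ :=
  Quotient.lift
    (fun ℓ : BasedPath (Lagrangian g) lam₀ =>
      Circle.isCoveringMap_exp.liftPath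
        ((⟨I.detMap lam₀, I.continuous_detMap lam₀⟩ : C(Lagrangian g, Circle)).comp ℓ.1)
        (Complex.arg (I.detMap lam₀ lam₀ : ℂ))
        (by
          rw [Circle.exp_arg]
          exact congrArg (I.detMap lam₀) ℓ.2) 1)
    (fun ℓ m h => Circle.isCoveringMap_exp.liftPath_apply_one_eq_of_homotopicRel
      (ContinuousMap.HomotopicRel.comp_continuousMap h _) _ _ _)

end TameStructure

/-- A maximal compact subgroup of a topological group. -/
def IsMaximalCompact {G : Type*} [Group G] [TopologicalSpace G] (K : Subgroup G) : Prop :=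
  IsCompact (K : Set G) ∧ ∀ L : Subgroup G, IsCompact (L : Set G) → K ≤ L → L = K

end Determinant

/-! ### Displacement angles -/

section Displacement

open Matrix

variable {g : ℕ}

/-- The subsemigroup `S̃p(-) = ⋂_K {s | d̃_K(s • x) ≤ d̃_K(x) for all x}` of the universal covering
group, the intersection being over all maximal compact subgroups `K = U(I)`. -/
def spTildeMinus (lam₀ : Lagrangian g) : Set (SpTilde g) :=
  {s | ∀ (I : TameStructure g) (x : UniversalCoverAt (Lagrangian g) lam₀),
    I.detLift lam₀ (s • x) ≤ I.detLift lam₀ x}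

theorem exp_mem_symplecticGroup_of (y : Matrix (Fin g ⊕ Fin g) (Fin g ⊕ Fin g) ℝ)
    (h : yᵀ * J (Fin g) ℝ = J (Fin g) ℝ * (-y)) :
    NormedSpace.exp y ∈ symplecticGroup (Fin g) ℝ := by
  have hJ : IsUnit (J (Fin g) ℝ) := (Matrix.isUnit_iff_isUnit_det _).2 (isUnit_det_J _ _)
  have hJd := isUnit_det_J (Fin g) ℝ
  have h1 : yᵀ = J (Fin g) ℝ * (-y) * (J (Fin g) ℝ)⁻¹ := by
    rw [← h, Matrix.mul_nonsing_inv_cancel_right _ _ hJd]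
  have h2 : (NormedSpace.exp y)ᵀ =
      J (Fin g) ℝ * (NormedSpace.exp y)⁻¹ * (J (Fin g) ℝ)⁻¹ := by
    rw [← Matrix.exp_transpose, h1, Matrix.exp_conj _ _ hJ, Matrix.exp_neg]
  have h3 : (NormedSpace.exp y)⁻¹ * NormedSpace.exp y = 1 :=
    Matrix.nonsing_inv_mul _ ((Matrix.isUnit_iff_isUnit_det _).1 (Matrix.isUnit_exp _))
  rw [SymplecticGroup.mem_iff', h2, Matrix.nonsing_inv_mul_cancel_right _ _ hJd, Matrix.mul_assoc,
    h3, Matrix.mul_one]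

theorem exp_mem_symplecticGroup (x : LieAlgebra.Symplectic.sp (Fin g) ℝ) (t : ℝ) :
    NormedSpace.exp (t • (x : Matrix (Fin g ⊕ Fin g) (Fin g ⊕ Fin g) ℝ)) ∈
      symplecticGroup (Fin g) ℝ := by
  have hx : (x.1)ᵀ * J (Fin g) ℝ = J (Fin g) ℝ * (-x.1) :=
    (mem_skewAdjointMatricesSubmodule (J (Fin g) ℝ) x.1).1
      ((mem_skewAdjointMatricesLieSubalgebra (J (Fin g) ℝ) x.1).1 x.2)
  refine exp_mem_symplecticGroup_of _ ?_
  rw [Matrix.transpose_smul, ← smul_neg, Matrix.mul_smul, ← hx, Matrix.smul_mul]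

/-- The exponential map of the universal covering group of `Sp(2g, ℝ)`: the class of the path
`t ↦ exp (t x)`. -/
def expTilde (x : LieAlgebra.Symplectic.sp (Fin g) ℝ) : SpTilde g :=
  UniversalCover.mk
    ⟨fun t => ⟨NormedSpace.exp ((t : ℝ) • (x : Matrix (Fin g ⊕ Fin g) (Fin g ⊕ Fin g) ℝ)),
      exp_mem_symplecticGroup x t⟩, by
      refine continuous_induced_rng.2 ?_
      change Continuous fun t : unitInterval =>
        NormedSpace.exp ((t : ℝ) • (x : Matrix (Fin g ⊕ Fin g) (Fin g ⊕ Fin g) ℝ))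
      have h : Continuous (NormedSpace.exp :
          Matrix (Fin g ⊕ Fin g) (Fin g ⊕ Fin g) ℝ → Matrix (Fin g ⊕ Fin g) (Fin g ⊕ Fin g) ℝ) :=
        open scoped Matrix.Norms.Operator in NormedSpace.exp_continuous
      exact h.comp (by fun_prop)⟩
    (Subtype.ext (by simp))

/-- The endomorphism `-I x` representing, with respect to the inner product
`γ(u, v) = θ(u, I v)`, the bilinear form `γ_x(u, v) = θ(u, x v)` of an element `x` of the Lie
algebra `sp(2g, ℝ)`: one has `γ_x(u, v) = γ(u, (-I x) v)`. -/
def gammaMatrix (I : TameStructure g) (x : LieAlgebra.Symplectic.sp (Fin g) ℝ) :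
    Matrix (Fin g ⊕ Fin g) (Fin g ⊕ Fin g) ℝ :=
  -(I.toMatrix * (x : Matrix (Fin g ⊕ Fin g) (Fin g ⊕ Fin g) ℝ))

theorem theta_gammaMatrix (I : TameStructure g) (x : LieAlgebra.Symplectic.sp (Fin g) ℝ)
    (u v : Fin g ⊕ Fin g → ℝ) :
    theta u (I.toMatrix *ᵥ (gammaMatrix I x *ᵥ v)) =
      theta u ((x : Matrix (Fin g ⊕ Fin g) (Fin g ⊕ Fin g) ℝ) *ᵥ v) := by
  rw [gammaMatrix, Matrix.neg_mulVec, Matrix.mulVec_neg, ← Matrix.mulVec_mulVec, I.apply_apply,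
    neg_neg]

/-- The elements `x` of the Lie algebra of the maximal compact subgroup `U(I)` for which the
spectrum of the form `γ_x` is contained in `(-2π, 0]`. -/
def unitaryWindow (I : TameStructure g) : Set (LieAlgebra.Symplectic.sp (Fin g) ℝ) :=
  {x | Commute (x : Matrix (Fin g ⊕ Fin g) (Fin g ⊕ Fin g) ℝ) I.toMatrix ∧
    spectrum ℝ (gammaMatrix I x) ⊆ Set.Ioc (-(2 * Real.pi)) 0}

/-- `HasDisplacementAngle lam₀ s φ`: the element `s` of the universal covering group has a
non-positive displacement angle (it lies in `S̃p(-)`), it lies in `Ũ(I)` for some maximal compact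
subgroup `U(I)` and is there the exponential of an `x` whose form `γ_x` has spectrum in `(-2π, 0]`,
and `tr(γ_x) / (2g) = φ` for every choice of such `I` and `x`. -/
def HasDisplacementAngle (lam₀ : Lagrangian g) (s : SpTilde g) (φ : ℝ) : Prop :=
  s ∈ spTildeMinus lam₀ ∧
  (∃ I : TameStructure g, ∃ x ∈ unitaryWindow I, expTilde x = s) ∧
  ∀ I : TameStructure g, ∀ x ∈ unitaryWindow I, expTilde x = s →
    (gammaMatrix I x).trace / (2 * (g : ℝ)) = φ

end Displacement

end

end HyperellipticBraid

open HyperellipticBraid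

/-! Let `A` be the image of `h` in the real symplectic group. Transvections do not see the sign of
their vector, so the chain can be normalised to vectors `d_0, …, d_{2g}` with all consecutive
pairings equal to `-1`.

The product `A` shifts this chain, `A d_k = d_{k+1}` (`chainProd_mulVec`), and `d_0 + d_2 + ⋯ +
d_{2g} = 0`; hence `A^(2g+2) = 1`. The product in the opposite order shifts back with a sign, so
`h̄` acts as `-A⁻¹` (`chainProd_mul_reverse`).

In the triangular coordinates `y` of `exists_coeff`, `-θ(u, A u)` is the positive definite form `∑
(y_i² - ε y_i y_{i+1})` of the Dynkin graph, so `θ(u, A u)` is negative definite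
(`theta_mulVec_neg`). This makes `A` unitary for an explicit `I`: `B = A⁻¹ - A` defines the inner
product `θ(u, B v)`, `C = (A + A⁻¹)/2` is self-adjoint for it with eigenvalues in `(-1, 1)`, and `I
= ½ B (1 - C²)^(-1/2)` is a tamed complex structure commuting with `A`. Moreover `A = exp x` for `x
= -I arccos C` (`exists_log`).

To see that `Exp(x)` is the lift of `h`, two paths from `1` to `A` are compared: `s ↦ T_{d_0}(s) ⋯
T_{d_{2g}}(s)` and `t ↦ exp(t x)`. Neither meets a real eigenvalue `≤ -1`
(`eq_zero_of_mulVec_eq_neg`). Symplectic matrices without such eigenvalues contract to `1` by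
scaling their Cayley transform, so the paths are homotopic (`mk_eq_of_isUnit_add_smul`).

For the angle, `h` and `h̄` are conjugate already in the braid group, so `A` is conjugate to `-A⁻¹`
and `C` to `-C`. For any logarithm in a window, negativity of `θ(u, A u)` forces the eigenvalues of
`γ_x` to be minus the arccosines of those of `C`; with `arccos(-y) = π - arccos y` the trace is
`-gπ` (`trace_gammaMatrix_log`). Finally `S̃p(-)` is a semigroup containing the lifts of
transvections: these multiply `d_I` by the squared phase of `1 - tκ` with `Im κ ≥ 0`. -/

namespace HyperellipticBraid
open Matrix

/-! ### Functional calculus for real diagonalizable matrices and commuting complex structures -/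

section LinearAlgebra
variable {n : Type*} [Fintype n] [DecidableEq n]

/-- An endomorphism that is self-adjoint for an inner product is diagonalizable. -/
theorem exists_diagonalization {G C : Matrix n n ℝ} (hG : ∀ u v, u ⬝ᵥ (G *ᵥ v) = v ⬝ᵥ (G *ᵥ u))
    (hpos : ∀ u, u ≠ 0 → 0 < u ⬝ᵥ (G *ᵥ u))
    (hC : ∀ u v, u ⬝ᵥ ((G * C) *ᵥ v) = v ⬝ᵥ ((G * C) *ᵥ u)) :
    ∃ (Q : Matrix n n ℝ) (d : n → ℝ), IsUnit Q.det ∧ C = Q * diagonal d * Q⁻¹ := by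
  have symm_of : ∀ M : Matrix n n ℝ, (∀ u v, u ⬝ᵥ (M *ᵥ v) = v ⬝ᵥ (M *ᵥ u)) → Mᵀ = M := by
    intro M hM
    ext i j
    simpa using hM (Pi.single j 1) (Pi.single i 1)
  have hGt := symm_of G hG
  have hCt := symm_of (G * C) hC
  have hP : G.PosDef := by
    refine PosDef.of_dotProduct_mulVec_pos (by simpa [IsHermitian, conjTranspose_eq_transpose_of_trivial] using hGt) fun x hx => ?_
    simpa using hpos x hx
  -- With `G = Rᵀ R`, self-adjointness of `C` for `G` becomes symmetry of `R C R⁻¹`, to which the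
  -- spectral theorem applies.
  obtain ⟨R, hR⟩ : ∃ R : Matrix n n ℝ, G = Rᵀ * R := by
    open scoped MatrixOrder Matrix.Norms.L2Operator in
    obtain ⟨R, hR⟩ := CStarAlgebra.nonneg_iff_eq_star_mul_self.mp hP.posSemidef.nonneg
    exact ⟨R, by simpa [star_eq_conjTranspose, conjTranspose_eq_transpose_of_trivial] using hR⟩
  have hRu : IsUnit R.det := by
    have h1 : IsUnit G.det := (isUnit_iff_isUnit_det _).1 hP.isUnit
    rw [hR, det_mul, det_transpose] at h1
    exact isUnit_of_mul_isUnit_left h1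
  have hRtu : IsUnit Rᵀ.det := by rwa [det_transpose]
  have hS : (R * C * R⁻¹).IsHermitian := by
    rw [IsHermitian, conjTranspose_eq_transpose_of_trivial]
    have h2 : Cᵀ * (Rᵀ * R) = Rᵀ * R * C := by
      rw [← hR, ← hCt, transpose_mul, hGt]
    calc (R * C * R⁻¹)ᵀ = Rᵀ⁻¹ * (Cᵀ * (Rᵀ * R)) * R⁻¹ := by
          rw [transpose_mul, transpose_mul, transpose_nonsing_inv, ← Matrix.mul_assoc Cᵀ,
            Matrix.mul_assoc _ _ R⁻¹, Matrix.mul_assoc (Cᵀ * Rᵀ), mul_nonsing_inv _ hRu,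
            Matrix.mul_one]
      _ = R * C * R⁻¹ := by
          rw [h2, Matrix.mul_assoc Rᵀ, nonsing_inv_mul_cancel_left _ _ hRtu]
  let U : Matrix n n ℝ := hS.eigenvectorUnitary
  have hU1 : Uᴴ * U = 1 := mem_unitaryGroup_iff'.1 hS.eigenvectorUnitary.2
  have hU2 : U * Uᴴ = 1 := mem_unitaryGroup_iff.1 hS.eigenvectorUnitary.2
  have hst : R * C * R⁻¹ = U * diagonal hS.eigenvalues * Uᴴ := by
    have := hS.spectral_theorem
    rw [Unitary.conjStarAlgAut_apply] at this
    exact this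
  have hinv : (R⁻¹ * U)⁻¹ = Uᴴ * R := by
    refine inv_eq_right_inv ?_
    rw [Matrix.mul_assoc, ← Matrix.mul_assoc U, hU2, Matrix.one_mul, nonsing_inv_mul _ hRu]
  refine ⟨R⁻¹ * U, hS.eigenvalues, ?_, ?_⟩
  · rw [det_mul]
    refine IsUnit.mul (by rwa [isUnit_nonsing_inv_det_iff]) ?_
    exact isUnit_det_of_left_inverse hU1
  · rw [hinv]
    calc C = R⁻¹ * (R * C * R⁻¹) * R := by
          rw [Matrix.mul_assoc R, nonsing_inv_mul_cancel_left _ _ hRu,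
            nonsing_inv_mul_cancel_right _ _ hRu]
      _ = R⁻¹ * (U * diagonal hS.eigenvalues * Uᴴ) * R := congrArg (fun X => R⁻¹ * X * R) hst
      _ = _ := by simp only [Matrix.mul_assoc]

/-- The value at the diagonalizable matrix `Q * diagonal d * Q⁻¹` of the function taking the values
`w i` at the eigenvalues `d i`. -/
noncomputable def conjDiag (Q : Matrix n n ℝ) (w : n → ℝ) : Matrix n n ℝ := Q * diagonal w * Q⁻¹

variable {Q : Matrix n n ℝ} {d : n → ℝ}

theorem conjDiag_mul (hQ : IsUnit Q.det) (v w : n → ℝ) :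
    conjDiag Q v * conjDiag Q w = conjDiag Q (v * w) := by
  simp only [conjDiag, Matrix.mul_assoc]
  rw [nonsing_inv_mul_cancel_left _ _ hQ, ← Matrix.mul_assoc (diagonal v), diagonal_mul_diagonal]
  rfl

theorem conjDiag_one (hQ : IsUnit Q.det) : conjDiag Q 1 = 1 := by
  rw [conjDiag, Pi.one_def, diagonal_one, Matrix.mul_one, mul_nonsing_inv _ hQ]

theorem conjDiag_add (v w : n → ℝ) : conjDiag Q (v + w) = conjDiag Q v + conjDiag Q w := by
  rw [conjDiag, conjDiag, conjDiag, ← Matrix.add_mul, ← Matrix.mul_add, diagonal_add]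
  rfl

theorem conjDiag_smul (c : ℝ) (w : n → ℝ) : conjDiag Q (c • w) = c • conjDiag Q w := by
  rw [conjDiag, conjDiag, diagonal_smul, Matrix.mul_smul, Matrix.smul_mul]

theorem conjDiag_neg (w : n → ℝ) : conjDiag Q (-w) = -conjDiag Q w := by
  rw [← neg_one_smul ℝ, conjDiag_smul, neg_one_smul]

theorem conjDiag_zero : conjDiag Q 0 = 0 := by simp [conjDiag]

theorem conjDiag_trace (hQ : IsUnit Q.det) (w : n → ℝ) : (conjDiag Q w).trace = ∑ i, w i := by
  rw [conjDiag, trace_mul_comm, nonsing_inv_mul_cancel_left _ _ hQ, trace_diagonal]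

theorem conjDiag_mulVec_col (hQ : IsUnit Q.det) (w : n → ℝ) (i : n) :
    conjDiag Q w *ᵥ Q.col i = w i • Q.col i := by
  have h : Q.col i = Q *ᵥ Pi.single i 1 := by ext k; simp
  rw [h, conjDiag, mulVec_mulVec, nonsing_inv_mul_cancel_right _ _ hQ, ← mulVec_mulVec,
    diagonal_mulVec_single, ← mulVec_smul]
  congr 1
  ext k
  simp [Pi.single_apply]

theorem col_ne_zero (hQ : IsUnit Q.det) (i : n) : Q.col i ≠ 0 := by
  intro h
  have h2 : Q *ᵥ Pi.single i 1 = 0 := by rw [← h]; ext k; simp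
  have := congrFun (mulVec_injective_of_isUnit ((isUnit_iff_isUnit_det _).2 hQ)
    (h2.trans (mulVec_zero Q).symm)) i
  simp at this

/-- Whatever intertwines diagonal matrices intertwines functions of them. -/
theorem diagonal_intertwine {M : Matrix n n ℝ} (h : diagonal d * M = M * diagonal d) (f : ℝ → ℝ) :
    diagonal (f ∘ d) * M = M * diagonal (f ∘ d) := by
  ext i j
  have := congrFun (congrFun h i) j
  rw [diagonal_mul, mul_diagonal] at this ⊢
  -- The hypothesis reads `d i * M i j = M i j * d j`: a nonzero entry joins equal eigenvalues.
  by_cases hM : M i j = 0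
  · simp [hM]
  · have hd : d i = d j := by
      rw [mul_comm] at this
      exact mul_left_cancel₀ hM this
    simp [hd, mul_comm]

theorem commute_conjDiag_comp (hQ : IsUnit Q.det) {M : Matrix n n ℝ} (h : Commute M (conjDiag Q d))
    (f : ℝ → ℝ) : Commute M (conjDiag Q (f ∘ d)) := by
  have h1 : diagonal d * (Q⁻¹ * M * Q) = (Q⁻¹ * M * Q) * diagonal d := by
    have := congrArg (fun X => Q⁻¹ * X * Q) h.eq
    simp only [conjDiag, Matrix.mul_assoc] at this ⊢
    rw [nonsing_inv_mul_cancel_left _ _ hQ, nonsing_inv_mul _ hQ, Matrix.mul_one] at this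
    exact this.symm
  have h2 := congrArg (fun X => Q * X * Q⁻¹) (diagonal_intertwine h1 f)
  simp only [Matrix.mul_assoc] at h2
  rw [mul_nonsing_inv_cancel_left _ _ hQ, mul_nonsing_inv _ hQ, Matrix.mul_one] at h2
  simp only [Commute, SemiconjBy, conjDiag, Matrix.mul_assoc]
  exact h2.symm

/-- The relation `Sᵀ M = M S` is self-adjointness of `S` for the bilinear form with matrix `M`; the
congruence `Qᵀ M Q` reduces its inheritance by functions of `S` to `diagonal_intertwine`. -/
theorem conjDiag_transpose_intertwine (hQ : IsUnit Q.det) {M : Matrix n n ℝ}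
    (h : (conjDiag Q d)ᵀ * M = M * conjDiag Q d) (f : ℝ → ℝ) :
    (conjDiag Q (f ∘ d))ᵀ * M = M * conjDiag Q (f ∘ d) := by
  have hQt : IsUnit Qᵀ.det := by rwa [det_transpose]
  simp only [conjDiag, transpose_mul, diagonal_transpose, transpose_nonsing_inv,
    Matrix.mul_assoc] at h ⊢
  have h1 : diagonal d * (Qᵀ * M * Q) = (Qᵀ * M * Q) * diagonal d := by
    have := congrArg (fun X => Qᵀ * X * Q) h
    simp only [Matrix.mul_assoc] at this ⊢
    rw [mul_nonsing_inv_cancel_left _ _ hQt, nonsing_inv_mul _ hQ, Matrix.mul_one] at this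
    exact this
  have h2 := congrArg (fun X => Qᵀ⁻¹ * X * Q⁻¹) (diagonal_intertwine h1 f)
  simp only [Matrix.mul_assoc] at h2
  rw [nonsing_inv_mul_cancel_left _ _ hQt, mul_nonsing_inv _ hQ, Matrix.mul_one] at h2
  exact h2

/-- The homomorphism from complex functions on the spectrum of a real diagonalizable matrix to
matrices determined by a complex structure commuting with it. -/
theorem exists_complexCalculus (hQ : IsUnit Q.det) {I : Matrix n n ℝ} (hI : I * I = -1)
    (hc : Commute I (conjDiag Q d)) :
    ∃ Φ : (Set.range d → ℂ) →+* Matrix n n ℝ, Continuous Φ ∧ ∀ z, Φ z =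
      conjDiag Q (fun i => (z ⟨d i, i, rfl⟩).re) + I * conjDiag Q (fun i => (z ⟨d i, i, rfl⟩).im) := by
  classical
  -- Functions on `Set.range d`, not on the index set, are needed: equal eigenvalues must receive
  -- equal values for `I` to commute with the result. The value `0` off the spectrum is arbitrary.
  have hcomm : ∀ z : Set.range d → ℝ, Commute I (conjDiag Q fun i => z ⟨d i, i, rfl⟩) := by
    intro z
    have := commute_conjDiag_comp hQ hc (fun y => if h : y ∈ Set.range d then z ⟨y, h⟩ else 0)
    simpa [Function.comp_def] using this
  let F : (Set.range d → ℂ) → Matrix n n ℝ := fun z =>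
    conjDiag Q (fun i => (z ⟨d i, i, rfl⟩).re) + I * conjDiag Q (fun i => (z ⟨d i, i, rfl⟩).im)
  refine ⟨{ toFun := F, map_one' := ?_, map_mul' := ?_, map_zero' := ?_, map_add' := ?_ }, ?_,
    fun z => rfl⟩
  · have h1 : (fun i : n => ((1 : Set.range d → ℂ) ⟨d i, i, rfl⟩).re) = 1 := rfl
    have h2 : (fun i : n => ((1 : Set.range d → ℂ) ⟨d i, i, rfl⟩).im) = 0 := rfl
    simp only [F, h1, h2, conjDiag_zero, Matrix.mul_zero, add_zero, conjDiag_one hQ]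
  · intro z w
    have hz := (hcomm fun s => (z s).re).eq
    have hz' := (hcomm fun s => (z s).im).eq
    have h1 : (fun i : n => ((z * w) ⟨d i, i, rfl⟩).re) =
        (fun i => (z ⟨d i, i, rfl⟩).re) * (fun i => (w ⟨d i, i, rfl⟩).re) +
        -((fun i => (z ⟨d i, i, rfl⟩).im) * (fun i => (w ⟨d i, i, rfl⟩).im)) := by
      ext; simp [sub_eq_add_neg]
    have h2 : (fun i : n => ((z * w) ⟨d i, i, rfl⟩).im) =
        (fun i => (z ⟨d i, i, rfl⟩).re) * (fun i => (w ⟨d i, i, rfl⟩).im) +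
        ((fun i => (z ⟨d i, i, rfl⟩).im) * (fun i => (w ⟨d i, i, rfl⟩).re)) := by
      ext; simp
    simp only [F, h1, h2, conjDiag_add, conjDiag_neg, ← conjDiag_mul hQ]
    generalize conjDiag Q (fun i => (z ⟨d i, i, rfl⟩).re) = a at *
    generalize conjDiag Q (fun i => (z ⟨d i, i, rfl⟩).im) = b at *
    generalize conjDiag Q (fun i => (w ⟨d i, i, rfl⟩).re) = a'
    generalize conjDiag Q (fun i => (w ⟨d i, i, rfl⟩).im) = b'
    have e1 : a * (I * b') = I * (a * b') := by rw [← Matrix.mul_assoc, ← hz, Matrix.mul_assoc]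
    have e2 : I * b * (I * b') = -(b * b') := by
      rw [hz', Matrix.mul_assoc, ← Matrix.mul_assoc I, hI, Matrix.neg_mul, Matrix.one_mul,
        Matrix.mul_neg]
    rw [Matrix.add_mul, Matrix.mul_add, Matrix.mul_add, Matrix.mul_add, e1, e2,
      Matrix.mul_assoc I b a']
    abel
  · have h1 : (fun i : n => ((0 : Set.range d → ℂ) ⟨d i, i, rfl⟩).re) = 0 := rfl
    have h2 : (fun i : n => ((0 : Set.range d → ℂ) ⟨d i, i, rfl⟩).im) = 0 := rfl
    simp only [F, h1, h2, conjDiag_zero, Matrix.mul_zero, add_zero]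
  · intro z w
    have h1 : (fun i : n => ((z + w) ⟨d i, i, rfl⟩).re) =
        (fun i => (z ⟨d i, i, rfl⟩).re) + (fun i => (w ⟨d i, i, rfl⟩).re) := by ext; simp
    have h2 : (fun i : n => ((z + w) ⟨d i, i, rfl⟩).im) =
        (fun i => (z ⟨d i, i, rfl⟩).im) + (fun i => (w ⟨d i, i, rfl⟩).im) := by ext; simp
    simp only [F, h1, h2, conjDiag_add, Matrix.mul_add]
    abel
  · change Continuous F
    simp only [F, conjDiag]
    fun_prop

/-- The exponential of `t I S`, for a complex structure `I` commuting with the real diagonalizable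
matrix `S`, is `cos (t S) + I sin (t S)`. -/
theorem exp_smul_mul_conjDiag (hQ : IsUnit Q.det) {I : Matrix n n ℝ} (hI : I * I = -1)
    (hc : Commute I (conjDiag Q d)) (t : ℝ) :
    NormedSpace.exp (t • (I * conjDiag Q d)) =
      conjDiag Q (fun i => Real.cos (t * d i)) + I * conjDiag Q (fun i => Real.sin (t * d i)) := by
  classical
  obtain ⟨Φ, hΦ, hΦz⟩ := exists_complexCalculus hQ hI hc
  have h0 : t • (I * conjDiag Q d) = Φ (fun s => (t * s.1 : ℝ) * Complex.I) := by
    rw [hΦz]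
    have h1 : (fun i : n => (((t * d i : ℝ) : ℂ) * Complex.I).re) = 0 := by ext; simp
    have h2 : (fun i : n => (((t * d i : ℝ) : ℂ) * Complex.I).im) = t • d := by ext; simp
    simp only [h1, h2, conjDiag_smul, conjDiag_zero, zero_add, Matrix.mul_smul]
  have h3 : NormedSpace.exp (Φ fun s => ((t * s.1 : ℝ) : ℂ) * Complex.I) =
      Φ (NormedSpace.exp fun s => ((t * s.1 : ℝ) : ℂ) * Complex.I) := by
    open scoped Matrix.Norms.Operator in
    exact (NormedSpace.map_exp Φ hΦ _).symm
  rw [h0, h3, hΦz]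
  have h4 : ∀ s : Set.range d, NormedSpace.exp (fun s : Set.range d => ((t * s.1 : ℝ) : ℂ) * Complex.I) s =
      Complex.exp (((t * s.1 : ℝ) : ℂ) * Complex.I) := fun s => by
    rw [Pi.coe_exp, Complex.exp_eq_exp_ℂ]
  simp only [h4, Complex.exp_ofReal_mul_I_re,
    Complex.exp_ofReal_mul_I_im]

/-- The matrix is the image, under the ring homomorphism of `exists_complexCalculus`, of the
function `s ↦ exp(i t s) + μ`, which has no zero on the spectrum and so is a unit. -/
theorem isUnit_add_smul_of_rotation (hQ : IsUnit Q.det) {I : Matrix n n ℝ} (hI : I * I = -1)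
    (hc : Commute I (conjDiag Q d)) (t μ : ℝ)
    (h : ∀ i, Complex.exp ((t * d i : ℝ) * Complex.I) + μ ≠ 0) :
    IsUnit (conjDiag Q (fun i => Real.cos (t * d i)) + I * conjDiag Q (fun i => Real.sin (t * d i))
      + μ • (1 : Matrix n n ℝ)) := by
  obtain ⟨Φ, hΦ, hΦz⟩ := exists_complexCalculus hQ hI hc
  let z : Set.range d → ℂ := fun s => Complex.exp ((t * s.1 : ℝ) * Complex.I) + μ
  have hz : IsUnit z := by
    refine Pi.isUnit_iff.2 ?_
    rintro ⟨_, i, rfl⟩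
    exact isUnit_iff_ne_zero.2 (h i)
  have := hz.map Φ
  rw [hΦz] at this
  convert this using 1
  have h1 : (fun i : n => (z ⟨d i, i, rfl⟩).re) = (fun i => Real.cos (t * d i)) + μ • 1 := by
    ext
    simp only [z, Complex.add_re, Complex.exp_ofReal_mul_I_re]
    simp
  have h2 : (fun i : n => (z ⟨d i, i, rfl⟩).im) = fun i => Real.sin (t * d i) := by
    ext
    simp only [z, Complex.add_im, Complex.exp_ofReal_mul_I_im]
    simp
  rw [h1, h2, conjDiag_add, conjDiag_smul, conjDiag_one hQ]
  abel

end LinearAlgebra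

/-! ### Products of transvections along a chain -/

section Chain
variable {g : ℕ}

/-- The product `T_{d_0}(r) ⋯ T_{d_{n-1}}(r)` of transvections. -/
noncomputable def chainProd (d : ℕ → Fin g ⊕ Fin g → ℝ) (r : ℝ) (n : ℕ) : symplecticGroup (Fin g) ℝ :=
  (List.ofFn fun i : Fin n => transvection (d i) r).prod

theorem chainProd_succ (d : ℕ → Fin g ⊕ Fin g → ℝ) (r : ℝ) (n : ℕ) :
    chainProd d r (n + 1) = transvection (d 0) r * chainProd (fun k => d (k + 1)) r n := by
  simp [chainProd, List.ofFn_succ]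

theorem chainProd_mulVec_succ (d : ℕ → Fin g ⊕ Fin g → ℝ) (r : ℝ) (n : ℕ)
    (u : Fin g ⊕ Fin g → ℝ) :
    (chainProd d r (n + 1)).1 *ᵥ u = (chainProd (fun k => d (k + 1)) r n).1 *ᵥ u +
      (r * theta (d 0) ((chainProd (fun k => d (k + 1)) r n).1 *ᵥ u)) • d 0 := by
  rw [chainProd_succ, Submonoid.coe_mul, ← mulVec_mulVec]
  exact transvectionMatrix_mulVec _ _ _

/-- A sequence of `n` vectors whose consecutive terms all have pairing `ε`. -/
structure IsNormalChain (n : ℕ) (ε : ℝ) (d : ℕ → Fin g ⊕ Fin g → ℝ) : Prop where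
  next : ∀ k, k + 1 < n → theta (d k) (d (k + 1)) = ε
  far : ∀ i j, i + 1 < j → j < n → theta (d i) (d j) = 0

namespace IsNormalChain
variable {n : ℕ} {ε : ℝ} {d : ℕ → Fin g ⊕ Fin g → ℝ}

theorem tail (h : IsNormalChain (n + 1) ε d) : IsNormalChain n ε fun k => d (k + 1) :=
  ⟨fun k hk => h.next (k + 1) (by omega), fun i j hij hj => h.far _ _ (by omega) (by omega)⟩

/-- Skewness of `θ` flips the sign. This is the reason for carrying a general `ε`: results on chains
then apply to products in either order. -/
theorem reverse (h : IsNormalChain (n + 1) ε d) : IsNormalChain (n + 1) (-ε) fun k => d (n - k) := by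
  refine ⟨fun k hk => ?_, fun i j hij hj => ?_⟩
  · obtain ⟨m, rfl⟩ : ∃ m, n = k + 1 + m := ⟨n - (k + 1), by omega⟩
    have e1 : k + 1 + m - k = m + 1 := by omega
    have e2 : k + 1 + m - (k + 1) = m := by omega
    simp only [e1, e2]
    rw [theta_skew, h.next m (by omega)]
  · rw [theta_skew, h.far _ _ (by omega) (by omega), neg_zero]

/-- The pairing of a term of the chain with a linear combination of the terms. -/
theorem theta_sum (h : IsNormalChain n ε d) (y : ℕ → ℝ) (hy : y 0 = 0) {j : ℕ} (hj : j < n) :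
    theta (d j) (∑ i ∈ Finset.range n, y (i + 1) • d i) =
      ε * ((if j + 1 < n then y (j + 2) else 0) - y j) := by
  -- The coefficient of `d i` is `y (i + 1)`, so that `y 0 = 0` stands for the missing left
  -- neighbour of `d 0`.
  rw [theta_sum_right]
  have key : ∀ i ∈ Finset.range n, y (i + 1) * theta (d j) (d i) =
      (if i = j + 1 then ε * y (j + 2) else 0) - (if i + 1 = j then ε * y j else 0) := by
    intro i hi
    have hi' := Finset.mem_range.1 hi
    rcases lt_trichotomy i j with hij | rfl | hij
    · rw [if_neg (by omega)]
      split_ifs with h1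
      · subst h1
        rw [theta_skew, h.next i hj]
        ring
      · rw [theta_skew, h.far i j (by omega) hj]
        ring
    · rw [theta_self, if_neg (by omega), if_neg (by omega)]
      ring
    · rw [if_neg (by omega : ¬ i + 1 = j)]
      split_ifs with h1
      · subst h1
        rw [h.next j hi']
        ring
      · rw [h.far j i (by omega) hi']
        ring
  rw [Finset.sum_congr rfl key, Finset.sum_sub_distrib, Finset.sum_ite_eq', mul_sub]
  congr 1
  · simp only [Finset.mem_range, mul_ite, mul_zero]
  · rcases j with _ | j
    · simp [hy]
    · simp only [Nat.add_right_cancel_iff]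
      rw [Finset.sum_ite_eq', if_pos (Finset.mem_range.2 (by omega))]

/-- The action of a product of transvections along a chain. -/
theorem exists_coeff (h : IsNormalChain n ε d) (r : ℝ) (u : Fin g ⊕ Fin g → ℝ) :
    ∃ y : ℕ → ℝ, (∀ k, n ≤ k → y k = 0) ∧
      (chainProd d r n).1 *ᵥ u = u + r • ∑ i ∈ Finset.range n, y i • d i ∧
      ∀ j < n, y j = theta (d j) u + r * (ε * y (j + 1)) := by
  induction n generalizing d with
  | zero => exact ⟨0, by simp, by simp [chainProd], by simp⟩
  | succ n ih =>
    obtain ⟨y, hy0, hy, hyj⟩ := ih h.tail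
    -- The transvection along `d 0` acts last, so its coefficient is the pairing of `d 0` with the
    -- vector already moved by the tail; of the terms added by the tail only the multiple of `d 1`
    -- contributes.
    let y' : ℕ → ℝ := fun k => Nat.casesOn k
      (theta (d 0) ((chainProd (fun k => d (k + 1)) r n).1 *ᵥ u)) y
    refine ⟨y', ?_, ?_, ?_⟩
    · rintro (_ | k) hk
      · omega
      · exact hy0 k (by omega)
    · rw [chainProd_mulVec_succ, Finset.sum_range_succ', smul_add, ← add_assoc, smul_smul]
      congr 1
    · rintro (_ | j) hj
      · have hs : ∑ i ∈ Finset.range n, y i * theta (d 0) (d (i + 1)) = ε * y 0 := by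
          rcases n with _ | n
          · simp [hy0 0 le_rfl]
          · rw [Finset.sum_range_succ', Finset.sum_eq_zero, zero_add, h.next 0 (by omega), mul_comm]
            intro i hi
            rw [h.far 0 _ (by omega) (by have := Finset.mem_range.1 hi; omega), mul_zero]
        change theta (d 0) ((chainProd (fun k => d (k + 1)) r n).1 *ᵥ u) = _
        rw [hy, theta_add_right, theta_smul_right, theta_sum_right, hs]
      · exact hyj j (by omega)

end IsNormalChain

/-- Twice the summand plus the telescoping term `y_{i+1}² - y_i²` dominates `(y_i - e y_{i+1})²`.
The telescoped sum is `-y_0² ≤ 0`, so all these squares vanish and `y_n = 0` propagates downwards.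
For `e = ±1` this is the definiteness of the form of the Dynkin graph `A_n`. -/
theorem eq_zero_of_sum_sq_sub_le {n : ℕ} {e : ℝ} (he : e ^ 2 ≤ 1) {y : ℕ → ℝ} (hn : y n = 0)
    (h : ∑ i ∈ Finset.range n, (y i ^ 2 - e * (y i * y (i + 1))) ≤ 0) : ∀ i ≤ n, y i = 0 := by
  have h1 : ∀ i ∈ Finset.range n, (y i - e * y (i + 1)) ^ 2 ≤
      2 * (y i ^ 2 - e * (y i * y (i + 1))) + (y (i + 1) ^ 2 - y i ^ 2) := by
    intro i _
    nlinarith [mul_le_mul_of_nonneg_right he (sq_nonneg (y (i + 1)))]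
  have h2 := Finset.sum_le_sum h1
  rw [Finset.sum_add_distrib, ← Finset.mul_sum, Finset.sum_range_sub (fun i => y i ^ 2), hn] at h2
  have h3 : ∑ i ∈ Finset.range n, (y i - e * y (i + 1)) ^ 2 = 0 :=
    le_antisymm (by nlinarith [sq_nonneg (y 0)]) (Finset.sum_nonneg fun i _ => sq_nonneg _)
  rw [Finset.sum_eq_zero_iff_of_nonneg fun i _ => sq_nonneg _] at h3
  intro i hi
  induction hi using Nat.decreasingInduction with
  | self => exact hn
  | of_succ k hk ih =>
    have := pow_eq_zero_iff two_ne_zero |>.1 (h3 k (Finset.mem_range.2 hk))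
    rw [ih] at this
    linarith

namespace IsNormalChain
variable {n : ℕ} {ε : ℝ} {d : ℕ → Fin g ⊕ Fin g → ℝ}

/-- A product of transvections `T(r)`, `0 ≤ r ≤ 1`, along a chain has no negative eigenvalue. -/
theorem eq_zero_of_mulVec_eq_neg (h : IsNormalChain n ε d) (hε : ε ^ 2 = 1) {r μ : ℝ} (hr0 : 0 ≤ r)
    (hr1 : r ≤ 1) (hμ : 0 < μ) {u : Fin g ⊕ Fin g → ℝ}
    (hu : (chainProd d r n).1 *ᵥ u = -(μ • u)) : u = 0 := by
  obtain ⟨y, hy0, hy, hyj⟩ := h.exists_coeff r u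
  let Y : ℕ → ℝ := fun k => Nat.casesOn k 0 y
  have hsum : r • ∑ i ∈ Finset.range n, y i • d i = (-(1 + μ)) • u := by
    have : r • ∑ i ∈ Finset.range n, y i • d i = -(μ • u) - u := by rw [← hu, hy]; abel
    rw [this]
    module
  -- Pairing the eigenvalue equation with `d j` gives a three-term recurrence; `Y` is `y` shifted by
  -- one, with `Y 0 = 0`.
  have hrec : ∀ j < n, (1 + μ) * y j = r * ε * (μ * y (j + 1) + Y j) := by
    intro j hj
    have h1 := h.theta_sum Y rfl hj
    have h2 : (if j + 1 < n then Y (j + 2) else 0) = y (j + 1) := by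
      split_ifs with h3
      · rfl
      · exact (hy0 _ (by omega)).symm
    rw [h2] at h1
    have h4 := congrArg (theta (d j)) hsum
    rw [theta_smul_right, theta_smul_right] at h4
    change theta (d j) (∑ i ∈ Finset.range n, y i • d i) = _ at h1
    rw [h1] at h4
    have h5 := hyj j hj
    linear_combination (1 + μ) * h5 + h4
  -- Rescaling by powers of `ρ = √μ` symmetrises the recurrence: `(1 + ρ²) z_j = r ε ρ (z_{j+1} +
  -- z_{j-1})`. Multiplying by `z_j` and summing gives `hall`.
  obtain ⟨ρ, hρ, rfl⟩ : ∃ ρ : ℝ, 0 < ρ ∧ ρ ^ 2 = μ := ⟨√μ, Real.sqrt_pos.2 hμ, Real.sq_sqrt hμ.le⟩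
  let z : ℕ → ℝ := fun j => ρ ^ j * y j
  have hzn : z n = 0 := by simp [z, hy0 n le_rfl]
  let f : ℕ → ℝ := fun j => ρ ^ (2 * j) * (y j * Y j)
  have hf : ∑ j ∈ Finset.range n, f j = ∑ j ∈ Finset.range n, ρ * (z j * z (j + 1)) := by
    have h1 : ∑ j ∈ Finset.range n, f j = ∑ j ∈ Finset.range (n + 1), f j := by
      rw [Finset.sum_range_succ]
      simp [f, hy0 n le_rfl]
    rw [h1, Finset.sum_range_succ']
    have h0 : f 0 = 0 := by simp [f, Y]
    rw [h0, add_zero]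
    refine Finset.sum_congr rfl fun j _ => ?_
    simp only [f, Y, z]
    ring
  have hall : (1 + ρ ^ 2) * ∑ j ∈ Finset.range n, z j ^ 2 =
      2 * ρ * ∑ j ∈ Finset.range n, r * ε * (z j * z (j + 1)) := by
    have h1 : ∀ j ∈ Finset.range n, (1 + ρ ^ 2) * z j ^ 2 =
        r * ε * (ρ * (z j * z (j + 1))) + r * ε * f j := by
      intro j hj
      simp only [z, f]
      linear_combination ρ ^ (2 * j) * y j * hrec j (Finset.mem_range.1 hj)
    rw [Finset.mul_sum, Finset.sum_congr rfl h1, Finset.sum_add_distrib, ← Finset.mul_sum,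
      ← Finset.mul_sum, ← Finset.mul_sum, ← Finset.mul_sum, hf, ← Finset.mul_sum]
    ring
  have hz : ∀ i ≤ n, z i = 0 := by
    refine eq_zero_of_sum_sq_sub_le (e := r * ε) ?_ hzn ?_
    · rw [mul_pow, hε, mul_one]
      exact pow_le_one₀ hr0 hr1
    · rw [Finset.sum_sub_distrib]
      -- Since `1 + ρ² ≥ 2ρ`, `hall` gives `∑ z_j² ≤ r ε ∑ z_j z_{j+1}`.
      have h2 : 0 ≤ ∑ j ∈ Finset.range n, z j ^ 2 := Finset.sum_nonneg fun _ _ => sq_nonneg _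
      nlinarith [mul_nonneg (sq_nonneg (1 - ρ)) h2]
  have hy' : ∀ i, y i = 0 := by
    intro i
    rcases lt_or_ge i n with hi | hi
    · have := hz i hi.le
      simpa [z, hρ.ne'] using this
    · exact hy0 i hi
  simp only [hy', zero_smul, Finset.sum_const_zero, smul_zero] at hsum
  have := smul_eq_zero.1 hsum.symm
  exact this.resolve_left (by nlinarith [sq_nonneg ρ])

/-- A chain of length `2g` spans `ℝ^{2g}`, so that only zero is orthogonal to it. -/
theorem eq_zero_of_theta_eq_zero (h : IsNormalChain n ε d) (hε : ε ≠ 0) (hn : 2 * g ≤ n)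
    {u : Fin g ⊕ Fin g → ℝ} (hu : ∀ j < 2 * g, theta (d j) u = 0) : u = 0 := by
  have h' : IsNormalChain (2 * g) ε d :=
    ⟨fun k hk => h.next k (by omega), fun i j hij hj => h.far i j hij (by omega)⟩
  have hli : LinearIndependent ℝ fun i : Fin (2 * g) => d i := by
    rw [Fintype.linearIndependent_iff]
    intro a ha
    let Y : ℕ → ℝ := fun k => Nat.casesOn k 0 fun j => if hj : j < 2 * g then a ⟨j, hj⟩ else 0
    have hYa : ∀ j (hj : j < 2 * g), Y (j + 1) = a ⟨j, hj⟩ := fun j hj => dif_pos hj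
    have hsum : ∑ i ∈ Finset.range (2 * g), Y (i + 1) • d i = 0 := by
      rw [← ha, ← Fin.sum_univ_eq_sum_range (fun i => Y (i + 1) • d i)]
      exact Finset.sum_congr rfl fun i _ => by rw [hYa i i.2]
    -- `Y` extends the coefficients by zero at both ends, and pairing the relation with `d j` makes
    -- it 2-periodic. The zero at `0` kills the even indices, the zero at `2g + 1` the odd ones; the
    -- even length of the chain is essential.
    have hrec : ∀ j < 2 * g, Y (j + 2) = Y j := by
      intro j hj
      have h1 := h'.theta_sum Y rfl hj
      have h0 : theta (d j) (0 : Fin g ⊕ Fin g → ℝ) = 0 := by simp [theta]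
      rw [hsum, h0] at h1
      have h2 : (if j + 1 < 2 * g then Y (j + 2) else 0) = Y (j + 2) := by
        split_ifs with h3
        · rfl
        · exact ((dif_neg h3 : Y (j + 1 + 1) = 0)).symm
      rw [h2] at h1
      have := (mul_eq_zero.1 h1.symm).resolve_left hε
      linarith
    have heven : ∀ m ≤ g, Y (2 * m) = 0 := by
      intro m
      induction m with
      | zero => exact fun _ => rfl
      | succ m ih => exact fun hm => (hrec (2 * m) (by omega)).trans (ih (by omega))
    have hodd : ∀ m ≤ g, Y (2 * m + 1) = 0 := by
      intro m hm
      induction hm using Nat.decreasingInduction with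
      | self => exact dif_neg (by omega)
      | of_succ k hk ih => exact (hrec (2 * k + 1) (by omega)).symm.trans ih
    rintro ⟨i, hi⟩
    rw [← hYa i hi]
    rcases Nat.even_or_odd' (i + 1) with ⟨m, hm | hm⟩
    · rw [hm]; exact heven m (by omega)
    · rw [hm]; exact hodd m (by omega)
  have hspan := hli.span_eq_top_of_card_eq_finrank' (by simp [two_mul])
  have hall : ∀ v, theta v u = 0 := by
    intro v
    have hv : v ∈ Submodule.span ℝ (Set.range fun i : Fin (2 * g) => d i) := hspan ▸ Submodule.mem_top
    obtain ⟨a, rfl⟩ := (Submodule.mem_span_range_iff_exists_fun ℝ).1 hv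
    rw [theta_sum_left]
    exact Finset.sum_eq_zero fun i _ => by rw [hu i i.2, mul_zero]
  ext k
  rcases k with k | k
  · have := hall (Pi.single (Sum.inr k) 1)
    simpa [theta, Pi.single_apply] using this
  · have := hall (Pi.single (Sum.inl k) 1)
    simpa [theta, Pi.single_apply] using this

/-- The quadratic form `θ(u, A u)` of the product `A` of the transvections along a chain is
negative definite. -/
theorem theta_mulVec_neg (h : IsNormalChain n ε d) (hε : ε ^ 2 = 1) (hn : 2 * g ≤ n)
    {u : Fin g ⊕ Fin g → ℝ} (hu : u ≠ 0) : theta u ((chainProd d 1 n).1 *ᵥ u) < 0 := by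
  obtain ⟨y, hy0, hy, hyj⟩ := h.exists_coeff 1 u
  by_contra hneg
  -- The coordinates satisfy `θ(d_i, u) = y_i - ε y_{i+1}`, which expresses the form through `y`
  -- alone.
  have h1 : theta u ((chainProd d 1 n).1 *ᵥ u) =
      -∑ i ∈ Finset.range n, (y i ^ 2 - ε * (y i * y (i + 1))) := by
    rw [hy, one_smul, theta_add_right, theta_self, zero_add, theta_sum_right,
      ← Finset.sum_neg_distrib]
    refine Finset.sum_congr rfl fun i hi => ?_
    rw [theta_skew]
    linear_combination y i * hyj i (Finset.mem_range.1 hi)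
  have h2 := eq_zero_of_sum_sq_sub_le hε.le (hy0 n le_rfl) (by linarith)
  refine hu (h.eq_zero_of_theta_eq_zero (fun h0 => by simp [h0] at hε) hn fun j hj => ?_)
  have := hyj j (by omega)
  rw [h2 j (by omega), h2 (j + 1) (by omega)] at this
  linarith

theorem chainProd_mulVec_eq_self {d : ℕ → Fin g ⊕ Fin g → ℝ} {r : ℝ} {u : Fin g ⊕ Fin g → ℝ} {n : ℕ}
    (hu : ∀ k < n, theta (d k) u = 0) : (chainProd d r n).1 *ᵥ u = u := by
  induction n generalizing d with
  | zero => simp [chainProd]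
  | succ n ih =>
    rw [chainProd_mulVec_succ, ih fun k hk => hu (k + 1) (by omega), hu 0 (by omega)]
    simp

/-- The product of the transvections along a chain shifts the chain. -/
theorem chainProd_mulVec (h : IsNormalChain n ε d) (hε : ε ^ 2 = 1) {i : ℕ} (hi : i + 1 < n) :
    (chainProd d 1 n).1 *ᵥ d i = (-ε) • d (i + 1) := by
  induction n generalizing d i with
  | zero => omega
  | succ n ih =>
    rcases i with _ | i
    · obtain ⟨n, rfl⟩ : ∃ m, n = m + 1 := ⟨n - 1, by omega⟩
      -- Only the transvections along `d 1` and `d 0` move `d 0`: the former gives `d 0 - ε d 1`,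
      -- and the latter cancels `d 0` because `ε² = 1`.
      have h1 : (chainProd (fun k => d (k + 1 + 1)) 1 n).1 *ᵥ d 0 = d 0 :=
        chainProd_mulVec_eq_self fun k hk => by
          rw [theta_skew, h.far 0 _ (by omega) (by omega), neg_zero]
      have h2 := h.next 0 (by omega)
      simp only [zero_add] at h2
      rw [chainProd_mulVec_succ, chainProd_mulVec_succ (fun k => d (k + 1)), h1]
      simp only [zero_add, theta_add_right, theta_smul_right, theta_self, theta_skew (d 1) (d 0), h2]
      have : 1 * (1 * -ε * ε) = (-1 : ℝ) := by linear_combination -hε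
      rw [this]
      module
    · have h1 := ih h.tail (i := i) (by omega)
      rw [chainProd_mulVec_succ, h1, theta_smul_right, h.far 0 _ (by omega) (by omega)]
      simp

/-- The products of the transvections along a chain of length `2g + 1`, in the two orders, are
inverse to each other up to sign. -/
theorem chainProd_mul_reverse (h : IsNormalChain (2 * g + 1) ε d) (hε : ε ^ 2 = 1) :
    (chainProd d 1 (2 * g + 1)).1 * (chainProd (fun k => d (2 * g - k)) 1 (2 * g + 1)).1 = -1 := by
  have hr := h.reverse
  set A := chainProd d 1 (2 * g + 1)
  set A' := chainProd (fun k => d (2 * g - k)) 1 (2 * g + 1)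
  -- The reversed product sends `d (i + 1)` to `ε d i`, and the forward one sends `d i` to `-ε d (i
  -- + 1)`.
  have hcol : ∀ i < 2 * g, A.1 *ᵥ (A'.1 *ᵥ d (i + 1)) = -d (i + 1) := by
    intro i hi
    have h1 := hr.chainProd_mulVec (by simpa using hε) (i := 2 * g - (i + 1)) (by omega)
    have e1 : 2 * g - (2 * g - (i + 1)) = i + 1 := by omega
    have e2 : 2 * g - (2 * g - (i + 1) + 1) = i := by omega
    simp only [e1, e2, neg_neg] at h1
    rw [h1, mulVec_smul, h.chainProd_mulVec hε (by omega), smul_smul]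
    have : ε * -ε = -1 := by linear_combination -hε
    rw [this, neg_one_smul]
  refine mulVec_injective (funext fun u => ?_)
  rw [neg_mulVec, one_mulVec, ← mulVec_mulVec, ← sub_eq_zero, sub_neg_eq_add]
  -- `A A'` is symplectic and negates `d_1, …, d_{2g}`, so `A A' u + u` is orthogonal to all of
  -- them; these are the first `2g` vectors of the reversed chain.
  refine hr.eq_zero_of_theta_eq_zero (neg_ne_zero.2 fun h0 => by simp [h0] at hε) (by omega) ?_
  intro j hj
  obtain ⟨i, hi, hij⟩ : ∃ i, i < 2 * g ∧ 2 * g - j = i + 1 := ⟨2 * g - j - 1, by omega, by omega⟩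
  simp only [hij]
  rw [theta_add_right]
  have h2 := (mem_symplecticGroup_iff A.1).1 A.2
  have h3 := (mem_symplecticGroup_iff A'.1).1 A'.2
  have h4 : d (i + 1) = -(A.1 *ᵥ (A'.1 *ᵥ d (i + 1))) := by rw [hcol i hi, neg_neg]
  nth_rewrite 1 [h4]
  rw [← neg_one_smul ℝ, theta_smul_left, h2, h3]
  ring

end IsNormalChain

theorem pow_mulVec_succ {m : Type*} [Fintype m] [DecidableEq m] (A : Matrix m m ℝ) (k : ℕ)
    (u : m → ℝ) : A ^ (k + 1) *ᵥ u = A *ᵥ (A ^ k *ᵥ u) := by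
  rw [pow_succ', ← mulVec_mulVec]

namespace IsNormalChain
variable {d : ℕ → Fin g ⊕ Fin g → ℝ}

theorem chainProd_pow_mulVec {n : ℕ} (h : IsNormalChain n (-1) d) {k : ℕ} (hk : k < n) :
    (chainProd d 1 n).1 ^ k *ᵥ d 0 = d k := by
  induction k with
  | zero => simp
  | succ k ih => rw [pow_mulVec_succ, ih (by omega), h.chainProd_mulVec (by norm_num) hk]; simp

/-- The coefficients `1, 0, 1, …, 1` are 2-periodic, so by `theta_sum` the combination pairs to zero
with `d_j` for every `j < 2g`. -/
theorem sum_even_eq_zero (h : IsNormalChain (2 * g + 1) (-1) d) :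
    ∑ m ∈ Finset.range (g + 1), d (2 * m) = 0 := by
  let Y : ℕ → ℝ := fun k => if Even k then 0 else 1
  have h1 : ∀ g' : ℕ, ∑ i ∈ Finset.range (2 * g' + 1), Y (i + 1) • d i =
      ∑ m ∈ Finset.range (g' + 1), d (2 * m) := by
    intro g'
    induction g' with
    | zero => simp [Y]
    | succ k ih =>
      rw [Finset.sum_range_succ _ (k + 1), ← ih, mul_add, mul_one, Finset.sum_range_succ,
        Finset.sum_range_succ]
      have e1 : Even (2 * k + 1 + 1) := ⟨k + 1, by omega⟩
      have e2 : ¬ Even (2 * k + 2 + 1) := by rw [Nat.not_even_iff_odd]; exact ⟨k + 1, by omega⟩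
      simp [Y, e1, e2]
  rw [← h1]
  refine h.eq_zero_of_theta_eq_zero (by norm_num) (by omega) fun j hj => ?_
  rw [h.theta_sum Y (by simp [Y]) (by omega), if_pos (by omega)]
  simp [Y, Nat.even_add]

/-- As `d_{2m} = A^(2m) d_0`, comparing the relation `sum_even_eq_zero` with its image under `A²`
leaves `A^(2g+2) d_0 = d_0`. The remaining `d_k = A^k d_0` are then fixed too, and the chain spans.
-/
theorem chainProd_pow_eq_one (h : IsNormalChain (2 * g + 1) (-1) d) :
    (chainProd d 1 (2 * g + 1)) ^ (2 * g + 2) = 1 := by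
  set A := chainProd d 1 (2 * g + 1) with hA
  have h0 : A.1 ^ (2 * g + 2) *ᵥ d 0 = d 0 := by
    have h1 : ∑ m ∈ Finset.range (g + 1), A.1 ^ (2 * m) *ᵥ d 0 = 0 := by
      rw [← h.sum_even_eq_zero]
      refine Finset.sum_congr rfl fun m hm => h.chainProd_pow_mulVec ?_
      have := Finset.mem_range.1 hm
      omega
    have h2 : A.1 ^ 2 *ᵥ ∑ m ∈ Finset.range (g + 1), A.1 ^ (2 * m) *ᵥ d 0 =
        ∑ m ∈ Finset.range (g + 1), A.1 ^ (2 * (m + 1)) *ᵥ d 0 := by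
      rw [mulVec_sum]
      exact Finset.sum_congr rfl fun m _ => by rw [mulVec_mulVec, ← pow_add]; congr 2; ring
    have h3 := Finset.sum_range_succ' (fun m => A.1 ^ (2 * m) *ᵥ d 0) (g + 1)
    rw [← h2, h1, Finset.sum_range_succ, h1] at h3
    simpa [mul_add] using h3
  have hall : ∀ k < 2 * g + 1, A.1 ^ (2 * g + 2) *ᵥ d k = d k := by
    intro k hk
    rw [← h.chainProd_pow_mulVec hk, ← hA, mulVec_mulVec, ← pow_add, add_comm, pow_add,
      ← mulVec_mulVec, h0]
  refine symplectic_ext fun u => ?_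
  rw [SubmonoidClass.coe_pow, OneMemClass.coe_one, one_mulVec, ← sub_eq_zero]
  refine h.eq_zero_of_theta_eq_zero (by norm_num) (by omega) fun j hj => ?_
  have h2 := (mem_symplecticGroup_iff (A ^ (2 * g + 2)).1).1 (A ^ (2 * g + 2)).2 (d j) u
  rw [SubmonoidClass.coe_pow, hall j (by omega)] at h2
  rw [sub_eq_add_neg, theta_add_right, h2, ← neg_one_smul ℝ, theta_smul_right]
  ring

/-- `A^k = 1` with `0 < k < 2g` would give `d_k = d_0`, but these pair differently with `d_{k+1}`.
So the order is at least `2g` and divides `2g + 2`; if it were smaller than `2g + 2` it would divide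
`1` or `2`, whereas `A² ≠ 1`. -/
theorem orderOf_chainProd (h : IsNormalChain (2 * g + 1) (-1) d) (hg : 1 ≤ g) :
    orderOf (chainProd d 1 (2 * g + 1)) = 2 * g + 2 := by
  set A := chainProd d 1 (2 * g + 1) with hA
  have hd0 : ∀ k, k + 1 < 2 * g + 1 → d k ≠ 0 := fun k hk h0 => by
    have := h.next k hk
    simp [h0, theta] at this
  have hA2 : A ^ 2 ≠ 1 := by
    intro h2
    have h3 := h.theta_mulVec_neg (by norm_num) (by omega) (hd0 0 (by omega))
    have h4 := h.theta_mulVec_neg (by norm_num) (by omega) (hd0 1 (by omega))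
    have h1 : A.1 ^ 2 *ᵥ d 0 = d 0 := by
      have : A.1 ^ 2 = 1 := congrArg Subtype.val h2
      rw [this, one_mulVec]
    -- If `A² = 1`, invariance and skewness give `θ(d_0, A d_0) = 0`, against negative definiteness.
    have h5 := (mem_symplecticGroup_iff A.1).1 A.2 (d 0) (A.1 *ᵥ d 0)
    have h6 := pow_mulVec_succ A.1 1 (d 0)
    rw [pow_one, one_add_one_eq_two, h1] at h6
    rw [← h6, theta_skew] at h5
    linarith
  have hdvd : orderOf A ∣ 2 * g + 2 := orderOf_dvd_of_pow_eq_one h.chainProd_pow_eq_one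
  have hpos : 0 < orderOf A := orderOf_pos_iff.2 (isOfFinOrder_iff_pow_eq_one.2
    ⟨2 * g + 2, by omega, h.chainProd_pow_eq_one⟩)
  have hge : 2 * g ≤ orderOf A := by
    by_contra hlt
    have h1 : A.1 ^ orderOf A = 1 := by
      rw [← SubmonoidClass.coe_pow, pow_orderOf_eq_one, OneMemClass.coe_one]
    have h2 := h.chainProd_pow_mulVec (k := orderOf A) (by omega)
    rw [← hA, h1, one_mulVec] at h2
    have h3 := h.next (orderOf A) (by omega)
    rw [← h2, h.far 0 _ (by omega) (by omega)] at h3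
    norm_num at h3
  have hle := Nat.le_of_dvd (by omega) hdvd
  by_contra hne
  have h1 : orderOf A ∣ 2 * g + 2 - orderOf A := Nat.dvd_sub hdvd dvd_rfl
  refine hA2 (orderOf_dvd_iff_pow_eq_one.1 ?_)
  rcases (by omega : 2 * g + 2 - orderOf A = 1 ∨ 2 * g + 2 - orderOf A = 2) with h2 | h2
  · rw [h2] at h1; exact h1.trans (one_dvd 2)
  · rwa [h2] at h1

end IsNormalChain
end Chain

/-! ### Contracting paths that avoid real eigenvalues `≤ -1` -/

section Contraction

/-- In a square whose left and bottom sides are constant, the right and the top side are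
homotopic. -/
theorem homotopicRel_of_square {X : Type*} [TopologicalSpace X] {x : X}
    (K : C(unitInterval × unitInterval, X)) (h₀ : ∀ s, K (0, s) = x) (h₁ : ∀ r, K (r, 0) = x) :
    (K.comp ⟨fun s => ((1 : unitInterval), s), by fun_prop⟩).HomotopicRel
      (K.comp ⟨fun s => (s, (1 : unitInterval)), by fun_prop⟩) {0, 1} := by
  -- Both sides are compared with the diagonal of the square; the starting points slide along sides
  -- on which `K` is constant.
  have e1 : (K.comp ⟨fun s => ((1 : unitInterval), s), by fun_prop⟩).HomotopicRel
      (K.comp ⟨fun s => (s, s), by fun_prop⟩) {0, 1} := by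
    refine ⟨{ toFun := fun p => K (max p.2 (unitInterval.symm p.1), p.2)
              continuous_toFun := by fun_prop
              map_zero_left := fun t => ?_
              map_one_left := fun t => ?_
              prop' := fun r t ht => ?_ }⟩
    · simp [unitInterval.le_one']
    · simp
    · rcases ht with rfl | ht
      · simp [h₁]
      · obtain rfl : t = 1 := ht
        simp [unitInterval.le_one']
  have e2 : (K.comp ⟨fun s => (s, s), by fun_prop⟩).HomotopicRel
      (K.comp ⟨fun s => (s, (1 : unitInterval)), by fun_prop⟩) {0, 1} := by
    refine ⟨{ toFun := fun p => K (p.2, max p.2 p.1)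
              continuous_toFun := by fun_prop
              map_zero_left := fun t => ?_
              map_one_left := fun t => ?_
              prop' := fun r t ht => ?_ }⟩
    · simp
    · simp [unitInterval.le_one']
    · rcases ht with rfl | ht
      · simp [h₀]
      · obtain rfl : t = 1 := ht
        simp [unitInterval.le_one']
  exact e1.trans e2

variable {g : ℕ}

/-- The Möbius transform `(a A + b) (b A + a)⁻¹` of a symplectic matrix is symplectic. -/
theorem mobius_mem (A : symplecticGroup (Fin g) ℝ) {a b : ℝ}
    (h : IsUnit (b • A.1 + a • (1 : Matrix (Fin g ⊕ Fin g) (Fin g ⊕ Fin g) ℝ)).det) :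
    (a • A.1 + b • 1) * (b • A.1 + a • 1)⁻¹ ∈ symplecticGroup (Fin g) ℝ := by
  rw [mem_symplecticGroup_iff]
  intro u v
  have hA := (mem_symplecticGroup_iff A.1).1 A.2
  -- Both sides equal `(a² + b²) θ(u, v) + a b (θ(A u, v) + θ(u, A v))`, which is symmetric in `a`
  -- and `b`.
  have key : ∀ u v, theta ((a • A.1 + b • 1) *ᵥ u) ((a • A.1 + b • 1) *ᵥ v) =
      theta ((b • A.1 + a • 1) *ᵥ u) ((b • A.1 + a • 1) *ᵥ v) := by
    intro u v
    simp only [add_mulVec, smul_mulVec, one_mulVec, theta_add_left, theta_add_right,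
      theta_smul_left, theta_smul_right, hA]
    ring
  rw [← mulVec_mulVec, ← mulVec_mulVec, key, mulVec_mulVec, mulVec_mulVec, mul_nonsing_inv _ h,
    one_mulVec, one_mulVec]

/-- A path of symplectic matrices without real eigenvalues `≤ -1`, starting at `1`, is homotopic to
a path that depends on its end point only; hence any two such paths with the same end point are
homotopic. -/
theorem UniversalCover.mk_eq_of_isUnit_add_smul {γ δ : C(unitInterval, symplecticGroup (Fin g) ℝ)}
    (hγ0 : γ 0 = 1) (hδ0 : δ 0 = 1) (h1 : γ 1 = δ 1)
    (hγ : ∀ s, ∀ μ : ℝ, 1 ≤ μ → IsUnit ((γ s).1 + μ • (1 : Matrix (Fin g ⊕ Fin g) (Fin g ⊕ Fin g) ℝ)))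
    (hδ : ∀ s, ∀ μ : ℝ, 1 ≤ μ → IsUnit ((δ s).1 + μ • (1 : Matrix (Fin g ⊕ Fin g) (Fin g ⊕ Fin g) ℝ))) :
    UniversalCover.mk γ hγ0 = UniversalCover.mk δ hδ0 := by
  have hunit : ∀ γ : C(unitInterval, symplecticGroup (Fin g) ℝ),
      (∀ s, ∀ μ : ℝ, 1 ≤ μ → IsUnit ((γ s).1 + μ • (1 : Matrix (Fin g ⊕ Fin g) (Fin g ⊕ Fin g) ℝ))) →
      ∀ r s : unitInterval, IsUnit ((1 - (r : ℝ)) • (γ s).1 +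
        (1 + (r : ℝ)) • (1 : Matrix (Fin g ⊕ Fin g) (Fin g ⊕ Fin g) ℝ)).det := by
    intro γ hγ r s
    rw [← isUnit_iff_isUnit_det]
    -- For `r < 1` dividing by `1 - r` leaves `γ s + μ` with `μ = (1 + r)/(1 - r) ≥ 1`; at `r = 1`
    -- the matrix is twice the identity.
    rcases r.2.2.eq_or_lt with hr | hr
    · rw [hr, sub_self, zero_smul, zero_add]
      exact isUnit_one.smul (Units.mk0 (1 + 1 : ℝ) (by norm_num))
    · have hr' : 0 < 1 - (r : ℝ) := by linarith
      have h2 := hγ s ((1 + r) / (1 - r)) (by rw [le_div_iff₀ hr']; linarith [r.2.1])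
      have h3 : (1 - (r : ℝ)) • (γ s).1 + (1 + (r : ℝ)) • (1 : Matrix (Fin g ⊕ Fin g) (Fin g ⊕ Fin g) ℝ)
          = (1 - (r : ℝ)) • ((γ s).1 + ((1 + (r : ℝ)) / (1 - r)) • 1) := by
        rw [smul_add, smul_smul, mul_div_cancel₀ _ hr'.ne']
      rw [h3]
      exact h2.smul (Units.mk0 _ hr'.ne')
  have main : ∀ γ : C(unitInterval, symplecticGroup (Fin g) ℝ), γ 0 = 1 →
      (∀ s, ∀ μ : ℝ, 1 ≤ μ → IsUnit ((γ s).1 + μ • (1 : Matrix (Fin g ⊕ Fin g) (Fin g ⊕ Fin g) ℝ))) →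
      ∃ γ' : C(unitInterval, symplecticGroup (Fin g) ℝ), γ.HomotopicRel γ' {0, 1} ∧ ∀ r, (γ' r).1 =
        ((1 + (r : ℝ)) • (γ 1).1 + (1 - (r : ℝ)) • 1) *
          ((1 - (r : ℝ)) • (γ 1).1 + (1 + (r : ℝ)) • 1)⁻¹ := by
    intro γ h0 hγ
    have hcont : Continuous fun p : unitInterval × unitInterval => (γ p.2).1 := by fun_prop
    -- With `X = (γ s - 1)(γ s + 1)⁻¹` the Cayley transform, this is `(1 + r X)(1 - r X)⁻¹`: the
    -- identity at `r = 0` and `γ s` at `r = 1`. The side `s = 1` depends on the end point of `γ`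
    -- only.
    let K : C(unitInterval × unitInterval, symplecticGroup (Fin g) ℝ) :=
      ⟨fun p => ⟨((1 + (p.1 : ℝ)) • (γ p.2).1 + (1 - (p.1 : ℝ)) • 1) *
          ((1 - (p.1 : ℝ)) • (γ p.2).1 + (1 + (p.1 : ℝ)) • 1)⁻¹, mobius_mem _ (hunit γ hγ p.1 p.2)⟩, by
        refine continuous_induced_rng.2 ?_
        change Continuous fun p : unitInterval × unitInterval =>
          ((1 + (p.1 : ℝ)) • (γ p.2).1 + (1 - (p.1 : ℝ)) • 1) *
          ((1 - (p.1 : ℝ)) • (γ p.2).1 + (1 + (p.1 : ℝ)) • 1)⁻¹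
        have hN : Continuous fun p : unitInterval × unitInterval =>
          (1 - (p.1 : ℝ)) • (γ p.2).1 + (1 + (p.1 : ℝ)) • (1 : Matrix (Fin g ⊕ Fin g) (Fin g ⊕ Fin g) ℝ) := by
          fun_prop
        refine Continuous.mul (by fun_prop) ?_
        simp only [inv_def, Ring.inverse_eq_inv']
        exact (hN.matrix_det.inv₀ fun p => (hunit γ hγ p.1 p.2).ne_zero).smul hN.matrix_adjugate⟩
    have hK0 : ∀ s, K (0, s) = 1 := fun s => Subtype.ext (by
      have := hunit γ hγ 0 s
      simp only [Set.Icc.coe_zero] at this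
      simp only [K, ContinuousMap.coe_mk, Set.Icc.coe_zero, add_zero, sub_zero] at this ⊢
      exact mul_nonsing_inv _ this)
    have hK1 : ∀ r, K (r, 0) = 1 := fun r => Subtype.ext (by
      have := hunit γ hγ r 0
      simp only [K, ContinuousMap.coe_mk]
      rw [h0] at this ⊢
      rw [add_comm] at this
      rw [add_comm ((1 - (r : ℝ)) • _)]
      exact mul_nonsing_inv _ this)
    have hK : K.comp ⟨fun s => ((1 : unitInterval), s), by fun_prop⟩ = γ := by
      ext1 s
      refine Subtype.ext ?_
      simp only [K, ContinuousMap.comp_apply, ContinuousMap.coe_mk, Set.Icc.coe_one, sub_self,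
        zero_smul, add_zero, zero_add, one_add_one_eq_two]
      rw [smul_mul_assoc, ← mul_smul_comm]
      have : (2 : ℝ) • ((2 : ℝ) • (1 : Matrix (Fin g ⊕ Fin g) (Fin g ⊕ Fin g) ℝ))⁻¹ = 1 := by
        have h2 : ((2 : ℝ) • (1 : Matrix (Fin g ⊕ Fin g) (Fin g ⊕ Fin g) ℝ))⁻¹ = (2⁻¹ : ℝ) • 1 := by
          refine inv_eq_right_inv ?_
          rw [smul_mul_smul_comm, Matrix.one_mul]
          norm_num
        rw [h2, smul_smul]
        norm_num
      rw [this, Matrix.mul_one]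
    refine ⟨_, hK ▸ homotopicRel_of_square K hK0 hK1, fun r => rfl⟩
  obtain ⟨γ', hγ', hγe⟩ := main γ hγ0 hγ
  obtain ⟨δ', hδ', hδe⟩ := main δ hδ0 hδ
  have heq : γ' = δ' := by
    ext1 r
    refine Subtype.ext ?_
    rw [hγe, hδe, h1]
  subst heq
  exact QuotientGroup.eq.2 ((homotopicRel_iff_inv_mul_mem _ _).2 (hγ'.trans hδ'.symm))

end Contraction

/-! ### The lift of the chain product as an exponential -/

section Paths
variable {g : ℕ}

/-- The product of the canonical lifts of transvections is the class of the path of the products. -/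
theorem prod_transvectionLift (d : ℕ → Fin g ⊕ Fin g → ℝ) (n : ℕ) :
    ∃ (γ : C(unitInterval, symplecticGroup (Fin g) ℝ)) (h : γ 0 = 1),
      (∀ t, γ t = chainProd d t n) ∧
      (List.ofFn fun i : Fin n => transvectionLift (d i)).prod = UniversalCover.mk γ h := by
  let p : Fin n → pathGroup (symplecticGroup (Fin g) ℝ) := fun i =>
    ⟨transvectionPath (d i), by
      change transvectionPath (d i) 0 = 1
      simp [transvectionPath, transvection_zero]⟩
  let P := (List.ofFn p).prod
  refine ⟨P.1, P.2, fun t => ?_, ?_⟩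
  · let ev : pathGroup (symplecticGroup (Fin g) ℝ) →* symplecticGroup (Fin g) ℝ :=
      { toFun := fun γ => γ.1 t, map_one' := rfl, map_mul' := fun _ _ => rfl }
    change ev (List.ofFn p).prod = _
    rw [map_list_prod, List.map_ofFn]
    rfl
  · change _ = QuotientGroup.mk' (nullLoops _) (List.ofFn p).prod
    rw [map_list_prod, List.map_ofFn]
    rfl

/-- An element `x` of the Lie algebra whose one-parameter group has no real eigenvalues `≤ -1` on
`[0, 1]` and ends at the product of the transvections along a chain is a logarithm of the product of
their canonical lifts. -/
theorem IsNormalChain.expTilde_eq {n : ℕ} {ε : ℝ} {d : ℕ → Fin g ⊕ Fin g → ℝ}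
    (h : IsNormalChain n ε d) (hε : ε ^ 2 = 1) (x : LieAlgebra.Symplectic.sp (Fin g) ℝ)
    (hx : NormedSpace.exp x.1 = (chainProd d 1 n).1)
    (hx' : ∀ t : unitInterval, ∀ μ : ℝ, 1 ≤ μ → IsUnit (NormedSpace.exp ((t : ℝ) • x.1) +
      μ • (1 : Matrix (Fin g ⊕ Fin g) (Fin g ⊕ Fin g) ℝ))) :
    expTilde x = (List.ofFn fun i : Fin n => transvectionLift (d i)).prod := by
  obtain ⟨γ, hγ0, hγ, hprod⟩ := prod_transvectionLift d n
  rw [hprod]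
  refine UniversalCover.mk_eq_of_isUnit_add_smul _ _ ?_ hx' ?_
  · refine Subtype.ext ?_
    rw [hγ]
    simpa using hx
  · intro s μ hμ
    rw [hγ]
    refine mulVec_injective_iff_isUnit.1 ?_
    refine (injective_iff_map_eq_zero (mulVecLin _)).2 fun u hu => ?_
    rw [mulVecLin_apply, add_mulVec, smul_mulVec, one_mulVec] at hu
    exact h.eq_zero_of_mulVec_eq_neg hε s.2.1 s.2.2 (by linarith) (eq_neg_of_add_eq_zero_left hu)

end Paths

/-- The class of a path in the universal cover. -/
def UniversalCoverAt.mk {X : Type*} [TopologicalSpace X] {x₀ : X} (ℓ : BasedPath X x₀) :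
    UniversalCoverAt X x₀ := Quotient.mk _ ℓ

/-! ### Fixed points of transvection lifts on the universal cover of the Lagrangian Grassmannian -/

section Lagrangian
variable {g : ℕ}

theorem continuous_transvection_comp {X : Type*} [TopologicalSpace X] (a : Fin g ⊕ Fin g → ℝ)
    {f : X → ℝ} (hf : Continuous f) : Continuous fun p => transvection a (f p) :=
  continuous_transvection.comp (continuous_const.prodMk hf)

theorem mulVec_injective_symplectic (A : symplecticGroup (Fin g) ℝ) :
    LinearMap.ker (mulVecLin A.1) = ⊥ :=
  LinearMap.ker_eq_bot.2 (Matrix.mulVec_injective_of_isUnit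
    ((Matrix.isUnit_iff_isUnit_det _).2 (SymplecticGroup.symplectic_det A.2)))

/-- The action of the symplectic group on Lagrangian frames. -/
def LagrangianFrame.map (A : symplecticGroup (Fin g) ℝ) (f : LagrangianFrame g) :
    LagrangianFrame g :=
  ⟨fun i => A.1 *ᵥ f.1 i, f.2.1.map' (mulVecLin A.1) (mulVec_injective_symplectic A), fun i j => by
    rw [(mem_symplecticGroup_iff _).1 A.2, f.2.2]⟩

theorem LagrangianFrame.span_map (A : symplecticGroup (Fin g) ℝ) (f : LagrangianFrame g) :
    (f.map A).span = A • f.span := by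
  refine Subtype.ext ?_
  change Submodule.span ℝ (Set.range (mulVecLin A.1 ∘ f.1)) =
    (Submodule.span ℝ (Set.range f.1)).map (mulVecLin A.1)
  rw [Set.range_comp, Submodule.span_image]

theorem LagrangianFrame.continuous_map (A : symplecticGroup (Fin g) ℝ) :
    Continuous (LagrangianFrame.map A) := by
  refine continuous_induced_rng.2 (continuous_pi fun i => ?_)
  have h : Continuous fun f : LagrangianFrame g => f.1 i :=
    (continuous_apply i).comp continuous_subtype_val
  exact Continuous.matrix_mulVec continuous_const h

theorem coe_transvection_smul (a : Fin g ⊕ Fin g → ℝ) (s : ℝ) (lam : Lagrangian g)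
    {x : Fin g ⊕ Fin g → ℝ} :
    x ∈ (transvection a s • lam).1 ↔ ∃ y ∈ lam.1, y + (s * theta a y) • a = x := by
  change x ∈ lam.1.map (mulVecLin (transvectionMatrix a s)) ↔ _
  simp only [Submodule.mem_map, mulVecLin_apply, transvectionMatrix_mulVec]

/-- A transvection fixes the Lagrangian subspaces that contain its vector, or are orthogonal to
it. -/
theorem transvection_smul_eq_self {a : Fin g ⊕ Fin g → ℝ} {lam : Lagrangian g}
    (h : a ∈ lam.1 ∨ ∀ x ∈ lam.1, theta a x = 0) (s : ℝ) : transvection a s • lam = lam := by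
  refine Subtype.ext (Submodule.eq_of_le_of_finrank_eq ?_
    ((transvection a s • lam).2.1.trans lam.2.1.symm))
  intro x hx
  obtain ⟨y, hy, rfl⟩ := (coe_transvection_smul a s lam).1 hx
  rcases h with h | h
  · exact lam.1.add_mem hy (lam.1.smul_mem _ h)
  · simpa [h y hy] using hy

/-- The homotopy `T_a((1 - r) s) ℓ(s)` switches the transvection off gradually; its end point stays
put because every `T_a(s)` fixes it. -/
theorem transvectionLift_smul_mk (lam₀ : Lagrangian g) (a : Fin g ⊕ Fin g → ℝ)
    (ℓ : BasedPath (Lagrangian g) lam₀) (h : ∀ s : ℝ, transvection a s • ℓ.1 1 = ℓ.1 1) :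
    transvectionLift a • UniversalCoverAt.mk ℓ =
      UniversalCoverAt.mk ℓ := by
  refine Quotient.sound ?_
  refine ⟨{ toFun := fun p => transvection a ((1 - (p.1 : ℝ)) * (p.2 : ℝ)) • ℓ.1 p.2
            continuous_toFun := ?_
            map_zero_left := fun t => ?_
            map_one_left := fun t => ?_
            prop' := fun r t ht => ?_ }⟩
  · exact (continuous_transvection_comp a (f := fun p : unitInterval × unitInterval =>
      (1 - (p.1 : ℝ)) * (p.2 : ℝ)) (by fun_prop)).smul (ℓ.1.continuous.comp continuous_snd)
  · simp only [Set.Icc.coe_zero, sub_zero, one_mul]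
    rfl
  · simp [transvection_zero]
  · rcases ht with rfl | ht
    · change _ = transvection a ((0 : unitInterval) : ℝ) • ℓ.1 0
      simp [transvection_zero]
    · obtain rfl : t = 1 := ht
      change _ = transvection a ((1 : unitInterval) : ℝ) • ℓ.1 1
      rw [h]
      exact h _

/-- The canonical lift of a transvection has a fixed point on the universal cover of the Lagrangian
Grassmannian. -/
theorem exists_transvectionLift_smul_eq (lam₀ : Lagrangian g) (a : Fin g ⊕ Fin g → ℝ) :
    ∃ x : UniversalCoverAt (Lagrangian g) lam₀, transvectionLift a • x = x := by
  by_cases h : ∀ x ∈ lam₀.1, theta a x = 0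
  · exact ⟨_, transvectionLift_smul_mk lam₀ a ⟨ContinuousMap.const _ lam₀, rfl⟩
      fun s => transvection_smul_eq_self (Or.inr h) s⟩
  · push Not at h
    obtain ⟨x, hx, hax⟩ := h
    let f := (theta a x)⁻¹ • x
    have hf : f ∈ lam₀.1 := lam₀.1.smul_mem _ hx
    have haf : theta a f = 1 := by rw [theta_smul_right, inv_mul_cancel₀ hax]
    -- Since `θ(f - a, f) = -1`, the transvection along `f - a` carries `f ∈ lam₀` to `a`; the path
    -- thus ends at a Lagrangian containing `a`.
    refine ⟨_, transvectionLift_smul_mk lam₀ a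
      ⟨⟨fun t => transvection (f - a) (t : ℝ) • lam₀, ?_⟩, ?_⟩ fun s =>
        transvection_smul_eq_self (Or.inl ?_) s⟩
    · exact (continuous_transvection_comp (X := unitInterval) (f - a) continuous_subtype_val).smul
        continuous_const
    · simp [transvection_zero]
    · refine (coe_transvection_smul _ _ _).2 ⟨f, hf, ?_⟩
      have : theta (f - a) f = -1 := by
        rw [sub_eq_add_neg, theta_add_left, theta_self, ← neg_one_smul ℝ a, theta_smul_left, haf]
        ring
      rw [this]
      simp

end Lagrangian

/-! ### Squared phases of complex numbers -/

section Phase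

theorem coe_phaseSq {z : ℂ} (hz : z ≠ 0) : (phaseSq z hz : ℂ) = (z / (‖z‖ : ℂ)) ^ 2 := rfl

theorem phaseSq_mul {z w : ℂ} (hz : z ≠ 0) (hw : w ≠ 0) :
    phaseSq (z * w) (mul_ne_zero hz hw) = phaseSq z hz * phaseSq w hw := by
  refine Circle.ext ?_
  rw [Circle.coe_mul, coe_phaseSq, coe_phaseSq hz, coe_phaseSq hw]
  simp only [norm_mul, Complex.ofReal_mul, mul_div_mul_comm, mul_pow]

theorem circleExp_two_mul_arg {z : ℂ} (hz : z ≠ 0) : Circle.exp (2 * z.arg) = phaseSq z hz := by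
  refine Circle.ext ?_
  have h := Complex.norm_mul_exp_arg_mul_I z
  have hn : (‖z‖ : ℂ) ≠ 0 := Complex.ofReal_ne_zero.2 (norm_ne_zero_iff.2 hz)
  have h2 : z / ‖z‖ = Complex.exp (z.arg * Complex.I) := by
    rw [div_eq_iff hn, mul_comm, h]
  rw [Circle.coe_exp, coe_phaseSq, h2, ← Complex.exp_nat_mul]
  congr 1
  push_cast
  ring

end Phase

/-! ### The effect of a transvection on the determinant map -/

namespace TameStructure
variable {g : ℕ} (I : TameStructure g)

theorem continuous_det_frameMatrix (f₀ : LagrangianFrame g) :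
    Continuous fun f : LagrangianFrame g => (I.frameMatrix f₀ f).det := by
  refine Continuous.matrix_det (continuous_matrix fun i j => ?_)
  have hj : Continuous fun f : LagrangianFrame g => f.1 j :=
    (continuous_apply j).comp continuous_subtype_val
  have hθ : ∀ u : Fin g ⊕ Fin g → ℝ, Continuous fun v : Fin g ⊕ Fin g → ℝ => theta u v :=
    fun u => by
      simp only [theta]
      fun_prop
  have h1 : Continuous fun f : LagrangianFrame g => theta (f₀.1 i) (I.toMatrix *ᵥ f.1 j) :=
    (hθ _).comp (Continuous.matrix_mulVec continuous_const hj)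
  exact (Complex.continuous_ofReal.comp h1).add
    ((Complex.continuous_ofReal.comp ((hθ _).comp hj)).mul continuous_const)

theorem eta_add_right (u v w : Fin g ⊕ Fin g → ℝ) : I.eta u (v + w) = I.eta u v + I.eta u w := by
  simp only [eta, mulVec_add, theta_add_right, Complex.ofReal_add]
  ring

theorem eta_smul_right (u v : Fin g ⊕ Fin g → ℝ) (s : ℝ) : I.eta u (s • v) = s * I.eta u v := by
  simp only [eta, mulVec_smul, theta_smul_right, Complex.ofReal_mul]
  ring

theorem eta_toMatrix_right (u v : Fin g ⊕ Fin g → ℝ) :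
    I.eta u (I.toMatrix *ᵥ v) = Complex.I * I.eta u v := by
  simp only [eta, I.apply_apply, ← neg_one_smul ℝ v, theta_smul_right, Complex.ofReal_mul,
    Complex.ofReal_neg, Complex.ofReal_one]
  linear_combination -((theta u v : ℝ) : ℂ) * Complex.I_sq

theorem eta_sum_right (u : Fin g ⊕ Fin g → ℝ) (f : Fin g → Fin g ⊕ Fin g → ℝ) (b : Fin g → ℝ) :
    I.eta u (∑ j, b j • f j) = ∑ j, (b j : ℂ) * I.eta u (f j) := by
  let F : (Fin g ⊕ Fin g → ℝ) →+ ℂ := AddMonoidHom.mk' (I.eta u) (I.eta_add_right u)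
  change F _ = _
  rw [map_sum]
  exact Finset.sum_congr rfl fun j _ => I.eta_smul_right _ _ _

/-- The determinant of a frame matrix changes by a real factor depending on the base change only
when the frame is changed within its span. -/
theorem exists_det_frameMatrix_map (f₀ : LagrangianFrame g) {f f' : LagrangianFrame g}
    (h : f.span = f'.span) : ∃ b : ℝ, ∀ A : symplecticGroup (Fin g) ℝ,
      (I.frameMatrix f₀ (f'.map A)).det = (I.frameMatrix f₀ (f.map A)).det * b := by
  obtain ⟨B, hB⟩ := LagrangianFrame.exists_matrix h
  refine ⟨B.det, fun A => ?_⟩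
  have hM : I.frameMatrix f₀ (f'.map A) = I.frameMatrix f₀ (f.map A) * B.map Complex.ofRealHom := by
    ext i k
    have : (f'.map A).1 k = ∑ j, B j k • (f.map A).1 j := by
      simp only [LagrangianFrame.map, hB k, mulVec_sum, mulVec_smul]
    simp only [frameMatrix, of_apply, mul_apply, map_apply, this, eta_sum_right]
    exact Finset.sum_congr rfl fun j _ => mul_comm _ _
  rw [hM, det_mul]
  congr 1
  exact (RingHom.map_det Complex.ofRealHom B).symm

theorem LagrangianFrame_map_one (f : LagrangianFrame g) : f.map 1 = f :=
  Subtype.ext (funext fun _ => one_mulVec _)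

theorem detMap_eq (lam₀ : Lagrangian g) {lam : Lagrangian g} {f : LagrangianFrame g}
    (h : f.span = lam) : I.detMap lam₀ lam =
      phaseSq (I.frameMatrix lam₀.frame f).det (I.det_frameMatrix_ne_zero lam₀.frame f) :=
  I.phaseSq_frameMatrix_congr lam₀.frame (lam.span_frame.trans h.symm)

/-- The factor by which a transvection changes the determinant of a frame matrix. -/
theorem exists_det_frameMatrix_transvection (f₀ f : LagrangianFrame g) (a : Fin g ⊕ Fin g → ℝ) :
    ∃ κ : ℂ, (κ = 0 ∨ 0 < κ.im) ∧ ∀ t : ℝ, (I.frameMatrix f₀ (f.map (transvection a t))).det =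
      (I.frameMatrix f₀ f).det * (1 - t * κ) := by
  obtain ⟨p, q, hpq⟩ := I.frame_surjective f a
  set P := ∑ j, p j • f.1 j with hP
  set R := ∑ j, q j • f.1 j with hR
  have hRR : theta R P = 0 ∧ theta R R = 0 ∧ theta P P = 0 ∧ theta P R = 0 := by
    simp [hP, hR, theta_sum_right, theta_sum_left, f.2.2]
  -- `z` holds the complex coordinates of `a` in the frame, so the transvection perturbs the frame
  -- matrix by rank one and the matrix determinant lemma gives the factor `1 + t (w ⬝ᵥ z)`.
  let z : Fin g → ℂ := fun j => p j + q j * Complex.I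
  let w : Fin g → ℂ := fun j => ((theta a (f.1 j) : ℝ) : ℂ)
  have hz : I.frameMatrix f₀ f *ᵥ z = fun i => I.eta (f₀.1 i) a := by
    ext i
    rw [← hpq, eta_add_right, eta_toMatrix_right, hP, hR, eta_sum_right, eta_sum_right,
      Finset.mul_sum, ← Finset.sum_add_distrib]
    simp only [mulVec, dotProduct, frameMatrix, of_apply, z]
    exact Finset.sum_congr rfl fun j _ => by ring
  have hM : ∀ t : ℝ, I.frameMatrix f₀ (f.map (transvection a t)) =
      I.frameMatrix f₀ f * (1 + vecMulVec ((t : ℂ) • z) w) := by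
    intro t
    rw [Matrix.mul_add, Matrix.mul_one, mul_vecMulVec, mulVec_smul, hz]
    ext i j
    have : (f.map (transvection a t)).1 j = f.1 j + (t * theta a (f.1 j)) • a :=
      transvectionMatrix_mulVec _ _ _
    simp only [frameMatrix, of_apply, this, eta_add_right, eta_smul_right, Matrix.add_apply,
      vecMulVec_apply, w, Pi.smul_apply, smul_eq_mul, Complex.ofReal_mul]
    ring
  -- With `a = P + I R` and `P`, `R` in the Lagrangian, only pairings with `I R` survive. The
  -- imaginary part is `-γ(R, R)`, which is the source of the sign.
  have hwz : w ⬝ᵥ z = -(((theta P (I.toMatrix *ᵥ R) : ℝ) : ℂ) +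
    ((theta R (I.toMatrix *ᵥ R) : ℝ) : ℂ) * Complex.I) := by
    have h1 : w ⬝ᵥ z = ((theta a P : ℝ) : ℂ) + ((theta a R : ℝ) : ℂ) * Complex.I := by
      simp only [dotProduct, w, z, hP, hR, theta_sum_right, Complex.ofReal_sum, Finset.sum_mul,
        ← Finset.sum_add_distrib]
      refine Finset.sum_congr rfl fun j _ => ?_
      push_cast
      ring
    have h2 : theta a P = -theta P (I.toMatrix *ᵥ R) := by
      rw [← hpq, theta_add_left, hRR.2.2.1, zero_add, theta_skew]
    have h3 : theta a R = -theta R (I.toMatrix *ᵥ R) := by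
      rw [← hpq, theta_add_left, hRR.2.2.2, zero_add, theta_skew]
    rw [h1, h2, h3]
    push_cast
    ring
  refine ⟨((theta P (I.toMatrix *ᵥ R) : ℝ) : ℂ) +
    ((theta R (I.toMatrix *ᵥ R) : ℝ) : ℂ) * Complex.I, ?_, fun t => ?_⟩
  · by_cases h0 : R = 0
    · left
      simp [h0, theta]
    · right
      simpa using I.pos R h0
  · rw [hM, det_mul, vecMulVec_eq Unit, det_one_add_replicateCol_mul_replicateRow, dotProduct_smul, hwz]
    congr 1
    rw [smul_eq_mul]
    ring

/-- The factor is recovered from the ratio of determinants at `t = 1`. A change of frame multiplies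
both determinants by the same number, so it descends continuously to the Grassmannian. -/
theorem exists_continuous_factor (lam₀ : Lagrangian g) (a : Fin g ⊕ Fin g → ℝ) :
    ∃ κ : Lagrangian g → ℂ, Continuous κ ∧ (∀ lam, κ lam = 0 ∨ 0 < (κ lam).im) ∧
      ∀ lam (t : ℝ) (h : 1 - t * κ lam ≠ 0),
        I.detMap lam₀ (transvection a t • lam) = I.detMap lam₀ lam * phaseSq (1 - t * κ lam) h := by
  let k : LagrangianFrame g → ℂ := fun f =>
    1 - (I.frameMatrix lam₀.frame (f.map (transvection a 1))).det / (I.frameMatrix lam₀.frame f).det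
  have hk : ∀ f : LagrangianFrame g, (k f = 0 ∨ 0 < (k f).im) ∧ ∀ t : ℝ,
      (I.frameMatrix lam₀.frame (f.map (transvection a t))).det =
      (I.frameMatrix lam₀.frame f).det * (1 - t * k f) := by
    intro f
    obtain ⟨κ, h1, h2⟩ := I.exists_det_frameMatrix_transvection lam₀.frame f a
    have h3 : k f = κ := by
      simp only [k, h2]
      rw [mul_div_cancel_left₀ _ (I.det_frameMatrix_ne_zero _ _)]
      simp
    rw [h3]
    exact ⟨h1, h2⟩
  have hks : ∀ f f' : LagrangianFrame g, f.span = f'.span → k f' = k f := by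
    intro f f' h
    obtain ⟨b, hb⟩ := I.exists_det_frameMatrix_map lam₀.frame h
    have h1 := hb 1
    have hb0 : (b : ℂ) ≠ 0 := by
      rintro h0
      rw [h0, mul_zero] at h1
      exact I.det_frameMatrix_ne_zero _ _ h1
    rw [LagrangianFrame_map_one, LagrangianFrame_map_one] at h1
    simp only [k, hb, h1]
    rw [mul_div_mul_right _ _ hb0]
  refine ⟨fun lam => k lam.frame, ?_, fun lam => (hk lam.frame).1, fun lam t h => ?_⟩
  · refine continuous_coinduced_dom.2 ?_
    have : (fun lam : Lagrangian g => k lam.frame) ∘ LagrangianFrame.span = k :=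
      funext fun f => hks f _ f.span.span_frame.symm
    rw [this]
    exact continuous_const.sub (((I.continuous_det_frameMatrix _).comp
      (LagrangianFrame.continuous_map _)).div (I.continuous_det_frameMatrix _)
      fun f => I.det_frameMatrix_ne_zero _ _)
  · rw [I.detMap_eq lam₀ ((LagrangianFrame.span_map _ lam.frame).trans (by rw [lam.span_frame])),
      detMap, ← phaseSq_mul]
    congr 1
    exact (hk lam.frame).2 t

/-- By uniqueness of path lifting, any continuous phase along `ℓ` with the right initial value
computes the lift. -/
theorem detLift_mk (lam₀ : Lagrangian g) (ℓ : BasedPath (Lagrangian g) lam₀)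
    {Γ : unitInterval → ℝ} (hΓ : Continuous Γ) (h : ∀ t, Circle.exp (Γ t) = I.detMap lam₀ (ℓ.1 t))
    (h0 : Γ 0 = Complex.arg (I.detMap lam₀ lam₀ : ℂ)) :
    I.detLift lam₀ (UniversalCoverAt.mk ℓ) = Γ 1 := by
  have h' : Circle.exp ∘ Γ =
      (⟨I.detMap lam₀, I.continuous_detMap lam₀⟩ : C(Lagrangian g, Circle)).comp ℓ.1 := funext h
  exact (congrFun ((Circle.isCoveringMap_exp.eq_liftPath_iff _).2 ⟨hΓ, h', h0⟩) 1).symm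

theorem exists_detLift_path (lam₀ : Lagrangian g) (ℓ : BasedPath (Lagrangian g) lam₀) :
    ∃ Γ : C(unitInterval, ℝ), (∀ t, Circle.exp (Γ t) = I.detMap lam₀ (ℓ.1 t)) ∧
      Γ 0 = Complex.arg (I.detMap lam₀ lam₀ : ℂ) := by
  obtain ⟨Γ, h1, h2⟩ := Circle.isCoveringMap_exp.exists_path_lifts
    ((⟨I.detMap lam₀, I.continuous_detMap lam₀⟩ : C(Lagrangian g, Circle)).comp ℓ.1)
    (Complex.arg (I.detMap lam₀ lam₀ : ℂ))
    (by
      rw [Circle.exp_arg]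
      exact congrArg (I.detMap lam₀) ℓ.2)
  exact ⟨Γ, fun t => congrFun h1 t, h2⟩

end TameStructure

/-! ### Membership in the semigroup of non-positive displacement -/

section Semigroup
variable {g : ℕ}

theorem mul_mem_spTildeMinus {lam₀ : Lagrangian g} {s t : SpTilde g} (hs : s ∈ spTildeMinus lam₀)
    (ht : t ∈ spTildeMinus lam₀) : s * t ∈ spTildeMinus lam₀ := fun I x => by
  rw [mul_smul]
  exact (hs I _).trans (ht I x)

theorem list_prod_mem_spTildeMinus {lam₀ : Lagrangian g} (l : List (SpTilde g))
    (h : ∀ s ∈ l, s ∈ spTildeMinus lam₀) : l.prod ∈ spTildeMinus lam₀ := by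
  induction l with
  | nil => exact fun I x => by rw [List.prod_nil, one_smul]
  | cons s l ih =>
    rw [List.prod_cons]
    exact mul_mem_spTildeMinus (h s (by simp)) (ih fun t ht => h t (by simp [ht]))

/-- The canonical lifts of transvections have non-positive displacement. -/
theorem transvectionLift_mem_spTildeMinus (lam₀ : Lagrangian g) (a : Fin g ⊕ Fin g → ℝ) :
    transvectionLift a ∈ spTildeMinus lam₀ := by
  rintro I ⟨ℓ⟩
  obtain ⟨κ, hκc, hκ, hκd⟩ := I.exists_continuous_factor lam₀ a
  obtain ⟨Γ, hΓ, hΓ0⟩ := I.exists_detLift_path lam₀ ℓ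
  let z : unitInterval → ℂ := fun t => 1 - ((t : ℝ) : ℂ) * κ (ℓ.1 t)
  -- The factor never leaves the open lower half-plane together with `1`, so its principal argument
  -- is continuous along the path and non-positive.
  have hz : ∀ t, z t = 1 ∨ (z t).im < 0 := by
    intro t
    rcases hκ (ℓ.1 t) with h | h
    · left; simp [z, h]
    · rcases t.2.1.eq_or_lt with h0 | h0
      · left; simp [z, ← h0]
      · right
        have := mul_pos h0 h
        simpa [z] using this
  have hz0 : ∀ t, z t ≠ 0 := fun t h => by rcases hz t with h1 | h1 <;> simp [h] at h1
  have hzs : ∀ t, z t ∈ Complex.slitPlane := by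
    intro t
    rcases hz t with h | h
    · rw [h]; exact Complex.one_mem_slitPlane
    · exact Or.inr h.ne
  have hzc : Continuous z := by
    have : Continuous fun t : unitInterval => κ (ℓ.1 t) := hκc.comp ℓ.1.continuous
    fun_prop
  have harg : Continuous fun t => (z t).arg := continuous_iff_continuousAt.2 fun t =>
    (Complex.continuousAt_arg (hzs t)).comp hzc.continuousAt
  have h1 : I.detLift lam₀ (UniversalCoverAt.mk ℓ) = Γ 1 :=
    I.detLift_mk lam₀ ℓ Γ.continuous hΓ hΓ0
  have h2 : I.detLift lam₀ (transvectionLift a • UniversalCoverAt.mk ℓ) = Γ 1 + 2 * (z 1).arg := by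
    refine I.detLift_mk lam₀ _ (Γ := fun t => Γ t + 2 * (z t).arg)
      (Γ.continuous.add (harg.const_mul 2)) (fun t => ?_) ?_
    · rw [Circle.exp_add, hΓ, circleExp_two_mul_arg (hz0 t)]
      exact (hκd (ℓ.1 t) t (hz0 t)).symm
    · have : z 0 = 1 := by simp [z]
      simp [this, hΓ0]
  change I.detLift lam₀ (transvectionLift a • UniversalCoverAt.mk ℓ) ≤ I.detLift lam₀ (UniversalCoverAt.mk ℓ)
  rw [h1, h2]
  have : (z 1).arg ≤ 0 := by
    rcases hz 1 with h | h
    · simp [h]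
    · exact (Complex.arg_neg_iff.2 h).le
  linarith

end Semigroup

/-! ### Adjoints for the symplectic form, and eigenvalues -/

section Adjoint
variable {g : ℕ}

theorem theta_adjoint_iff {M N : Matrix (Fin g ⊕ Fin g) (Fin g ⊕ Fin g) ℝ} :
    (∀ u v, theta (M *ᵥ u) v = theta u (N *ᵥ v)) ↔ Mᵀ * J (Fin g) ℝ = J (Fin g) ℝ * N := by
  have h1 : ∀ u v, theta (M *ᵥ u) v = -(u ⬝ᵥ ((Mᵀ * J (Fin g) ℝ) *ᵥ v)) := fun u v => by
    rw [theta_eq, ← mulVec_mulVec, dotProduct_mulVec u, vecMul_transpose]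
  have h2 : ∀ u v, theta u (N *ᵥ v) = -(u ⬝ᵥ ((J (Fin g) ℝ * N) *ᵥ v)) := fun u v => by
    rw [theta_eq, ← mulVec_mulVec]
  constructor
  · intro h
    ext i j
    have := h (Pi.single i 1) (Pi.single j 1)
    rw [h1, h2, neg_inj] at this
    simpa using this
  · intro h u v
    rw [h1, h2, h]

theorem mem_sp_iff {x : Matrix (Fin g ⊕ Fin g) (Fin g ⊕ Fin g) ℝ} :
    x ∈ LieAlgebra.Symplectic.sp (Fin g) ℝ ↔ ∀ u v, theta (x *ᵥ u) v = -theta u (x *ᵥ v) := by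
  have h1 : x ∈ LieAlgebra.Symplectic.sp (Fin g) ℝ ↔ xᵀ * J (Fin g) ℝ = J (Fin g) ℝ * (-x) :=
    (mem_skewAdjointMatricesLieSubalgebra (J (Fin g) ℝ) x).trans
      (mem_skewAdjointMatricesSubmodule (J (Fin g) ℝ) x)
  rw [h1, ← theta_adjoint_iff]
  refine forall_congr' fun u => forall_congr' fun v => ?_
  rw [neg_mulVec, ← neg_one_smul ℝ (x *ᵥ v), theta_smul_right, neg_one_mul]

/-- A matrix that is self-adjoint for the inner product `θ(u, B v)` is diagonalizable. -/
theorem exists_eq_conjDiag {B C : Matrix (Fin g ⊕ Fin g) (Fin g ⊕ Fin g) ℝ}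
    (hB : ∀ u v, theta u (B *ᵥ v) = theta v (B *ᵥ u)) (hpos : ∀ u, u ≠ 0 → 0 < theta u (B *ᵥ u))
    (hC : ∀ u v, theta u (B *ᵥ (C *ᵥ v)) = theta v (B *ᵥ (C *ᵥ u))) :
    ∃ (Q : Matrix (Fin g ⊕ Fin g) (Fin g ⊕ Fin g) ℝ) (d : Fin g ⊕ Fin g → ℝ),
      IsUnit Q.det ∧ C = conjDiag Q d := by
  have h : ∀ (M : Matrix (Fin g ⊕ Fin g) (Fin g ⊕ Fin g) ℝ) (u v : Fin g ⊕ Fin g → ℝ),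
      u ⬝ᵥ ((-(J (Fin g) ℝ) * M) *ᵥ v) = theta u (M *ᵥ v) := fun M u v => by
    rw [theta_eq, ← mulVec_mulVec, neg_mulVec, dotProduct_neg]
  refine exists_diagonalization (G := -(J (Fin g) ℝ) * B) (fun u v => ?_) (fun u hu => ?_)
    fun u v => ?_
  · rw [h, h, hB]
  · rw [h]; exact hpos u hu
  · rw [Matrix.mul_assoc, h, h, ← mulVec_mulVec, ← mulVec_mulVec, hC]

theorem theta_conjDiag_comp {Q : Matrix (Fin g ⊕ Fin g) (Fin g ⊕ Fin g) ℝ} {d : Fin g ⊕ Fin g → ℝ}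
    (hQ : IsUnit Q.det) (h : ∀ u v, theta (conjDiag Q d *ᵥ u) v = theta u (conjDiag Q d *ᵥ v))
    (f : ℝ → ℝ) (u v : Fin g ⊕ Fin g → ℝ) :
    theta (conjDiag Q (f ∘ d) *ᵥ u) v = theta u (conjDiag Q (f ∘ d) *ᵥ v) :=
  theta_adjoint_iff.2 (conjDiag_transpose_intertwine hQ (theta_adjoint_iff.1 h) f) u v

theorem spectrum_conjDiag {n : Type*} [Fintype n] [DecidableEq n] {Q : Matrix n n ℝ}
    (hQ : IsUnit Q.det) (d : n → ℝ) : spectrum ℝ (conjDiag Q d) = Set.range d := by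
  ext k
  rw [spectrum.mem_iff]
  have h1 : algebraMap ℝ (Matrix n n ℝ) k - conjDiag Q d = conjDiag Q (fun i => k - d i) := by
    have : (fun i => k - d i) = k • (1 : n → ℝ) + -d := by ext; simp [sub_eq_add_neg]
    rw [this, conjDiag_add, conjDiag_smul, conjDiag_one hQ, conjDiag_neg, Algebra.algebraMap_eq_smul_one,
      sub_eq_add_neg]
  rw [h1, isUnit_iff_isUnit_det, conjDiag, det_mul, det_mul, det_diagonal]
  have hQi : IsUnit Q⁻¹.det := by rwa [isUnit_nonsing_inv_det_iff]
  have h2 : IsUnit (Q.det * (∏ i, (k - d i)) * Q⁻¹.det) ↔ ∀ i, k ≠ d i := by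
    rw [isUnit_iff_ne_zero] at *
    simp only [ne_eq, mul_eq_zero, hQ, hQi, or_false, false_or, Finset.prod_eq_zero_iff,
      Finset.mem_univ, true_and, sub_eq_zero, not_exists]
  rw [h2]
  push Not
  exact exists_congr fun i => eq_comm

theorem charpoly_conjDiag {n : Type*} [Fintype n] [DecidableEq n] {Q : Matrix n n ℝ}
    (hQ : IsUnit Q.det) (d : n → ℝ) :
    (conjDiag Q d).charpoly = ∏ i, (Polynomial.X - Polynomial.C (d i)) := by
  rw [conjDiag, charpoly_mul_comm, nonsing_inv_mul_cancel_left _ _ hQ, charpoly_diagonal]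

/-- If a diagonalizable matrix is conjugate to its negative, then sums over its eigenvalues are
invariant under negation. -/
theorem sum_neg_eq_sum {n : Type*} [Fintype n] [DecidableEq n] {Q W W' : Matrix n n ℝ}
    (hQ : IsUnit Q.det) {d : n → ℝ} (hW : W' * W = 1) (h : W * conjDiag Q d * W' = -conjDiag Q d)
    (f : ℝ → ℝ) : ∑ i, f (-d i) = ∑ i, f (d i) := by
  have h1 : (conjDiag Q (-d)).charpoly = (conjDiag Q d).charpoly := by
    rw [conjDiag_neg, ← h, charpoly_mul_comm, ← Matrix.mul_assoc, hW, Matrix.one_mul]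
  rw [charpoly_conjDiag hQ, charpoly_conjDiag hQ] at h1
  have h2 := congrArg Polynomial.roots h1
  have h3 : ∀ e : n → ℝ, (∏ i, (Polynomial.X - Polynomial.C (e i))).roots =
      Finset.univ.val.map e := fun e => by
    have := Polynomial.roots_multiset_prod_X_sub_C (Finset.univ.val.map e)
    rw [Multiset.map_map] at this
    exact this
  rw [h3, h3] at h2
  have h4 := congrArg (fun s => (Multiset.map f s).sum) h2
  simpa [Multiset.map_map, Function.comp_def] using h4

end Adjoint

/-! ### Unitary logarithms of a symplectic map with `θ(u, A u)` negative definite -/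

section Logarithm
variable {g : ℕ}

/-- A symplectic map `A` for which `θ(u, A u)` is negative definite lies in some `U(I)`, and is there
the exponential of an element of the window whose one-parameter group has no eigenvalues `≤ -1` up
to time `1`. -/
theorem exists_log {A : symplecticGroup (Fin g) ℝ} (hA : ∀ u, u ≠ 0 → theta u (A.1 *ᵥ u) < 0) :
    ∃ (I : TameStructure g) (x : LieAlgebra.Symplectic.sp (Fin g) ℝ), x ∈ unitaryWindow I ∧
      Commute A.1 I.toMatrix ∧ NormedSpace.exp x.1 = A.1 ∧
      ∀ t : unitInterval, ∀ μ : ℝ, 1 ≤ μ → IsUnit (NormedSpace.exp ((t : ℝ) • x.1) +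
        μ • (1 : Matrix (Fin g ⊕ Fin g) (Fin g ⊕ Fin g) ℝ)) := by
  obtain ⟨A', hAA', hA'A⟩ : ∃ A', A.1 * A' = 1 ∧ A' * A.1 = 1 :=
    ⟨(A⁻¹).1, congrArg Subtype.val (mul_inv_cancel A), congrArg Subtype.val (inv_mul_cancel A)⟩
  have hAθ := (mem_symplecticGroup_iff A.1).1 A.2
  have hA'θ : ∀ u v, theta u (A' *ᵥ v) = theta (A.1 *ᵥ u) v := fun u v => by
    rw [← hAθ, mulVec_mulVec, hAA', one_mulVec]
  have hA'θ' : ∀ u v, theta (A' *ᵥ u) v = theta u (A.1 *ᵥ v) := fun u v => by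
    rw [theta_skew, hA'θ, theta_skew, neg_neg]
  -- Modelled on `A = cos S + I sin S`, for which `B = -2 I sin S` and `C = cos S`; the complex
  -- structure is to be read off from the polar decomposition of `B`.
  set B := A' - A.1 with hBdef
  set C := (2⁻¹ : ℝ) • (A.1 + A') with hCdef
  have hBθ : ∀ u v, theta u (B *ᵥ v) = theta (A.1 *ᵥ u) v - theta u (A.1 *ᵥ v) := fun u v => by
    rw [hBdef, sub_mulVec, sub_eq_add_neg, ← neg_one_smul ℝ, theta_add_right, theta_smul_right, hA'θ]
    ring
  have hB : ∀ u v, theta u (B *ᵥ v) = theta v (B *ᵥ u) := fun u v => by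
    rw [hBθ, hBθ, theta_skew (A.1 *ᵥ v), theta_skew v]
    ring
  have hBpos : ∀ u, u ≠ 0 → 0 < theta u (B *ᵥ u) := fun u hu => by
    rw [hBθ, theta_skew (A.1 *ᵥ u)]
    linarith [hA u hu]
  have hC : ∀ u v, theta (C *ᵥ u) v = theta u (C *ᵥ v) := fun u v => by
    rw [hCdef]
    simp only [smul_mulVec, add_mulVec, theta_smul_left, theta_smul_right, theta_add_left,
      theta_add_right, hA'θ, hA'θ']
    ring
  have hBC : Commute B C := by
    rw [hBdef, hCdef]
    refine Commute.smul_right ?_ _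
    have h1 : Commute A.1 A' := hAA'.trans hA'A.symm
    exact (h1.symm.add_right (Commute.refl _)).sub_left ((Commute.refl _).add_right h1)
  have hB2 : B * B = (4 : ℝ) • (C * C - 1) := by
    rw [hBdef, hCdef, smul_mul_smul_comm]
    have : (A' - A.1) * (A' - A.1) = A' * A' + A.1 * A.1 - (2 : ℝ) • (1 : Matrix _ _ ℝ) := by
      rw [sub_mul, mul_sub, mul_sub, hAA', hA'A]
      module
    have h2 : (A.1 + A') * (A.1 + A') = A' * A' + A.1 * A.1 + (2 : ℝ) • (1 : Matrix _ _ ℝ) := by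
      rw [add_mul, mul_add, mul_add, hAA', hA'A]
      module
    rw [this, h2]
    module
  obtain ⟨Q, d, hQ, hCQ⟩ := exists_eq_conjDiag hB hBpos (C := C) (fun u v => by
    rw [mulVec_mulVec, hBC.eq, ← mulVec_mulVec, ← hC, hB])
  -- On an eigenvector `q` one has `B² q = 4 (d² - 1) q`; positivity of the form at `B q` forces `d²
  -- < 1`.
  have hd : ∀ i, d i ^ 2 < 1 := by
    intro i
    have hq := col_ne_zero hQ i
    have hq2 : C *ᵥ Q.col i = d i • Q.col i := by rw [hCQ]; exact conjDiag_mulVec_col hQ d i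
    have h1 := hBpos _ hq
    have hBq : B *ᵥ Q.col i ≠ 0 := fun h0 => by simp [h0, theta] at h1
    have h2 := hBpos _ hBq
    rw [mulVec_mulVec, hB2, smul_mulVec, sub_mulVec (C * C), one_mulVec, ← mulVec_mulVec, hq2, mulVec_smul,
      hq2, theta_smul_right, smul_smul, sub_eq_add_neg, ← neg_one_smul ℝ (Q.col i), ← add_smul,
      theta_smul_right, theta_skew] at h2
    nlinarith
  have hd' : ∀ i, 0 < √(1 - d i ^ 2) := fun i => Real.sqrt_pos.2 (by linarith [hd i])
  rw [hCQ] at hBC hC hB2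
  -- Since `(½ B)² = C² - 1`, multiplication by `E = (1 - C²)^(-1/2)` normalises `½ B` to square
  -- `-1`.
  let s : ℝ → ℝ := fun y => (√(1 - y ^ 2))⁻¹
  let E := conjDiag Q (s ∘ d)
  have hBE : Commute B E := commute_conjDiag_comp hQ hBC s
  have hCE : Commute (conjDiag Q d) E := commute_conjDiag_comp hQ (Commute.refl _) s
  have hEθ := theta_conjDiag_comp hQ hC s
  set K := (2⁻¹ : ℝ) • (B * E) with hK
  have hK2 : K * K = -1 := by
    have h1 : B * E * (B * E) = (4 : ℝ) • conjDiag Q ((d * d + (-1 : ℝ) • 1) * ((s ∘ d) * (s ∘ d))) := by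
      rw [Matrix.mul_assoc, ← Matrix.mul_assoc E, ← hBE.eq, Matrix.mul_assoc B E E,
        ← Matrix.mul_assoc B B, hB2, Matrix.smul_mul, ← conjDiag_mul hQ, ← conjDiag_mul hQ,
        conjDiag_add, ← conjDiag_mul hQ, conjDiag_smul, conjDiag_one hQ, neg_one_smul,
        sub_eq_add_neg]
    have h2 : (d * d + (-1 : ℝ) • 1) * ((s ∘ d) * (s ∘ d)) = (-1 : ℝ) • (1 : Fin g ⊕ Fin g → ℝ) := by
      ext i
      have h3 : √(1 - d i ^ 2) * √(1 - d i ^ 2) = 1 - d i ^ 2 :=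
        Real.mul_self_sqrt (by linarith [hd i])
      simp only [s, Pi.mul_apply, Pi.add_apply, Pi.smul_apply, Pi.one_apply, smul_eq_mul,
        Function.comp_apply, ← mul_inv, h3]
      have : 1 - d i ^ 2 ≠ 0 := by linarith [hd i]
      field_simp
      ring
    rw [hK, smul_mul_smul_comm, h1, h2, conjDiag_smul, conjDiag_one hQ]
    module
  have hKsymm : ∀ u v, theta u (K *ᵥ v) = theta v (K *ᵥ u) := fun u v => by
    rw [hK, smul_mulVec, smul_mulVec, theta_smul_right, theta_smul_right]
    congr 1
    rw [hBE.eq, ← mulVec_mulVec, ← hEθ, hB, mulVec_mulVec, hBE.eq]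
  have hKpos : ∀ u, u ≠ 0 → 0 < theta u (K *ᵥ u) := by
    intro u hu
    -- `F = E^(1/2)` is self-adjoint for `θ` and commutes with `B`, so `θ(u, B E u) = θ(F u, B F
    -- u)`.
    let r : ℝ → ℝ := fun y => √(s y)
    let F := conjDiag Q (r ∘ d)
    have hFF : F * F = E := by
      rw [conjDiag_mul hQ]
      congr 1
      ext i
      exact Real.mul_self_sqrt (inv_nonneg.2 (Real.sqrt_nonneg _))
    have hBF : Commute B F := commute_conjDiag_comp hQ hBC r
    have hFu : F *ᵥ u ≠ 0 := by
      intro h0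
      have h1 : K *ᵥ u = 0 := by
        rw [hK, ← hFF, smul_mulVec, ← mulVec_mulVec, ← mulVec_mulVec, h0]
        simp
      have h2 : (K * K) *ᵥ u = 0 := by rw [← mulVec_mulVec, h1, mulVec_zero]
      rw [hK2, neg_mulVec, one_mulVec, neg_eq_zero] at h2
      exact hu h2
    have h1 := hBpos _ hFu
    rw [theta_conjDiag_comp hQ hC r, mulVec_mulVec, mulVec_mulVec, hBF.symm.eq,
      Matrix.mul_assoc, hFF] at h1
    rw [hK, smul_mulVec, theta_smul_right]
    linarith
  let I : TameStructure g := ⟨K, hK2, hKsymm, hKpos⟩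
  -- The sign is dictated by `A = C - ½ B = C - K √(1 - C²)`.
  let f : ℝ → ℝ := fun y => -Real.arccos y
  let e : Fin g ⊕ Fin g → ℝ := f ∘ d
  have hKC : Commute K (conjDiag Q d) := (hBC.mul_left hCE.symm).smul_left _
  have hKe : Commute K (conjDiag Q e) := commute_conjDiag_comp hQ hKC f
  have heθ := theta_conjDiag_comp hQ hC f
  have hKθ : ∀ u v, theta (K *ᵥ u) v = -theta u (K *ᵥ v) := fun u v => by
    rw [theta_skew, hKsymm]
  have hexp := exp_smul_mul_conjDiag hQ hK2 hKe
  have hd1 : ∀ i, -1 < d i ∧ d i < 1 := fun i => abs_lt.1 ((sq_lt_one_iff_abs_lt_one _).1 (hd i))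
  have he : ∀ i, -Real.pi < e i ∧ e i ≤ 0 := by
    intro i
    refine ⟨neg_lt_neg ?_, neg_nonpos.2 (Real.arccos_nonneg _)⟩
    refine lt_of_le_of_ne (Real.arccos_le_pi _) fun h => ?_
    rw [Real.arccos_eq_pi] at h
    linarith [(hd1 i).1]
  refine ⟨I, ⟨K * conjDiag Q e, mem_sp_iff.2 fun u v => ?_⟩, ⟨?_, ?_⟩, ?_, ?_, ?_⟩
  · rw [← mulVec_mulVec, hKθ, heθ, mulVec_mulVec, ← hKe.eq]
  · exact ((Commute.refl K).mul_left hKe.symm)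
  · change spectrum ℝ (-(K * (K * conjDiag Q e))) ⊆ _
    rw [← Matrix.mul_assoc, hK2, Matrix.neg_mul, Matrix.one_mul, neg_neg, spectrum_conjDiag hQ]
    rintro _ ⟨i, rfl⟩
    exact ⟨by linarith [(he i).1, Real.pi_pos], (he i).2⟩
  · have hAB : A.1 = conjDiag Q d - (2⁻¹ : ℝ) • B := by
      rw [← hCQ, hCdef, hBdef]
      module
    have hKB : Commute K B := ((Commute.refl B).mul_left hBE.symm).smul_left _
    change Commute A.1 K
    rw [hAB]
    exact (hKC.sub_right (hKB.smul_right _)).symm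
  · have h1 := hexp 1
    rw [one_smul] at h1
    rw [h1]
    have h2 : (fun i => Real.cos (1 * e i)) = d := by
      ext i
      simp only [e, f, Function.comp_apply, one_mul, Real.cos_neg]
      exact Real.cos_arccos (hd1 i).1.le (hd1 i).2.le
    have h3 : (s ∘ d) * (fun i => Real.sin (1 * e i)) = (-1 : ℝ) • 1 := by
      ext i
      simp only [e, f, s, Function.comp_apply, one_mul, Real.sin_neg, Real.sin_arccos,
        Pi.mul_apply, Pi.smul_apply, Pi.one_apply, smul_eq_mul]
      have := (hd' i).ne'
      field_simp
    rw [h2, hK, Matrix.smul_mul, Matrix.mul_assoc, conjDiag_mul hQ, h3, conjDiag_smul,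
      conjDiag_one hQ, ← hCQ, hCdef, Matrix.mul_smul, Matrix.mul_one, hBdef]
    module
  · intro t μ hμ
    rw [hexp]
    -- The angles `t * e i` lie in `(-π, 0]`, where `exp(i t e)` is real only when it equals `1`.
    refine isUnit_add_smul_of_rotation hQ hK2 hKe t μ fun i h0 => ?_
    have hre := congrArg Complex.re h0
    have him := congrArg Complex.im h0
    simp only [Complex.add_re, Complex.add_im, Complex.exp_ofReal_mul_I_re,
      Complex.exp_ofReal_mul_I_im, Complex.ofReal_re, Complex.ofReal_im, Complex.zero_re,
      Complex.zero_im, add_zero] at hre him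
    have h1 : 0 ≤ -(t * e i) := by nlinarith [t.2.1, (he i).2]
    have h2 : -(t * e i) < Real.pi := by nlinarith [t.2.1, t.2.2, (he i).1, (he i).2]
    rcases h1.eq_or_lt with h3 | h3
    · rw [neg_eq_zero.1 h3.symm, Real.cos_zero] at hre
      linarith
    · have := Real.sin_pos_of_pos_of_lt_pi h3 h2
      rw [Real.sin_neg, him] at this
      simp at this

/-- The trace of any logarithm in a window of a symplectic map `A` that is conjugate to `-A⁻¹` and
for which `θ(u, A u)` is negative definite. -/
theorem trace_gammaMatrix_log {A W : symplecticGroup (Fin g) ℝ}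
    (hA : ∀ u, u ≠ 0 → theta u (A.1 *ᵥ u) < 0) (hW : A.1 * (W * A * W⁻¹).1 = -1)
    {I : TameStructure g} {x : LieAlgebra.Symplectic.sp (Fin g) ℝ} (hx : x ∈ unitaryWindow I)
    (hxA : NormedSpace.exp x.1 = A.1) : (gammaMatrix I x).trace = -(g * Real.pi) := by
  have hI2 := I.sq
  have hxI : x.1 = I.toMatrix * gammaMatrix I x := by
    rw [gammaMatrix, Matrix.mul_neg, ← Matrix.mul_assoc, hI2, Matrix.neg_mul, Matrix.one_mul, neg_neg]
  have hcomm : Commute I.toMatrix (gammaMatrix I x) :=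
    ((Commute.refl I.toMatrix).mul_right hx.1.symm).neg_right
  have hxθ := mem_sp_iff.1 x.2
  obtain ⟨Q, d, hQ, hS⟩ := exists_eq_conjDiag I.symm I.pos (C := gammaMatrix I x) (fun u v => by
    rw [theta_gammaMatrix, theta_gammaMatrix, theta_skew, hxθ, neg_neg])
  have hd : ∀ i, -(2 * Real.pi) < d i ∧ d i ≤ 0 := fun i => by
    have := hx.2
    rw [hS, spectrum_conjDiag hQ] at this
    exact this ⟨i, rfl⟩
  rw [hS] at hcomm
  have hexp := exp_smul_mul_conjDiag hQ hI2 hcomm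
  rw [← hS, ← hxI] at hexp
  have hAe : A.1 = conjDiag Q (fun i => Real.cos (d i)) +
      I.toMatrix * conjDiag Q (fun i => Real.sin (d i)) := by
    have := hexp 1
    simp only [one_smul, one_mul] at this
    rw [← this, hxA]
  have hA'e : (A⁻¹).1 = conjDiag Q (fun i => Real.cos (d i)) -
      I.toMatrix * conjDiag Q (fun i => Real.sin (d i)) := by
    have h1 := hexp (-1)
    have h2 : (fun i => Real.sin (-1 * d i)) = -fun i => Real.sin (d i) := by ext; simp
    simp only [neg_one_smul, neg_one_mul, Real.cos_neg] at h1 h2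
    rw [h2, conjDiag_neg, Matrix.mul_neg, Matrix.exp_neg, hxA, ← sub_eq_add_neg] at h1
    rw [← h1]
    exact (inv_eq_right_inv (congrArg Subtype.val (mul_inv_cancel A))).symm
  -- On an eigenvector `q`, `θ(q, A q) = sin(d i) γ(q, q)`. Within the window a negative sine
  -- confines `d i` to `(-π, 0)`, so `d i` is determined by its cosine.
  have hsin : ∀ i, Real.sin (d i) < 0 := by
    intro i
    have hq := col_ne_zero hQ i
    have h1 := hA _ hq
    rw [hAe, add_mulVec, ← mulVec_mulVec, conjDiag_mulVec_col hQ, conjDiag_mulVec_col hQ,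
      mulVec_smul, theta_add_right, theta_smul_right, theta_smul_right, theta_self] at h1
    have h2 := I.pos _ hq
    nlinarith
  have harc : ∀ i, Real.arccos (Real.cos (d i)) = -d i := by
    intro i
    rw [← Real.cos_neg]
    refine Real.arccos_cos (by linarith [(hd i).2]) ?_
    by_contra hlt
    have h1 : 0 ≤ Real.sin (d i + 2 * Real.pi) :=
      Real.sin_nonneg_of_nonneg_of_le_pi (by linarith [(hd i).1]) (by linarith)
    rw [Real.sin_add_two_pi] at h1
    exact absurd (hsin i) (not_lt.2 h1)
  have hsum2 : A.1 + (A⁻¹).1 = (2 : ℝ) • conjDiag Q (fun i => Real.cos (d i)) := by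
    rw [hAe, hA'e]
    module
  -- Conjugation by `W` sends `A` to `-A⁻¹` and `A⁻¹` to `-A`, hence negates `A + A⁻¹`.
  have hconj : W.1 * conjDiag Q (fun i => Real.cos (d i)) * (W⁻¹).1 =
      -conjDiag Q (fun i => Real.cos (d i)) := by
    have hAbar : (W * A * W⁻¹).1 = -(A⁻¹).1 := by
      have h1 : (A⁻¹).1 * A.1 = 1 := congrArg Subtype.val (inv_mul_cancel A)
      have h2 := congrArg (fun M => (A⁻¹).1 * M) hW
      simp only [← Matrix.mul_assoc, h1, Matrix.one_mul, Matrix.mul_neg, Matrix.mul_one] at h2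
      exact h2
    have hAbar' : (W * A⁻¹ * W⁻¹).1 = -A.1 := by
      have h0 : W * A⁻¹ * W⁻¹ = (W * A * W⁻¹)⁻¹ := by group
      have h1 : (W * A * W⁻¹).1 * (W * A⁻¹ * W⁻¹).1 = 1 := by
        rw [h0]; exact congrArg Subtype.val (mul_inv_cancel (W * A * W⁻¹))
      have h2 := congrArg (fun M => A.1 * M) h1
      simp only [← Matrix.mul_assoc, hW, Matrix.neg_mul, Matrix.one_mul, Matrix.mul_one] at h2
      rw [← h2, neg_neg]
    have h3 : W.1 * (A.1 + (A⁻¹).1) * (W⁻¹).1 = -(A.1 + (A⁻¹).1) := by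
      rw [Matrix.mul_add, Matrix.add_mul, neg_add, add_comm (-A.1), ← hAbar, ← hAbar']
      rfl
    rw [hsum2, Matrix.mul_smul, Matrix.smul_mul, ← smul_neg] at h3
    exact smul_right_injective _ (two_ne_zero (α := ℝ)) h3
  -- Summing `arccos(-y) = π - arccos y` over the `2g` eigenvalues yields `2gπ + ∑ d i = -∑ d i`.
  have hkey := sum_neg_eq_sum hQ (congrArg Subtype.val (inv_mul_cancel W)) hconj Real.arccos
  simp only [Real.arccos_neg, harc, Finset.sum_sub_distrib, Finset.sum_neg_distrib,
    Finset.sum_const, Finset.card_univ, Fintype.card_sum, Fintype.card_fin, nsmul_eq_mul,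
    Nat.cast_add] at hkey
  rw [hS, conjDiag_trace hQ]
  linarith

end Logarithm

/-! ### Unitary groups are maximal compact -/

namespace TameStructure
variable {g : ℕ} (I : TameStructure g)

theorem theta_toMatrix_left (u v : Fin g ⊕ Fin g → ℝ) :
    theta (I.toMatrix *ᵥ u) v = -theta u (I.toMatrix *ᵥ v) := by
  rw [theta_skew, I.symm]

theorem theta_toMatrix_toMatrix (u v : Fin g ⊕ Fin g → ℝ) :
    theta (I.toMatrix *ᵥ u) (I.toMatrix *ᵥ v) = theta u v := by
  rw [theta_toMatrix_left, I.apply_apply, ← neg_one_smul ℝ v, theta_smul_right]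
  ring

/-- A tamed complex structure, as a symplectic map. -/
def toSymplectic : symplecticGroup (Fin g) ℝ :=
  ⟨I.toMatrix, (mem_symplecticGroup_iff _).2 I.theta_toMatrix_toMatrix⟩

theorem toSymplectic_mem : I.toSymplectic ∈ I.unitary := Commute.refl I.toMatrix

theorem mem_unitary_iff {A : symplecticGroup (Fin g) ℝ} :
    A ∈ I.unitary ↔ Commute A.1 I.toMatrix := Iff.rfl

theorem nonneg (u : Fin g ⊕ Fin g → ℝ) : 0 ≤ theta u (I.toMatrix *ᵥ u) := by
  by_cases h : u = 0
  · simp [h, theta]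
  · exact (I.pos u h).le

theorem cauchy_schwarz (u v : Fin g ⊕ Fin g → ℝ) : theta u (I.toMatrix *ᵥ v) ^ 2 ≤
    theta u (I.toMatrix *ᵥ u) * theta v (I.toMatrix *ᵥ v) := by
  by_cases hv : v = 0
  · simp [hv, theta]
  · have h := I.nonneg (theta v (I.toMatrix *ᵥ v) • u + (-theta u (I.toMatrix *ᵥ v)) • v)
    simp only [mulVec_add, mulVec_smul, theta_add_left, theta_add_right, theta_smul_left,
      theta_smul_right, I.symm v u] at h
    have hp := I.pos v hv
    refine le_of_mul_le_mul_left ?_ hp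
    nlinarith

/-- Unitary maps preserve the inner product `γ`, so Cauchy–Schwarz bounds all matrix entries by the
trace `M` of the Gram matrix of `γ`; the defining equations are closed. -/
theorem isCompact_unitary : IsCompact (I.unitary : Set (symplecticGroup (Fin g) ℝ)) := by
  rw [Topology.IsEmbedding.subtypeVal.isCompact_iff]
  let e : Fin g ⊕ Fin g → Fin g ⊕ Fin g → ℝ := fun k => Pi.single k 1
  let γ : Fin g ⊕ Fin g → ℝ := fun k => theta (e k) (I.toMatrix *ᵥ e k)
  let M : ℝ := ∑ k, γ k
  have hγ0 : ∀ k, 0 ≤ γ k := fun k => I.nonneg _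
  have hγ : ∀ k, γ k ≤ M := fun k =>
    Finset.single_le_sum (f := γ) (fun i _ => hγ0 i) (Finset.mem_univ k)
  have hcoord : ∀ (v : Fin g ⊕ Fin g → ℝ) i, v i ^ 2 = theta (e i.swap) v ^ 2 := by
    rintro v (i | i) <;> simp [e, theta, Pi.single_apply]
  have hbound : ∀ (v : Fin g ⊕ Fin g → ℝ) i, v i ^ 2 ≤ M * theta v (I.toMatrix *ᵥ v) := by
    intro v i
    have h1 := I.cauchy_schwarz (I.toMatrix *ᵥ e i.swap) v
    rw [I.theta_toMatrix_toMatrix, I.theta_toMatrix_toMatrix] at h1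
    rw [hcoord]
    exact h1.trans (mul_le_mul_of_nonneg_right (hγ _) (I.nonneg v))
  have hK : IsCompact {N : Matrix (Fin g ⊕ Fin g) (Fin g ⊕ Fin g) ℝ | ∀ i j, N i j ∈ Set.Icc (-M) M} := by
    have := isCompact_univ_pi fun _ : Fin g ⊕ Fin g =>
      isCompact_univ_pi fun _ : Fin g ⊕ Fin g => isCompact_Icc (a := -M) (b := M)
    have hset : {N : Matrix (Fin g ⊕ Fin g) (Fin g ⊕ Fin g) ℝ | ∀ i j, N i j ∈ Set.Icc (-M) M} =
        Set.univ.pi fun _ => Set.univ.pi fun _ => Set.Icc (-M) M := by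
      ext N
      exact ⟨fun h i _ j _ => h i j, fun h i j => h i trivial j trivial⟩
    rw [hset]
    exact this
  refine hK.of_isClosed_subset ?_ ?_
  · have : (Subtype.val '' (I.unitary : Set (symplecticGroup (Fin g) ℝ))) =
        {N | Nᵀ * J (Fin g) ℝ * N = J (Fin g) ℝ} ∩ {N | N * I.toMatrix = I.toMatrix * N} := by
      ext N
      constructor
      · rintro ⟨A, hA, rfl⟩
        exact ⟨SymplecticGroup.mem_iff'.1 A.2, hA⟩
      · rintro ⟨h1, h2⟩
        exact ⟨⟨N, SymplecticGroup.mem_iff'.2 h1⟩, h2, rfl⟩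
    rw [this]
    exact (isClosed_eq (by fun_prop) continuous_const).inter (isClosed_eq (by fun_prop) (by fun_prop))
  · rintro _ ⟨A, hA, rfl⟩ i j
    have hA' : A.1 * I.toMatrix = I.toMatrix * A.1 := hA
    have h1 := hbound (A.1 *ᵥ e j) i
    rw [mulVec_mulVec, ← hA', ← mulVec_mulVec, (mem_symplecticGroup_iff A.1).1 A.2] at h1
    have h2 : (A.1 *ᵥ e j) i = A.1 i j := by simp [e]
    rw [h2] at h1
    have hM : 0 ≤ M := Finset.sum_nonneg fun i _ => hγ0 i
    have h3 : A.1 i j ^ 2 ≤ M ^ 2 := by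
      rw [_root_.sq M]
      exact h1.trans (mul_le_mul_of_nonneg_left (hγ j) hM)
    exact abs_le.1 (abs_le_of_sq_le_sq h3 hM)

/-- The unitary group of a tamed complex structure is a maximal compact subgroup. -/
theorem isMaximalCompact_unitary : IsMaximalCompact I.unitary := by
  refine ⟨I.isCompact_unitary, fun L hL hle => le_antisymm (fun b hb => ?_) hle⟩
  -- An eigenvalue `e > 1` would make `γ(q, S^k q) = e^k γ(q, q)` unbounded on the compact group
  -- `L`.
  have heig : ∀ S ∈ L, ∀ (q : Fin g ⊕ Fin g → ℝ) (e : ℝ), q ≠ 0 → S.1 *ᵥ q = e • q → e ≤ 1 := by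
    intro S hS q e hq he
    have hcont : Continuous fun A : symplecticGroup (Fin g) ℝ => theta q (I.toMatrix *ᵥ (A.1 *ᵥ q)) := by
      have : Continuous fun A : symplecticGroup (Fin g) ℝ => I.toMatrix *ᵥ (A.1 *ᵥ q) := by fun_prop
      simp only [theta]
      fun_prop
    obtain ⟨M, hM⟩ := hL.bddAbove_image hcont.continuousOn
    have hp := I.pos q hq
    have hpow : ∀ k : ℕ, (S ^ k).1 *ᵥ q = e ^ k • q := by
      intro k
      induction k with
      | zero => simp
      | succ k ih =>
        rw [pow_succ', Submonoid.coe_mul, ← mulVec_mulVec, ih, mulVec_smul, he, smul_smul, pow_succ]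
    by_contra hlt
    obtain ⟨k, hk⟩ := pow_unbounded_of_one_lt (M / theta q (I.toMatrix *ᵥ q)) (not_le.1 hlt)
    have h1 := hM ⟨S ^ k, L.pow_mem hS k, rfl⟩
    simp only [hpow, mulVec_smul, theta_smul_right] at h1
    rw [div_lt_iff₀ hp] at hk
    linarith
  let ι := I.toSymplectic
  have hι : ι ∈ L := hle I.toSymplectic_mem
  -- Here `I P = b⁻¹ I b`, so `γ(u, P v)` is the pull-back of `γ` by `b` and `P` is self-adjoint and
  -- positive. As `P` and `P⁻¹` lie in `L`, all eigenvalues are `1`; then `P = 1`, which says that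
  -- `b` commutes with `I`.
  let P := ι⁻¹ * b⁻¹ * ι * b
  have hP : P ∈ L := L.mul_mem (L.mul_mem (L.mul_mem (L.inv_mem hι) (L.inv_mem hb)) hι) hb
  have hIP : I.toMatrix * P.1 = (b⁻¹).1 * I.toMatrix * b.1 := by
    have : ι * P = b⁻¹ * ι * b := by simp only [P]; group
    exact congrArg Subtype.val this
  have hbθ := (mem_symplecticGroup_iff b.1).1 b.2
  have hbb : b.1 * (b⁻¹).1 = 1 := congrArg Subtype.val (mul_inv_cancel b)
  have hPθ : ∀ u v, theta u (I.toMatrix *ᵥ (P.1 *ᵥ v)) =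
      theta (b.1 *ᵥ u) (I.toMatrix *ᵥ (b.1 *ᵥ v)) := by
    intro u v
    rw [mulVec_mulVec, hIP, ← hbθ, mulVec_mulVec, ← Matrix.mul_assoc, ← Matrix.mul_assoc, hbb,
      Matrix.one_mul, ← mulVec_mulVec]
  obtain ⟨Q, d, hQ, hPQ⟩ := exists_eq_conjDiag I.symm I.pos (C := P.1) (fun u v => by
    rw [hPθ, hPθ, I.symm])
  have hd : d = 1 := by
    ext i
    have hq := col_ne_zero hQ i
    have h1 : P.1 *ᵥ Q.col i = d i • Q.col i := by rw [hPQ]; exact conjDiag_mulVec_col hQ d i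
    have h0 : 0 < d i := by
      have h2 := hPθ (Q.col i) (Q.col i)
      rw [h1, mulVec_smul, theta_smul_right] at h2
      have hbq : b.1 *ᵥ Q.col i ≠ 0 := fun h3 =>
        hq (mulVec_injective_of_isUnit ((isUnit_iff_isUnit_det _).2
          (SymplecticGroup.symplectic_det b.2)) (h3.trans (mulVec_zero b.1).symm))
      exact (pos_iff_pos_of_mul_pos (h2 ▸ I.pos _ hbq)).2 (I.pos _ hq)
    have h2 : (P⁻¹).1 *ᵥ Q.col i = (d i)⁻¹ • Q.col i := by
      have h3 : (P⁻¹).1 * P.1 = 1 := congrArg Subtype.val (inv_mul_cancel P)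
      have h4 := congrArg (fun v => (d i)⁻¹ • ((P⁻¹).1 *ᵥ v)) h1
      simp only [mulVec_mulVec, h3, one_mulVec, mulVec_smul, smul_smul, inv_mul_cancel₀ h0.ne',
        one_smul] at h4
      exact h4.symm
    have h3 := heig P hP _ _ hq h1
    have h4 := heig P⁻¹ (L.inv_mem hP) _ _ hq h2
    rw [inv_le_one₀ h0] at h4
    exact le_antisymm h3 h4
  have hP1 : P.1 = 1 := by rw [hPQ, hd, conjDiag_one hQ]
  rw [hP1, Matrix.mul_one] at hIP
  rw [mem_unitary_iff]
  change b.1 * I.toMatrix = I.toMatrix * b.1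
  nth_rewrite 1 [hIP]
  rw [← Matrix.mul_assoc, ← Matrix.mul_assoc, hbb, Matrix.one_mul]

end TameStructure

/-! ### Conjugacy of `h` and `h̄` in the braid group -/

section Conjugation

/-- The products of a sequence of elements, non-neighbouring ones of which commute, in increasing
and in decreasing order are conjugate. -/
theorem exists_conj_reverse {G : Type*} [Group G] (t : ℕ → G)
    (h : ∀ i j, i + 1 < j → t i * t j = t j * t i) (n : ℕ) :
    ∃ w ∈ Subgroup.closure {x | ∃ i, i + 1 < n ∧ t i = x},
      w * (List.ofFn fun i : Fin n => t i).prod * w⁻¹ =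
        (List.ofFn fun i : Fin n => t i.rev).prod := by
  induction n with
  | zero => exact ⟨1, Subgroup.one_mem _, by simp⟩
  | succ n ih =>
    obtain ⟨w, hw, hwn⟩ := ih
    have hrev : (List.ofFn fun i : Fin (n + 1) => t i.rev).prod =
        t n * (List.ofFn fun i : Fin n => t i.rev).prod := by
      simp [List.ofFn_succ]
    have hfwd : (List.ofFn fun i : Fin (n + 1) => t i).prod =
        (List.ofFn fun i : Fin n => t i).prod * t n := by
      rw [List.ofFn_succ', List.concat_eq_append, List.prod_append]
      simp
    set p := (List.ofFn fun i : Fin n => t i).prod with hp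
    have hpm : p ∈ Subgroup.closure {x | ∃ i, i + 1 < n + 1 ∧ t i = x} := by
      refine Subgroup.list_prod_mem _ fun x hx => ?_
      obtain ⟨i, rfl⟩ := (List.mem_ofFn' _ _).1 hx
      exact Subgroup.subset_closure ⟨i, by omega, rfl⟩
    -- `w` is a word in the `t i` with `i + 1 < n`, all of which commute with `t n`; the location of
    -- `w` is part of the induction for this purpose.
    have hcomm : w * t n = t n * w := by
      have hle : Subgroup.closure {x | ∃ i, i + 1 < n ∧ t i = x} ≤
          Subgroup.centralizer {t n} := by
        rw [Subgroup.closure_le]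
        rintro _ ⟨i, hi, rfl⟩
        rw [SetLike.mem_coe, Subgroup.mem_centralizer_singleton_iff]
        exact h i n hi
      exact Subgroup.mem_centralizer_singleton_iff.1 (hle hw)
    -- Conjugation by `p⁻¹` rotates `p * t n` to `t n * p`, and `w` then reverses `p`.
    refine ⟨w * p⁻¹, Subgroup.mul_mem _ (Subgroup.closure_mono ?_ hw) (Subgroup.inv_mem _ hpm), ?_⟩
    · rintro _ ⟨i, hi, rfl⟩
      exact ⟨i, by omega, rfl⟩
    · rw [hrev, hfwd, ← hwn]
      calc w * p⁻¹ * (p * t n) * (w * p⁻¹)⁻¹ = w * t n * p * w⁻¹ := by group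
        _ = t n * (w * p * w⁻¹) := by rw [hcomm]; group

/-- The braids `h` and `h̄` are conjugate. -/
theorem exists_braidH_conj (n : ℕ) : ∃ w : BraidGroup n, w * braidH n * w⁻¹ = braidHBar n := by
  let t : ℕ → BraidGroup n := fun i => if h : i < n then braidGen ⟨i, h⟩ else 1
  have ht : ∀ i : Fin n, t i = braidGen i := fun i => dif_pos i.2
  have hcomm : ∀ i j, i + 1 < j → t i * t j = t j * t i := by
    intro i j hij
    by_cases hj : j < n
    · have hi : i < n := by omega
      have h1 := PresentedGroup.one_of_mem (rels := braidRelations n)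
        (x := FreeGroup.of ⟨i, hi⟩ * FreeGroup.of ⟨j, hj⟩ *
          (FreeGroup.of ⟨j, hj⟩ * FreeGroup.of ⟨i, hi⟩)⁻¹) (Or.inl ⟨⟨i, hi⟩, ⟨j, hj⟩, hij, rfl⟩)
      rw [map_mul, map_inv, map_mul, map_mul, mul_inv_eq_one] at h1
      simp only [t, dif_pos hi, dif_pos hj]
      exact h1
    · simp [t, hj]
  obtain ⟨w, -, hw⟩ := exists_conj_reverse t hcomm n
  refine ⟨w, ?_⟩
  simp only [ht] at hw
  exact hw

end Conjugation

/-! ### Application to the representation of the braid group and its lift -/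

section Representation
variable {g : ℕ}

theorem spIntToReal_injective : Function.Injective (spIntToReal g) := by
  intro A B h
  refine Subtype.ext (Matrix.map_injective (f := Int.castRingHom ℝ) Int.cast_injective ?_)
  exact congrArg Subtype.val h

theorem spIntToReal_transvection (a : Fin g ⊕ Fin g → ℤ) :
    spIntToReal g (transvection a 1) = transvection (toReal a) 1 := by
  refine Subtype.ext ?_
  change (transvectionMatrix a 1).map (Int.castRingHom ℝ) = transvectionMatrix (toReal a) 1
  ext i j
  have h : (Pi.single j (1 : ℝ) : Fin g ⊕ Fin g → ℝ) = toReal (Pi.single j (1 : ℤ)) := by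
    ext k
    by_cases hk : k = j
    · subst hk; simp [toReal]
    · simp [toReal, hk]
  simp only [transvectionMatrix, one_smul, map_apply, Matrix.add_apply, vecMulVec_apply, h,
    theta_toReal, Int.coe_castRingHom]
  simp [toReal, Matrix.one_apply]

theorem proj_transvectionLift (a : Fin g ⊕ Fin g → ℝ) :
    UniversalCover.proj (transvectionLift a) = transvection a 1 := rfl

variable {c : Fin (2 * g + 1) → Fin g ⊕ Fin g → ℤ}

theorem proj_sigmaTilde (hc : IsChain c) (b : BraidGroup (2 * g + 1)) :
    UniversalCover.proj (sigmaTilde c hc b) = spIntToReal g (sigma c hc b) := by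
  have : UniversalCover.proj.comp (sigmaTilde c hc) = (spIntToReal g).comp (sigma c hc) := by
    refine PresentedGroup.ext fun i => ?_
    change UniversalCover.proj (sigmaTilde c hc (braidGen i)) =
      spIntToReal g (sigma c hc (braidGen i))
    rw [sigmaTilde, sigma, braidLift_gen, braidLift_gen, proj_transvectionLift,
      spIntToReal_transvection]
  exact DFunLike.congr_fun this b

theorem IsChain.rev (hc : IsChain c) : IsChain fun i => c i.rev := by
  refine ⟨fun i j hij => ?_, fun i j hij => ?_⟩
  · rw [theta_skew]
    have := hc.1 j.rev i.rev (by simp only [Fin.val_rev]; omega)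
    rcases this with h | h <;> simp [h]
  · rw [theta_skew, hc.2 j.rev i.rev (by simp only [Fin.val_rev]; omega), neg_zero]

theorem sigmaTilde_braidH (hc : IsChain c) : sigmaTilde c hc (braidH (2 * g + 1)) =
    (List.ofFn fun i => transvectionLift (toReal (c i))).prod := by
  rw [braidH, map_list_prod, List.map_ofFn]
  congr 2
  ext1 i
  simp [sigmaTilde]

theorem sigma_braidH (hc : IsChain c) : sigma c hc (braidH (2 * g + 1)) =
    (List.ofFn fun i => transvection (c i) 1).prod := by
  rw [braidH, map_list_prod, List.map_ofFn]
  congr 2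
  ext1 i
  simp [sigma]

/-- Reversing the product amounts to reversing the chain, so what is proved for `h` and all chains
covers `h̄`. -/
theorem sigmaTilde_braidHBar (hc : IsChain c) : sigmaTilde c hc (braidHBar (2 * g + 1)) =
    sigmaTilde _ hc.rev (braidH (2 * g + 1)) := by
  rw [sigmaTilde_braidH, braidHBar, map_list_prod, List.map_ofFn]
  congr 2
  ext1 i
  simp [sigmaTilde]

theorem sigma_braidHBar (hc : IsChain c) : sigma c hc (braidHBar (2 * g + 1)) =
    sigma _ hc.rev (braidH (2 * g + 1)) := by
  rw [sigma_braidH, braidHBar, map_list_prod, List.map_ofFn]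
  congr 2
  ext1 i
  simp [sigma]

/-- The signs of the vectors of a chain can be chosen such that consecutive vectors have pairing
`-1`. -/
theorem IsChain.exists_normal (hc : IsChain c) : ∃ d : ℕ → Fin g ⊕ Fin g → ℝ,
    IsNormalChain (2 * g + 1) (-1) d ∧ ∀ i : Fin (2 * g + 1),
      d i = toReal (c i) ∨ d i = -toReal (c i) := by
  let a : ℕ → Fin g ⊕ Fin g → ℝ := fun k => if h : k < 2 * g + 1 then toReal (c ⟨k, h⟩) else 0
  have ha : ∀ k (h : k < 2 * g + 1), a k = toReal (c ⟨k, h⟩) := fun k h => dif_pos h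
  have hnext : ∀ k, k + 1 < 2 * g + 1 → theta (a k) (a (k + 1)) = 1 ∨ theta (a k) (a (k + 1)) = -1 := by
    intro k hk
    rw [ha k (by omega), ha (k + 1) hk, theta_toReal]
    rcases hc.1 ⟨k, by omega⟩ ⟨k + 1, hk⟩ rfl with h | h <;> simp [h]
  -- The recursion is solved from `ε_k ε_{k+1} θ(a_k, a_{k+1}) = -1`, all three factors being signs.
  let ε : ℕ → ℝ := fun k => Nat.rec 1 (fun k e => -(e * theta (a k) (a (k + 1)))) k
  have hε : ∀ k, k < 2 * g + 1 → ε k = 1 ∨ ε k = -1 := by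
    intro k
    induction k with
    | zero => exact fun _ => Or.inl rfl
    | succ k ih =>
      intro hk
      have h1 : ε (k + 1) = -(ε k * theta (a k) (a (k + 1))) := rfl
      rw [h1]
      rcases ih (by omega) with h | h <;> rcases hnext k hk with h' | h' <;> simp [h, h']
  refine ⟨fun k => ε k • a k, ⟨fun k hk => ?_, fun i j hij hj => ?_⟩, fun i => ?_⟩
  · have h1 : ε (k + 1) = -(ε k * theta (a k) (a (k + 1))) := rfl
    rw [theta_smul_left, theta_smul_right, h1]
    rcases hε k (by omega) with h | h <;> rcases hnext k hk with h' | h' <;> simp [h, h']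
  · rw [theta_smul_left, theta_smul_right, ha i (by omega), ha j hj, theta_toReal,
      hc.2 ⟨i, by omega⟩ ⟨j, hj⟩ hij]
    simp
  · change ε i • a i = _ ∨ ε i • a i = _
    rw [ha i i.2]
    rcases hε i i.2 with h | h <;> simp [h]

variable {d : ℕ → Fin g ⊕ Fin g → ℝ}

theorem spIntToReal_sigma_braidH (hc : IsChain c)
    (hd : ∀ i : Fin (2 * g + 1), d i = toReal (c i) ∨ d i = -toReal (c i)) :
    spIntToReal g (sigma c hc (braidH (2 * g + 1))) = chainProd d 1 (2 * g + 1) := by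
  rw [sigma_braidH, map_list_prod, List.map_ofFn, chainProd]
  congr 2
  ext1 i
  rw [Function.comp_apply, spIntToReal_transvection]
  rcases hd i with h | h
  · rw [h]
  · rw [h, transvection_neg]

theorem sigmaTilde_braidH_eq (hc : IsChain c)
    (hd : ∀ i : Fin (2 * g + 1), d i = toReal (c i) ∨ d i = -toReal (c i)) :
    sigmaTilde c hc (braidH (2 * g + 1)) =
      (List.ofFn fun i : Fin (2 * g + 1) => transvectionLift (d i)).prod := by
  rw [sigmaTilde_braidH]
  congr 2
  ext1 i
  rcases hd i with h | h
  · rw [h]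
  · rw [h, transvectionLift_neg]

/-- The images of `h` and `h̄` in the symplectic group are inverse to each other up to sign. -/
theorem sigma_braidH_mul_braidHBar (hc : IsChain c) :
    (spIntToReal g (sigma c hc (braidH (2 * g + 1)))).1 *
      (spIntToReal g (sigma c hc (braidHBar (2 * g + 1)))).1 = -1 := by
  obtain ⟨d, hd, hdc⟩ := hc.exists_normal
  rw [sigma_braidHBar, spIntToReal_sigma_braidH hc hdc,
    spIntToReal_sigma_braidH (d := fun k => d (2 * g - k)) hc.rev, hd.chainProd_mul_reverse (by norm_num)]
  intro i
  have := hdc i.rev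
  rwa [Fin.val_rev, show 2 * g + 1 - (i + 1 : ℕ) = 2 * g - i by omega] at this

theorem orderOf_sigma_braidH (hg : 1 ≤ g) (hc : IsChain c) :
    orderOf (sigma c hc (braidH (2 * g + 1))) = 2 * g + 2 := by
  obtain ⟨d, hd, hdc⟩ := hc.exists_normal
  rw [← orderOf_injective _ spIntToReal_injective, spIntToReal_sigma_braidH hc hdc,
    hd.orderOf_chainProd hg]

theorem theta_sigma_braidH_neg (hc : IsChain c) (u : Fin g ⊕ Fin g → ℝ) (hu : u ≠ 0) :
    theta u ((spIntToReal g (sigma c hc (braidH (2 * g + 1)))).1 *ᵥ u) < 0 := by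
  obtain ⟨d, hd, hdc⟩ := hc.exists_normal
  rw [spIntToReal_sigma_braidH hc hdc]
  exact hd.theta_mulVec_neg (by norm_num) (by omega) hu

theorem hasDisplacementAngle_braidH (hg : 1 ≤ g) (hc : IsChain c) (lam₀ : Lagrangian g) :
    HasDisplacementAngle lam₀ (sigmaTilde c hc (braidH (2 * g + 1))) (-(Real.pi / 2)) := by
  refine ⟨?_, ?_, fun I x hx hxs => ?_⟩
  · rw [sigmaTilde_braidH]
    refine list_prod_mem_spTildeMinus _ fun s hs => ?_
    obtain ⟨i, rfl⟩ := (List.mem_ofFn' _ _).1 hs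
    exact transvectionLift_mem_spTildeMinus lam₀ _
  · obtain ⟨I, x, hx, -, hxA, hxu⟩ := exists_log (theta_sigma_braidH_neg hc)
    obtain ⟨d, hd, hdc⟩ := hc.exists_normal
    refine ⟨I, x, hx, ?_⟩
    rw [sigmaTilde_braidH_eq hc hdc]
    rw [spIntToReal_sigma_braidH hc hdc] at hxA
    exact hd.expTilde_eq (by norm_num) x hxA hxu
  -- The image of `w` conjugates `A` to the action of `h̄`, that is, to `-A⁻¹`.
  · obtain ⟨w, hw⟩ := exists_braidH_conj (2 * g + 1)
    have hxA : NormedSpace.exp x.1 = (spIntToReal g (sigma c hc (braidH (2 * g + 1)))).1 := by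
      rw [← proj_sigmaTilde, ← hxs]
      change _ = NormedSpace.exp (((1 : unitInterval) : ℝ) • x.1)
      simp
    have hW : (spIntToReal g (sigma c hc (braidH (2 * g + 1)))).1 *
        (spIntToReal g (sigma c hc w) * spIntToReal g (sigma c hc (braidH (2 * g + 1))) *
          (spIntToReal g (sigma c hc w))⁻¹).1 = -1 := by
      rw [← map_inv, ← map_inv, ← map_mul, ← map_mul, ← map_mul, ← map_mul, hw,
        sigma_braidH_mul_braidHBar]
    rw [trace_gammaMatrix_log (theta_sigma_braidH_neg hc) hW hx hxA]
    have : (g : ℝ) ≠ 0 := by exact_mod_cast (by omega : g ≠ 0)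
    field_simp

end Representation
end HyperellipticBraid
theorem proposition5p1 (g : ℕ) (hg : 1 ≤ g)
    (c : Fin (2 * g + 1) → Fin g ⊕ Fin g → ℤ) (hc : IsChain c) (lam₀ : Lagrangian g) :
    -- the homomorphism `sigmaTilde` lifts `sigma`, and it sends the standard generators to lifts
    -- acting with fixed points on the universal cover of the Lagrangian Grassmannian
    ((∀ b, UniversalCover.proj (sigmaTilde c hc b) = spIntToReal g (sigma c hc b)) ∧
      ∀ i, ∃ x : UniversalCoverAt (Lagrangian g) lam₀,
        sigmaTilde c hc (braidGen i) • x = x) ∧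
    -- (i)
    (orderOf (sigma c hc (braidH (2 * g + 1))) = 2 * g + 2 ∧
      orderOf (sigma c hc (braidHBar (2 * g + 1))) = 2 * g + 2 ∧
      ∃ I : TameStructure g, IsMaximalCompact I.unitary ∧
        spIntToReal g (sigma c hc (braidH (2 * g + 1))) ∈ I.unitary ∧
        spIntToReal g (sigma c hc (braidHBar (2 * g + 1))) ∈ I.unitary) ∧
    -- (ii)
    (∃ s ∈ spTildeInt g,
      s * sigmaTilde c hc (braidH (2 * g + 1)) * s⁻¹ =
        sigmaTilde c hc (braidHBar (2 * g + 1))) ∧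
    -- (iii)
    HasDisplacementAngle lam₀ (sigmaTilde c hc (braidH (2 * g + 1))) (-(Real.pi / 2)) ∧
    HasDisplacementAngle lam₀ (sigmaTilde c hc (braidHBar (2 * g + 1))) (-(Real.pi / 2)) := by
  refine ⟨⟨proj_sigmaTilde hc, fun i => ?_⟩, ⟨orderOf_sigma_braidH hg hc, ?_, ?_⟩, ?_,
    hasDisplacementAngle_braidH hg hc lam₀, ?_⟩
  · rw [sigmaTilde, braidLift_gen]
    exact exists_transvectionLift_smul_eq lam₀ _
  · rw [sigma_braidHBar]
    exact orderOf_sigma_braidH hg hc.rev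
  -- The `I` found for `h` serves `h̄` as well, which acts as `-A⁻¹`.
  · obtain ⟨I, x, -, hcomm, -⟩ := exists_log (theta_sigma_braidH_neg hc)
    refine ⟨I, I.isMaximalCompact_unitary, hcomm, ?_⟩
    set A := spIntToReal g (sigma c hc (braidH (2 * g + 1)))
    have h1 : (A⁻¹).1 * A.1 = 1 := congrArg Subtype.val (inv_mul_cancel A)
    have h2 := congrArg (fun M => (A⁻¹).1 * M) (sigma_braidH_mul_braidHBar hc)
    simp only [← Matrix.mul_assoc, A, h1, Matrix.one_mul, Matrix.mul_neg, Matrix.mul_one] at h2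
    rw [I.mem_unitary_iff, h2]
    exact Commute.neg_left (I.unitary.inv_mem hcomm)
  · obtain ⟨w, hw⟩ := exists_braidH_conj (2 * g + 1)
    refine ⟨sigmaTilde c hc w, ⟨sigma c hc w, (proj_sigmaTilde hc w).symm⟩, ?_⟩
    rw [← map_inv, ← map_mul, ← map_mul, hw]
  · rw [sigmaTilde_braidHBar]
    exact hasDisplacementAngle_braidH hg hc.rev lam₀
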